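/- **Setting.** Let $k$ be a perfect field of characteristic $2$, let $A=W(k)[[x,y,z]]$, let $n\ge 0$ and $r<n$ be integers, let $G\in A$ be a power series whose coefficient of $xz$ is not divisible by $2$ in $W(k)$, and let $$f=z^2+x^2y+xy^n+xy^{n-r}z+2G\qquad\text{or}\qquad f=z^2+x^2y+y^nz+xy^{n-r}z+2G .$$ Define $(\alpha_i)_{i\ge 0}$ and $(e_i)_{i\ge0}$ by $\alpha_0=0$ and, for $i\ge 0$, by letting $e_i$ be the smallest integer with $2^{e_i}(1+\alpha_i)-1-(n-r)\ge 0$ and putting $\alpha_{i+1}=2^{e_i}(1+\alpha_i)-1-(n-r)$. These sequences depend only on $n-r$. **Multi-height.** For a $\mathbb Z_{(p)}$-algebra $R$ put $\overline R=R/pR$, and let $F^m_*M$ denote the $\overline R$-module $M$ with scalars restricted along the $m$-th power of Frobenius. Let $Q_{R,m}=F_*(W_m(R)/pW_m(R))$ be the $\overline R$-module on which $a$ acts by multiplication by $[a^p]$; it comes with the $\overline R$-linear maps $\Phi_{R,m}\colon\overline R\to Q_{R,m}$, $a\mapsto[a^p]$, and $V^{m-1}\colon F^m_*\overline R\to Q_{R,m}$.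 Put $Q_{R,()}=\overline R$, $Q_{R,(m_0)}=Q_{R,m_0}$ and $\Psi_{R,(m_0)}=\Phi_{R,m_0}$. For $\ell\ge 1$ and integers $m_0,\dots,m_\ell\ge1$ let $Q_{R,(m_0,\dots,m_\ell)}$, with maps $V^{m_0-1}$ from $F^{m_0}_*Q_{R,(m_1,\dots,m_\ell)}$ and $\Psi_{R,(m_0,\dots,m_\ell)}$ from $Q_{R,(m_0,\dots,m_{\ell-1})}$, be the pushout of $$F^{m_0}_*Q_{R,(m_1,\dots,m_\ell)}\xleftarrow{\,F^{m_0}_*\Psi_{R,(m_1,\dots,m_\ell)}\,}F^{m_0}_*Q_{R,(m_1,\dots,m_{\ell-1})}\xrightarrow{\,V^{m_0-1}\,}Q_{R,(m_0,\dots,m_{\ell-1})}.$$ Let $\Phi_{R,(m_0,\dots,m_\ell)}\colon\overline R\to Q_{R,(m_0,\dots,m_\ell)}$ be the composite $\Psi_{R,(m_0,\dots,m_\ell)}\circ\cdots\circ\Psi_{R,(m_0)}$. The ring $R$ has *multi-height* $(h_0,h_1,\dots)$ if for every $\ell\ge0$ the integer $h_\ell$ is the least $h\ge1$ such that $\Phi_{R,(h_0,\dots,h_{\ell-1},h)}$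 splits as a map of $\overline R$-modules. **Theorem.** There exist integers $0\le s<t$ such that $\alpha_{s+i}=\alpha_{t+i}$ for every $i\ge0$. The ring $A/(f)$ has a (unique) multi-height $(h_0,h_1,\dots)$, and the following hold. 1. $h_i\le e_i$ for every $i\ge0$. 2. If $h_j<e_j$ for some $j\ge0$, then $h_i=1$ for all $i>j$. 3. Let $0\le s<t$ be any integers such that $\alpha_{s+i}=\alpha_{t+i}$ for every $i\ge0$. If $h_{t+j}\ge2$ for some $j\ge0$, then $h_i=e_i$ for every $i\ge0$. 4. For any $s<t$ as in (3), $(h_0,h_1,\dots)$ is an element of the finite set $$\bigl([1,e_0]\times[1,e_1]\times\cdots\times[1,e_t]\times\{1\}\times\{1\}\times\cdots\bigr)\cup\{(e_0,e_1,\dots)\}\subseteq\prod_{i\ge0}\mathbb Z_{\ge1}.$$ -/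

import Mathlib

open CategoryTheory CategoryTheory.Limits

universe u

namespace MultiHeight

section

variable (p : ℕ) (R : Type u) [CommRing R]

/-- The reduction `R̄ = R / pR`. -/
abbrev ModP : Type u := R ⧸ Ideal.span {(p : R)}

theorem natCast_modP_eq_zero : ((p : ℕ) : ModP p R) = 0 := by
  have : (Ideal.Quotient.mk (Ideal.span {(p : R)})) (p : R) = 0 :=
    Ideal.Quotient.eq_zero_iff_mem.2 (Ideal.mem_span_singleton_self _)
  simpa using this

variable [hp : Fact p.Prime]

/-- The `n`-th iterate `a ↦ a ^ (p ^ n)` of the Frobenius endomorphism of `R̄`. -/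
def frob (n : ℕ) : ModP p R →+* ModP p R where
  toFun a := a ^ p ^ n
  map_one' := one_pow _
  map_mul' a b := mul_pow a b _
  map_zero' := zero_pow (pow_ne_zero _ hp.out.ne_zero)
  map_add' a b := by
    obtain ⟨c, hc⟩ := exists_add_pow_prime_pow_eq hp.out a b n
    rw [hc, natCast_modP_eq_zero]
    ring

/-- The functor `M ↦ F^n_* M` on `R̄`-modules: restriction of scalars along the `n`-th iterate
of Frobenius. -/
noncomputable abbrev push (n : ℕ) : ModuleCat.{u} (ModP p R) ⥤ ModuleCat.{u} (ModP p R) :=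
  ModuleCat.restrictScalars (frob p R n)

/-- `W_n(R) / p W_n(R)`, where `W_n` denotes `p`-typical Witt vectors of length `n`. -/
abbrev WBar (n : ℕ) : Type u :=
  TruncatedWittVector p n R ⧸ Ideal.span {((p : ℕ) : TruncatedWittVector p n R)}

/-- The projection `W(R) → W_n(R) / p W_n(R)`. -/
noncomputable def toWBar (n : ℕ) : WittVector p R →+* WBar p R n :=
  (Ideal.Quotient.mk _).comp (WittVector.truncate n)

theorem toWBar_mul_p (n : ℕ) (x : WittVector p R) : toWBar p R n (x * (p : ℕ)) = 0 := by
  have : toWBar p R n (((p : ℕ) : WittVector p R)) = 0 := by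
    simp only [toWBar, map_natCast]
    rw [← map_natCast (Ideal.Quotient.mk
      (Ideal.span {((p : ℕ) : TruncatedWittVector p n R)}))]
    exact Ideal.Quotient.eq_zero_iff_mem.2 (Ideal.mem_span_singleton_self _)
  rw [map_mul, this, mul_zero]

/-- Witt vectors with the same zeroth coordinate differ by a Verschiebung. -/
theorem exists_eq_add_verschiebung (x y : WittVector p R) (h : x.coeff 0 = y.coeff 0) :
    ∃ z, x = y + WittVector.verschiebung z := by
  have h0 : ∀ i < 1, (x - y).coeff i = 0 := by
    intro i hi
    obtain rfl : i = 0 := by omega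
    have := map_sub (WittVector.constantCoeff (p := p) (R := R)) x y
    simp only [WittVector.constantCoeff_apply] at this
    rw [this, h, sub_self]
  refine ⟨(x - y).shift 1, ?_⟩
  have := WittVector.eq_iterate_verschiebung (n := 1) h0
  simp only [Function.iterate_one] at this
  rw [← this]
  ring

theorem toWBar_frobenius_congr (n : ℕ) (x y : WittVector p R) (h : x.coeff 0 = y.coeff 0) :
    toWBar p R n (WittVector.frobenius x) = toWBar p R n (WittVector.frobenius y) := by
  obtain ⟨z, rfl⟩ := exists_eq_add_verschiebung p R x y h
  rw [map_add, WittVector.frobenius_verschiebung, map_add, toWBar_mul_p, add_zero]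

theorem toWBar_verschiebung_congr (n : ℕ) (x y : WittVector p R) (h : x.coeff 0 = y.coeff 0) :
    toWBar p R n (WittVector.verschiebung^[n - 1] x) =
      toWBar p R n (WittVector.verschiebung^[n - 1] y) := by
  obtain ⟨z, rfl⟩ := exists_eq_add_verschiebung p R x y h
  rw [iterate_map_add, map_add, add_eq_left, ← Function.iterate_succ_apply]
  have : WittVector.truncate n (WittVector.verschiebung^[(n - 1).succ] z) = 0 := by
    ext i
    rw [WittVector.coeff_truncate, TruncatedWittVector.coeff_zero]
    exact WittVector.iterate_verschiebung_coeff_eq_zero _ (by have := i.2; omega)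
  rw [toWBar, RingHom.comp_apply, this, map_zero]

/-- The ring homomorphism `R → W_n(R) / p W_n(R)`, `a ↦ F [a] = [a ^ p]`. -/
noncomputable def frobTeich (n : ℕ) : R →+* WBar p R n where
  toFun a := toWBar p R n (WittVector.frobenius (WittVector.teichmuller p a))
  map_one' := by simp
  map_mul' a b := by simp
  map_zero' := by simp
  map_add' a b := by
    rw [← map_add, ← map_add]
    apply toWBar_frobenius_congr
    have := map_add (WittVector.constantCoeff (p := p) (R := R))
      (WittVector.teichmuller p a) (WittVector.teichmuller p b)
    simp only [WittVector.constantCoeff_apply] at this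
    simp [this]

/-- The ring homomorphism `R̄ → W_n(R) / p W_n(R)`, `a ↦ F [a] = [a ^ p]`. -/
noncomputable def frobWitt (n : ℕ) : ModP p R →+* WBar p R n :=
  Ideal.Quotient.lift _ (frobTeich p R n) (by
    intro a ha
    obtain ⟨b, rfl⟩ := Ideal.mem_span_singleton'.1 ha
    have h1 := toWBar_mul_p p R n 1
    rw [one_mul, map_natCast] at h1
    rw [map_mul, map_natCast, h1, mul_zero])

/-- The `R̄`-module `Q_{R,n} = F_* (W_n(R) / p W_n(R))`: a scalar `a` acts as multiplication by
`[a ^ p]`. -/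
noncomputable def QOne (n : ℕ) : ModuleCat.{u} (ModP p R) :=
  (ModuleCat.restrictScalars (frobWitt p R n)).obj (ModuleCat.of (WBar p R n) (WBar p R n))

/-- The `R̄`-linear map `Φ_{R,n} : R̄ → Q_{R,n}`, `a ↦ [a ^ p]`. -/
noncomputable def PhiOne (n : ℕ) : ModuleCat.of (ModP p R) (ModP p R) ⟶ QOne p R n :=
  ModuleCat.ofHom (Y := QOne p R n)
    { toFun := fun a => (frobWitt p R n a : WBar p R n)
      map_add' := fun a b => map_add (frobWitt p R n) a b
      map_smul' := fun a b => map_mul (frobWitt p R n) a b }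

/-- The additive map `R → W_n(R) / p W_n(R)`, `a ↦ V^{n-1} [a]`. -/
noncomputable def verTeich (n : ℕ) : R →+ WBar p R n where
  toFun a := toWBar p R n (WittVector.verschiebung^[n - 1] (WittVector.teichmuller p a))
  map_zero' := by
    rw [WittVector.teichmuller_zero, iterate_map_zero, map_zero]
  map_add' a b := by
    rw [← map_add, ← iterate_map_add]
    apply toWBar_verschiebung_congr
    have := map_add (WittVector.constantCoeff (p := p) (R := R))
      (WittVector.teichmuller p a) (WittVector.teichmuller p b)
    simp only [WittVector.constantCoeff_apply] at this
    simp [this]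

/-- The additive map `R̄ → W_n(R) / p W_n(R)`, `a ↦ V^{n-1} [a]`. -/
noncomputable def verWitt (n : ℕ) : ModP p R →+ WBar p R n :=
  QuotientAddGroup.lift (Ideal.span {(p : R)}).toAddSubgroup (verTeich p R n) (by
    intro a ha
    obtain ⟨b, rfl⟩ := Ideal.mem_span_singleton'.1 ha
    rw [AddMonoidHom.mem_ker, mul_comm, ← nsmul_eq_mul, map_nsmul, nsmul_eq_mul, mul_comm]
    have h1 := toWBar_mul_p p R n 1
    rw [one_mul, map_natCast] at h1
    rw [h1, mul_zero])

theorem frobenius_coeff_zero (x : WittVector p R) :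
    (Ideal.Quotient.mk (Ideal.span {(p : R)})) ((WittVector.frobenius x).coeff 0) =
      (Ideal.Quotient.mk (Ideal.span {(p : R)})) (x.coeff 0) ^ p := by
  have h0 := natCast_modP_eq_zero p R
  rw [WittVector.coeff_frobenius, WittVector.frobeniusPoly]
  simp only [map_add, map_mul, map_pow, MvPolynomial.aeval_X, MvPolynomial.aeval_C]
  simp [h0]

theorem iterate_frobenius_coeff_zero (m : ℕ) (x : WittVector p R) :
    (Ideal.Quotient.mk (Ideal.span {(p : R)})) ((WittVector.frobenius^[m] x).coeff 0) =
      (Ideal.Quotient.mk (Ideal.span {(p : R)})) (x.coeff 0) ^ p ^ m := by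
  induction m with
  | zero => simp
  | succ m ih =>
    rw [Function.iterate_succ_apply', frobenius_coeff_zero, ih, ← pow_mul, pow_succ]

theorem verWitt_coeff_zero (n : ℕ) (x : WittVector p R) :
    toWBar p R n (WittVector.verschiebung^[n - 1] x) =
      verWitt p R n (Ideal.Quotient.mk (Ideal.span {(p : R)}) (x.coeff 0)) := by
  change _ = toWBar p R n
    (WittVector.verschiebung^[n - 1] (WittVector.teichmuller p (x.coeff 0)))
  apply toWBar_verschiebung_congr
  simp

/-- The projection formula `V^{n-1} (a ^ (p ^ n) b) = [a ^ p] V^{n-1} (b)`. -/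
theorem verWitt_mul (n : ℕ) (a b : ModP p R) :
    verWitt p R n (frob p R n a * b) = frobWitt p R n a * verWitt p R n b := by
  obtain ⟨a, rfl⟩ := Ideal.Quotient.mk_surjective a
  obtain ⟨b, rfl⟩ := Ideal.Quotient.mk_surjective b
  rcases n with _ | n
  · have : Subsingleton (WBar p R 0) := by
      have : Subsingleton (TruncatedWittVector p 0 R) := ⟨fun x y => by ext i; exact i.elim0⟩
      exact Function.Surjective.subsingleton Ideal.Quotient.mk_surjective
    exact Subsingleton.elim _ _
  have h1 : frobWitt p R (n + 1) (Ideal.Quotient.mk _ a) =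
      toWBar p R (n + 1) (WittVector.frobenius (WittVector.teichmuller p a)) := rfl
  have h2 : verWitt p R (n + 1) (Ideal.Quotient.mk _ b) =
      toWBar p R (n + 1) (WittVector.verschiebung^[n] (WittVector.teichmuller p b)) := rfl
  rw [h1, h2, ← map_mul, mul_comm (WittVector.frobenius _), WittVector.iterate_verschiebung_mul_left]
  have h3 := verWitt_coeff_zero p R (n + 1) (WittVector.teichmuller p b *
    WittVector.frobenius^[n] (WittVector.frobenius (WittVector.teichmuller p a)))
  rw [Nat.add_sub_cancel] at h3
  rw [h3, WittVector.mul_coeff_zero, ← Function.iterate_succ_apply,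
    map_mul (Ideal.Quotient.mk _),
    iterate_frobenius_coeff_zero, mul_comm]
  simp [frob]

/-- The `R̄`-linear map `V^{n-1} : F^n_* R̄ → Q_{R,n}`. -/
noncomputable def verOne (n : ℕ) :
    (push p R n).obj (ModuleCat.of (ModP p R) (ModP p R)) ⟶ QOne p R n :=
  ModuleCat.ofHom (X := (push p R n).obj (ModuleCat.of (ModP p R) (ModP p R)))
    (Y := QOne p R n)
    { toFun := fun a => (verWitt p R n (a : ModP p R) : WBar p R n)
      map_add' := fun a b => map_add (verWitt p R n) a b
      map_smul' := fun a b => verWitt_mul p R n a b }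

/-- The data of the modules `Q_{R,(n_0,…,n_{r-1})}` (field `dom`) and `Q_{R,(n_0,…,n_r)}`
(field `cod`) for one fixed `r` and all sequences `n`, with the maps
`Ψ_{R,(n_0,…,n_r)} : Q_{R,(n_0,…,n_{r-1})} → Q_{R,(n_0,…,n_r)}` and
`V^{n_0-1} : F^{n_0}_* Q_{R,(n_1,…,n_r)} → Q_{R,(n_0,…,n_r)}`.
The module belonging to the empty tuple is `R̄`. -/
structure Level where
  dom : (ℕ → ℕ) → ModuleCat.{u} (ModP p R)
  cod : (ℕ → ℕ) → ModuleCat.{u} (ModP p R)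
  psi : ∀ n : ℕ → ℕ, dom n ⟶ cod n
  ver : ∀ n : ℕ → ℕ, (push p R (n 0)).obj (dom fun i => n (i + 1)) ⟶ cod n

/-- The inductive construction of the modules `Q_{R,(n_0,…,n_r)}`. For `r = 0` one takes
`Q_{R,n_0}`, `Φ_{R,n_0}` and `V^{n_0-1}`. In the step, `Q_{R,(n_0,…,n_{r+1})}` is the pushout of
`F^{n_0}_* Ψ_{R,(n_1,…,n_{r+1})} : F^{n_0}_* Q_{R,(n_1,…,n_r)} → F^{n_0}_* Q_{R,(n_1,…,n_{r+1})}`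
and `V^{n_0-1} : F^{n_0}_* Q_{R,(n_1,…,n_r)} → Q_{R,(n_0,…,n_r)}`. Only the entries
`n_0, …, n_r` of the sequence `n` enter into `(level p R r).cod n`. -/
noncomputable def level : ℕ → Level p R
  | 0 =>
    { dom := fun _ => ModuleCat.of (ModP p R) (ModP p R)
      cod := fun n => QOne p R (n 0)
      psi := fun n => PhiOne p R (n 0)
      ver := fun n => verOne p R (n 0) }
  | r + 1 =>
    { dom := (level r).cod
      cod := fun n =>
        pushout ((push p R (n 0)).map ((level r).psi fun i => n (i + 1))) ((level r).ver n)
      psi := fun n =>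
        pushout.inr ((push p R (n 0)).map ((level r).psi fun i => n (i + 1))) ((level r).ver n)
      ver := fun n =>
        pushout.inl ((push p R (n 0)).map ((level r).psi fun i => n (i + 1))) ((level r).ver n) }

/-- The map `Φ_{R,(n_0,…,n_r)} : R̄ → Q_{R,(n_0,…,n_r)}`, the composite
`Ψ_{R,(n_0,…,n_r)} ∘ ⋯ ∘ Ψ_{R,(n_0,n_1)} ∘ Ψ_{R,(n_0)}`. -/
noncomputable def Phi : ∀ (r : ℕ) (n : ℕ → ℕ),
    ModuleCat.of (ModP p R) (ModP p R) ⟶ (level p R r).cod n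
  | 0, n => (level p R 0).psi n
  | r + 1, n => Phi r n ≫ (level p R (r + 1)).psi n

/-- `R` has quasi-`F`-split multi-height `h = (h_0, h_1, …)`: for every `r`, the number `h_r` is
the least `m ≥ 1` such that `Φ_{R,(h_0,…,h_{r-1},m)}` splits as a map of `R̄`-modules. -/
def IsMultiHeight (h : ℕ → ℕ) : Prop :=
  ∀ r : ℕ, IsLeast
    {m : ℕ | 1 ≤ m ∧ IsSplitMono (Phi p R r fun i => if i < r then h i else m)} (h r)

end

/-- The smallest `e` with `2 ^ e * (1 + α) - 1 - N ≥ 0`. (For `0 ≤ α < N`, as is the case below,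
every integer `e` with this property is positive.) -/
noncomputable def xzStep (N α : ℤ) : ℕ :=
  sInf {e : ℕ | 0 ≤ 2 ^ e * (1 + α) - 1 - N}

/-- `α_0 = 0` and `α_{i+1} = 2 ^ {e_i} (1 + α_i) - 1 - N`. -/
noncomputable def xzAlpha (N : ℤ) : ℕ → ℤ
  | 0 => 0
  | i + 1 => 2 ^ xzStep N (xzAlpha N i) * (1 + xzAlpha N i) - 1 - N

/-- `e_i` is the smallest integer with `2 ^ {e_i} (1 + α_i) - 1 - N ≥ 0`. -/
noncomputable def xzE (N : ℤ) (i : ℕ) : ℕ := xzStep N (xzAlpha N i)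

/-- The set `([1,e_0] × ⋯ × [1,e_t] × {1} × {1} × ⋯) ∪ {(e_0, e_1, …)}` of sequences. -/
def possibleHeights (e : ℕ → ℕ) (t : ℕ) : Set (ℕ → ℕ) :=
  {g | (∀ i ≤ t, 1 ≤ g i ∧ g i ≤ e i) ∧ ∀ i > t, g i = 1} ∪ {e}

end MultiHeight

/-!
The theorem rests on a Fedder type criterion which turns the multi-height of `R = A / (f)` into a
question about ideals of `B = k[[x, y, z]] = A / 2A`, and on a computation with monomials.

*The criterion.* The ring `A` carries a lift `φ` of Frobenius, hence a section `s : A → W(A)` with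
`F s = s φ` (`exists_wittSection`), and `B` carries a trace `u` generating the Cartier-linear maps
(`tr`, `eq_sum_monomial_mul_tr_sq`). By duality for the iterated Frobenius on `R̄ = B / (f)`
(`CartierSetting.exists_linearMap_eq_τ_iterate`), `R̄`-linear forms on `Q_{R,m}` become additive
maps on `W(A)` (`CartierSetting.IsForm`), which are determined by their restrictions to `s(A)` and
`V W(A)`. Both restrictions are given by elements of `B`, and the relation `[f] s(a) = 0` in `W(R)`
links them: if `[f] = s(f) + V γ`, then `γ = s(c) + V(γ ^ 2 + s(φ f) γ)`, where `2 c = f ^ 2 - φ(f)`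
(`CartierSetting.gamma_eq`). Inductively the possible values at `Φ (1)` form the ideal `u(I_m)`,
where `I_1 = f J` and `I_{j+1} = u(c I_j) + (f)` (`CartierSetting.IsForm.exists_mem_fedder`,
`CartierSetting.exists_isForm_sec`); here `J` records the admissible restrictions to `V ^ (m - 1)`.
Pasting the pushout squares shows that for the modules `Q_{R,(m_0,…,m_ℓ)}` the ideal `J` is the
ideal of values belonging to `(m_1,…,m_ℓ)` (`CartierSetting.comap_valueIdeal_succ`). Reading this
backwards from the maximal ideal yields a chain `P_0 = 𝔪`,
`P_{i+1} = (P_i^{[2 ^ {h_i}]} : f c ^ (2 ^ {h_i - 1} - 1))` such that `h_i` is the least `m ≥ 1`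
with `f c ^ (2 ^ (m - 1) - 1) ∉ P_i^{[2 ^ m]}` (`CartierSetting.isMultiHeight_iff`).

*The computation.* Put `N = n - r`. Modulo two, `c` is the second elementary symmetric function of
the four terms of `f` plus `G ^ 2`. The operator `v`, which extracts the part of odd degree in `x`
and in `z` and divides it by `x z`, satisfies `v(f) = y ^ N` and
`v(f c) = y ^ N ((G + z² + x² y + m)² + y (x z)²)`, where `m` is the third term of `f`. Since the
coefficient of `x z` in `G` is a unit, it follows for an ideal `P = (x, z, y ^ M)` that
`f c ^ (2 ^ (h - 1) - 1) ∉ P^{[2 ^ h]}` as soon as `N < 2 ^ h M`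
(`Coords.XZForm.y_pow_mul_testElt_notMem`, with `h = 1` if `n = 0`; in that case `f` lies in the
Frobenius power of no proper ideal), and that conversely, if `x` and `z` lie in the next ideal of
the chain, then `h` is the least number with this property and the next ideal is
`(x, z, y ^ (2 ^ h M - N))` (`Coords.XZForm.eq_and_isXZ_nextIdeal`). With `M_i = 1 + α_i` this is
the recursion defining `e_i` and `α_i`. On the other hand `h_i ≥ 2` forces `x, z ∈ P_i`, and
`x, z ∈ P_{i+1}` forces `x, z ∈ P_i`. So once an entry falls short of `e_i`, the element `x` or `z`
has left the chain for good and all later entries are `1`. If `h_{t+j} ≥ 2`, then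
`P_s = (x, z, y ^ (1 + α_s)) = P_t`, the chain is periodic, and entries `≥ 2` recur forever, which
forces `h_i = e_i` throughout.
-/

set_option linter.unusedSectionVars false

namespace MultiHeight

/-! ### Witt vectors and lifts of Frobenius -/

section FrobeniusLift

variable {p : ℕ} [hp : Fact p.Prime] {A : Type*} [CommRing A]

theorem ghostComponent_eq_sum (x : WittVector p A) (n : ℕ) :
    WittVector.ghostComponent n x =
      ∑ i ∈ Finset.range (n + 1), (p : A) ^ i * x.coeff i ^ p ^ (n - i) := by
  rw [WittVector.ghostComponent_apply, aeval_wittPolynomial]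

/-- Over a domain of characteristic zero a Witt vector is determined by its ghost components. -/
theorem ghostMap_injective [IsDomain A] [CharZero A] :
    Function.Injective (WittVector.ghostMap : WittVector p A →+* ℕ → A) := by
  intro x y hxy
  have : CharZero (FractionRing A) :=
    charZero_of_injective_algebraMap (IsFractionRing.injective A (FractionRing A))
  have : Invertible (p : FractionRing A) :=
    invertibleOfNonzero (Nat.cast_ne_zero.2 hp.out.ne_zero)
  apply WittVector.map_injective (algebraMap A (FractionRing A))
    (IsFractionRing.injective A (FractionRing A))
  apply (WittVector.ghostMap.bijective_of_invertible p (FractionRing A)).1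
  have key : ∀ (z : WittVector p A) (n : ℕ),
      WittVector.ghostComponent n (WittVector.map (algebraMap A (FractionRing A)) z) =
        algebraMap A (FractionRing A) (WittVector.ghostComponent n z) := by
    intro z n
    simp [ghostComponent_eq_sum]
  ext n
  rw [WittVector.ghostMap_apply, WittVector.ghostMap_apply, key, key,
    ← WittVector.ghostMap_apply, ← WittVector.ghostMap_apply, hxy]

theorem frobenius_teichmuller [IsDomain A] [CharZero A] (a : A) :
    WittVector.frobenius (WittVector.teichmuller p a) = WittVector.teichmuller p a ^ p := by
  apply ghostMap_injective
  ext n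
  rw [WittVector.ghostMap_apply, WittVector.ghostMap_apply, WittVector.ghostComponent_frobenius,
    map_pow, WittVector.ghostComponent_teichmuller, WittVector.ghostComponent_teichmuller,
    ← pow_mul, pow_succ]

theorem witt_eq_zero_of_natCast_mul [IsDomain A] [CharZero A] {x : WittVector p A}
    (h : (p : WittVector p A) * x = 0) : x = 0 := by
  apply ghostMap_injective
  ext n
  have := congrFun (congrArg WittVector.ghostMap h) n
  rw [map_mul, map_natCast, map_zero, Pi.mul_apply, Pi.natCast_apply, Pi.zero_apply] at this
  rw [map_zero, Pi.zero_apply]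
  exact (mul_eq_zero.1 this).resolve_left (Nat.cast_ne_zero.2 hp.out.ne_zero)

/-- A sequence `(φ ^ n (a))` of iterated values of a Frobenius lift is the sequence of ghost
components of a Witt vector. The coefficients are found one after the other. -/
theorem exists_ghostComponent_eq (φ : A →+* A) (hφ : ∀ a, (p : A) ∣ φ a - a ^ p) (a : A) :
    ∃ x : WittVector p A, ∀ n, WittVector.ghostComponent n x = φ^[n] a := by
  -- The `n`-th coefficient can be chosen once the earlier ones have the required ghost components,
  -- since these determine the `n`-th ghost component modulo `p ^ n`.
  have step : ∀ (n : ℕ) (y : ℕ → A), (∀ j < n, ∑ i ∈ Finset.range (j + 1),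
      (p : A) ^ i * y i ^ p ^ (j - i) = φ^[j] a) →
      ∃ b, ∑ i ∈ Finset.range n, (p : A) ^ i * y i ^ p ^ (n - i) + (p : A) ^ n * b = φ^[n] a := by
    intro n y hy
    rcases n with _ | n
    · exact ⟨a, by simp⟩
    · have h1 : (p : A) ^ (n + 1) ∣ φ^[n + 1] a -
          ∑ i ∈ Finset.range (n + 1), (p : A) ^ i * y i ^ p ^ (n + 1 - i) := by
        rw [Function.iterate_succ_apply', ← hy n (Nat.lt_succ_self n), map_sum,
          ← Finset.sum_sub_distrib]
        refine Finset.dvd_sum fun i hi => ?_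
        have hi' : i ≤ n := Nat.lt_succ_iff.1 (Finset.mem_range.1 hi)
        have h2 := dvd_sub_pow_of_dvd_sub (hφ (y i)) (n - i)
        rw [map_mul, map_pow, map_natCast, map_pow, ← mul_sub,
          show n + 1 = i + (n - i + 1) by omega, pow_add]
        refine mul_dvd_mul_left _ ?_
        rwa [← pow_mul, ← pow_succ', show i + (n - i + 1) - i = n - i + 1 by omega] at *
      obtain ⟨b, hb⟩ := h1
      exact ⟨b, by rw [← hb]; ring⟩
  choose! b hb using step
  let y : ℕ → A := fun n => Nat.strongRec (motive := fun _ => A)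
    (fun n ih => b n fun i => if h : i < n then ih i h else 0) n
  have hy : ∀ n, y n = b n fun i => if i < n then y i else 0 := by
    intro n
    simp only [y]
    rw [Nat.strongRec_eq]
    rfl
  have main : ∀ n, ∑ i ∈ Finset.range (n + 1), (p : A) ^ i * y i ^ p ^ (n - i) = φ^[n] a := by
    intro n
    induction n using Nat.strong_induction_on with
    | _ n ih =>
      have e : ∀ j, j ≤ n → ∀ m, ∑ i ∈ Finset.range j,
          (p : A) ^ i * (if i < n then y i else 0) ^ p ^ (m - i) =
            ∑ i ∈ Finset.range j, (p : A) ^ i * y i ^ p ^ (m - i) := by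
        intro j hj m
        refine Finset.sum_congr rfl fun i hi => ?_
        rw [if_pos (lt_of_lt_of_le (Finset.mem_range.1 hi) hj)]
      have h1 := hb n (fun i => if i < n then y i else 0) (fun j hj => by
        rw [e (j + 1) hj, ih j hj])
      rw [e n le_rfl, ← hy n] at h1
      rw [Finset.sum_range_succ, Nat.sub_self, pow_zero, pow_one, h1]
  refine ⟨WittVector.mk p y, fun n => ?_⟩
  rw [ghostComponent_eq_sum, ← main n]
  rfl

/-- A ring homomorphism `s : A → W(A)` which is a section of the zeroth coordinate and carries
a lift `φ` of Frobenius to the Frobenius of `W(A)`. -/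
structure WittSection (p : ℕ) [Fact p.Prime] {A : Type*} [CommRing A] (φ : A →+* A) where
  toHom : A →+* WittVector p A
  coeff_zero : ∀ a, (toHom a).coeff 0 = a
  frobenius : ∀ a, WittVector.frobenius (toHom a) = toHom (φ a)

/-- A Frobenius lift on a domain of characteristic zero induces a section of `W(A) → A`. -/
theorem exists_wittSection [IsDomain A] [CharZero A] (φ : A →+* A)
    (hφ : ∀ a, (p : A) ∣ φ a - a ^ p) : Nonempty (WittSection p φ) := by
  choose s hs using exists_ghostComponent_eq φ hφ
  have inj : ∀ {x y : WittVector p A},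
      (∀ n, WittVector.ghostComponent n x = WittVector.ghostComponent n y) → x = y :=
    fun h => ghostMap_injective (funext h)
  refine ⟨⟨⟨⟨⟨s, ?_⟩, ?_⟩, ?_, ?_⟩, ?_, ?_⟩⟩
  · exact inj fun n => by rw [hs, map_one, iterate_map_one]
  · intro a b
    exact inj fun n => by rw [hs, map_mul, hs, hs, iterate_map_mul]
  · exact inj fun n => by rw [hs, map_zero, iterate_map_zero]
  · intro a b
    exact inj fun n => by rw [hs, map_add, hs, hs, iterate_map_add]
  · intro a
    have := hs a 0
    rw [ghostComponent_eq_sum] at this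
    simpa using this
  · intro a
    refine inj fun n => ?_
    change WittVector.ghostComponent n (WittVector.frobenius (s a)) =
      WittVector.ghostComponent n (s (φ a))
    rw [WittVector.ghostComponent_frobenius, hs, hs, Function.iterate_succ_apply]

end FrobeniusLift

/-! ### Power series and their trace in characteristic two -/

section PowerSeriesLift

variable (p : ℕ) [hp : Fact p.Prime] {σ : Type*} [Finite σ] {k : Type*} [Field k] [CharP k p]

/-- The Frobenius lift on `W(k)[[σ]]` which is the Witt vector Frobenius on coefficients and raises
every variable to the `p`-th power. -/
noncomputable def frobLift :
    MvPowerSeries σ (WittVector p k) →+* MvPowerSeries σ (WittVector p k) :=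
  (MvPowerSeries.map WittVector.frobenius).comp
    (MvPowerSeries.expand p hp.out.ne_zero).toRingHom

theorem frobLift_X (i : σ) :
    frobLift p (MvPowerSeries.X i : MvPowerSeries σ (WittVector p k)) =
      MvPowerSeries.X i ^ p := by
  simp [frobLift]

/-- Reduction of coefficients, `W(k)[[σ]] → k[[σ]]`. -/
noncomputable def redPS : MvPowerSeries σ (WittVector p k) →+* MvPowerSeries σ k :=
  MvPowerSeries.map WittVector.constantCoeff

theorem redPS_surjective :
    Function.Surjective (redPS p : MvPowerSeries σ (WittVector p k) → MvPowerSeries σ k) := by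
  intro g
  refine ⟨fun d => WittVector.teichmuller p (MvPowerSeries.coeff d g), ?_⟩
  ext d
  exact (MvPowerSeries.coeff_map _ _ _).trans (WittVector.teichmuller_coeff_zero p _)

theorem redPS_eq_zero_iff [PerfectRing k p] (a : MvPowerSeries σ (WittVector p k)) :
    redPS p a = 0 ↔ (p : MvPowerSeries σ (WittVector p k)) ∣ a := by
  constructor
  · intro h
    have h1 : ∀ d, ∃ c, MvPowerSeries.coeff d a = (p : WittVector p k) * c := by
      intro d
      have h2 := congrArg (MvPowerSeries.coeff d) h
      rw [redPS, MvPowerSeries.coeff_map, map_zero] at h2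
      have h3 : MvPowerSeries.coeff d a ∈
          RingHom.ker (WittVector.constantCoeff (p := p) (R := k)) :=
        h2
      rw [WittVector.ker_constantCoeff] at h3
      obtain ⟨c, hc⟩ := Ideal.mem_span_singleton.1 h3
      exact ⟨c, hc⟩
    choose c hc using h1
    let b : MvPowerSeries σ (WittVector p k) := c
    have hb : ∀ d, MvPowerSeries.coeff d b = c d := fun _ => rfl
    refine ⟨b, ?_⟩
    ext1 d
    rw [hc d, ← map_natCast (MvPowerSeries.C (σ := σ) (R := WittVector p k)),
      MvPowerSeries.coeff_C_mul, hb]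
  · rintro ⟨b, rfl⟩
    have : redPS p (p : MvPowerSeries σ (WittVector p k)) = 0 := by
      rw [map_natCast, ← map_natCast (MvPowerSeries.C (σ := σ) (R := k)), CharP.cast_eq_zero,
        map_zero]
    rw [map_mul, this, zero_mul]

theorem redPS_frobLift (a : MvPowerSeries σ (WittVector p k)) :
    redPS p (frobLift p a) = redPS p a ^ p := by
  have : ExpChar k p := ExpChar.prime hp.out
  rw [← MvPowerSeries.map_frobenius_expand p hp.out.ne_zero]
  simp only [redPS, frobLift, RingHom.comp_apply]
  rw [MvPowerSeries.map_map, ← MvPowerSeries.map_expand, MvPowerSeries.map_map]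
  congr 1
  congr 1
  ext x
  simp [WittVector.coeff_frobenius_charP, frobenius_def]

theorem frobLift_sub_pow_dvd [PerfectRing k p] (a : MvPowerSeries σ (WittVector p k)) :
    (p : MvPowerSeries σ (WittVector p k)) ∣ frobLift p a - a ^ p := by
  rw [← redPS_eq_zero_iff, map_sub, redPS_frobLift, map_pow, sub_self]

end PowerSeriesLift

section Trace

variable {σ : Type*} [Fintype σ] [DecidableEq σ] {k : Type*} [Field k] [CharP k 2] [PerfectRing k 2]

/-- The exponent of the squarefree monomial `∏ i ∈ T, X i`. -/
noncomputable def sqfreeExp (T : Finset σ) : σ →₀ ℕ :=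
  Finsupp.equivFunOnFinite.symm fun i => if i ∈ T then 1 else 0

@[simp]
theorem sqfreeExp_apply (T : Finset σ) (i : σ) : sqfreeExp T i = if i ∈ T then 1 else 0 := rfl

/-- The trace (generator of the Cartier-linear maps) on `k[[σ]]` in characteristic two:
the coefficient of `X ^ d` in `tr g` is the square root of the coefficient of
`X ^ (2 d + (1, …, 1))` in `g`. -/
noncomputable def tr : MvPowerSeries σ k →+ MvPowerSeries σ k where
  toFun g := fun d => (frobeniusEquiv k 2).symm
    (MvPowerSeries.coeff (2 • d + sqfreeExp Finset.univ) g)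
  map_zero' := by
    ext d
    change (frobeniusEquiv k 2).symm _ = _
    simp
  map_add' a b := by
    ext d
    change (frobeniusEquiv k 2).symm _ = (frobeniusEquiv k 2).symm _ + (frobeniusEquiv k 2).symm _
    simp

theorem coeff_tr (g : MvPowerSeries σ k) (d : σ →₀ ℕ) :
    MvPowerSeries.coeff d (tr g) = (frobeniusEquiv k 2).symm
      (MvPowerSeries.coeff (2 • d + sqfreeExp Finset.univ) g) := rfl

theorem coeff_sq_two_smul [Finite σ] (a : MvPowerSeries σ k) (d : σ →₀ ℕ) :
    MvPowerSeries.coeff (2 • d) (a ^ 2) = MvPowerSeries.coeff d a ^ 2 := by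
  have : ExpChar k 2 := ExpChar.prime Nat.prime_two
  rw [← MvPowerSeries.map_frobenius_expand 2 two_ne_zero, MvPowerSeries.coeff_map,
    MvPowerSeries.coeff_expand_smul, frobenius_def]

theorem coeff_sq_of_odd [Finite σ] (a : MvPowerSeries σ k) {d : σ →₀ ℕ} {i : σ} (h : ¬ 2 ∣ d i) :
    MvPowerSeries.coeff d (a ^ 2) = 0 := by
  have : ExpChar k 2 := ExpChar.prime Nat.prime_two
  rw [← MvPowerSeries.map_frobenius_expand 2 two_ne_zero, MvPowerSeries.coeff_map,
    MvPowerSeries.coeff_expand_of_not_dvd 2 two_ne_zero _ h, map_zero]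

theorem exists_two_smul_eq {d : σ →₀ ℕ} (h : ∀ i, 2 ∣ d i) : ∃ m : σ →₀ ℕ, 2 • m = d :=
  ⟨d.mapRange (fun a => a / 2) rfl, by ext i; simp [Nat.mul_div_cancel' (h i)]⟩

theorem tr_sq_mul (a g : MvPowerSeries σ k) : tr (a ^ 2 * g) = a * tr g := by
  ext d
  rw [coeff_tr, MvPowerSeries.coeff_mul, MvPowerSeries.coeff_mul, map_sum]
  symm
  refine Finset.sum_of_injOn (fun x => (2 • x.1, 2 • x.2 + sqfreeExp Finset.univ)) ?_ ?_ ?_ ?_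
  · rintro ⟨x, y⟩ _ ⟨x', y'⟩ _ h
    simp only [Prod.mk.injEq, add_left_inj] at h
    have := nsmul_right_injective (M := σ →₀ ℕ) (n := 2) two_ne_zero
    rw [this h.1, this h.2]
  · rintro ⟨x, y⟩ h
    rw [Finset.mem_coe, Finset.HasAntidiagonal.mem_antidiagonal] at h ⊢
    simp only at h ⊢
    rw [← h, smul_add, add_assoc]
  · rintro ⟨x, y⟩ h h'
    rw [Finset.HasAntidiagonal.mem_antidiagonal] at h
    simp only at h
    by_cases hx : ∀ i, 2 ∣ x i
    · exfalso
      apply h'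
      obtain ⟨m, rfl⟩ := exists_two_smul_eq hx
      have hle : ∀ i, m i ≤ d i := by
        intro i
        have := DFunLike.congr_fun h i
        simp at this
        omega
      refine ⟨(m, d - m), ?_, ?_⟩
      · rw [Finset.mem_coe, Finset.HasAntidiagonal.mem_antidiagonal]
        ext i
        simp [hle i]
      · simp only [Prod.mk.injEq, true_and]
        ext i
        have := DFunLike.congr_fun h i
        have := hle i
        simp at *
        omega
    · push Not at hx
      obtain ⟨i, hi⟩ := hx
      rw [coeff_sq_of_odd a hi, zero_mul, map_zero]
  · rintro ⟨x, y⟩ _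
    simp only [coeff_sq_two_smul, map_mul, coeff_tr]
    congr 1
    exact ((frobeniusEquiv k 2).symm_apply_apply _).symm

theorem tr_monomial_of_even (d : σ →₀ ℕ) (a : k) (i : σ) (h : 2 ∣ d i) :
    tr (MvPowerSeries.monomial d a) = 0 := by
  ext m
  rw [coeff_tr, MvPowerSeries.coeff_monomial, if_neg, map_zero, map_zero]
  rintro rfl
  simp at h

theorem tr_monomial (d : σ →₀ ℕ) :
    tr (MvPowerSeries.monomial (2 • d + sqfreeExp Finset.univ) (1 : k)) =
      MvPowerSeries.monomial d 1 := by
  ext m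
  rw [coeff_tr, MvPowerSeries.coeff_monomial, MvPowerSeries.coeff_monomial]
  have := nsmul_right_injective (M := σ →₀ ℕ) (n := 2) two_ne_zero
  by_cases h : m = d
  · subst h; simp
  · rw [if_neg h, if_neg, map_zero]
    exact fun h' => h (this (add_right_cancel h'))

theorem tr_surjective : Function.Surjective (tr : MvPowerSeries σ k → MvPowerSeries σ k) := by
  intro g
  refine ⟨g ^ 2 * MvPowerSeries.monomial (2 • 0 + sqfreeExp Finset.univ) (1 : k), ?_⟩
  rw [tr_sq_mul, tr_monomial, MvPowerSeries.monomial_zero_one, mul_one]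

/-- Squarefree monomials are a basis of `k[[σ]]` over its squares; complementary monomials form the
dual basis for the trace. -/
theorem eq_sum_monomial_mul_tr_sq (g : MvPowerSeries σ k) :
    g = ∑ T : Finset σ, MvPowerSeries.monomial (sqfreeExp T) 1 *
      tr (MvPowerSeries.monomial (sqfreeExp Tᶜ) 1 * g) ^ 2 := by
  ext d
  rw [map_sum]
  let T : Finset σ := Finset.univ.filter fun i => ¬ 2 ∣ d i
  obtain ⟨m, hm⟩ : ∃ m, 2 • m + sqfreeExp T = d := by
    refine ⟨d.mapRange (fun a => a / 2) rfl, ?_⟩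
    ext i
    by_cases h : d i % 2 = 1 <;> simp [T, h] <;> omega
  have hmT : 2 • m + sqfreeExp Finset.univ = sqfreeExp Tᶜ + d := by
    rw [← hm]
    ext i
    by_cases h : i ∈ T <;> simp [h, add_comm]
  rw [Finset.sum_eq_single T]
  · rw [← hm, add_comm (2 • m), MvPowerSeries.coeff_add_monomial_mul, one_mul, coeff_sq_two_smul,
      coeff_tr, hmT, MvPowerSeries.coeff_add_monomial_mul, one_mul, ← hm, add_comm (2 • m)]
    exact (frobeniusEquiv_symm_pow_p k 2 _).symm
  · intro T' _ hT
    rw [MvPowerSeries.coeff_monomial_mul]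
    split_ifs with hle
    · obtain ⟨i, hi⟩ : ∃ i, ¬ (i ∈ T' ↔ i ∈ T) := by
        by_contra! h
        exact hT (Finset.ext h)
      rw [coeff_sq_of_odd _ (i := i), mul_zero]
      have := hle i
      by_cases h : i ∈ T' <;> by_cases h' : 2 ∣ d i <;> simp_all [T] <;> omega
    · rfl
  · intro h
    exact absurd (Finset.mem_univ _) h

/-- Every Cartier-linear map out of `k[[σ]]` is represented by the trace. -/
theorem exists_eq_tr_mul {S : Type*} [CommRing S] (ρ : MvPowerSeries σ k →+* S)
    (hρ : Function.Surjective ρ) (κ : MvPowerSeries σ k →+ S)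
    (hκ : ∀ a b, κ (a ^ 2 * b) = ρ a * κ b) : ∃ h, ∀ b, κ b = ρ (tr (h * b)) := by
  choose t ht using fun T : Finset σ => hρ (κ (MvPowerSeries.monomial (sqfreeExp T) 1))
  refine ⟨∑ T, t T ^ 2 * MvPowerSeries.monomial (sqfreeExp Tᶜ) 1, fun b => ?_⟩
  conv_lhs => rw [eq_sum_monomial_mul_tr_sq b]
  rw [map_sum, Finset.sum_mul, map_sum, map_sum]
  refine Finset.sum_congr rfl fun T _ => ?_
  rw [mul_comm, hκ, mul_assoc, tr_sq_mul, map_mul ρ, ht, mul_comm]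

/-- Nondegeneracy of the trace. -/
theorem sq_dvd_of_dvd_tr (f g : MvPowerSeries σ k) (h : ∀ b, f ∣ tr (g * b)) : f ^ 2 ∣ g := by
  rw [eq_sum_monomial_mul_tr_sq g]
  refine Finset.dvd_sum fun T _ => Dvd.dvd.mul_left (pow_dvd_pow_of_dvd ?_ 2) _
  rw [mul_comm]
  exact h _

end Trace

/-! ### Cartier-linear duality -/

/-- A ring `A` with a lift `φ` of Frobenius and the induced section `A → W(A)`, together with a
trace `u` on the reduction `B = A / 2A`. The field `exists_repr` says that `u` generates the
Cartier-linear maps from `B` to its quotients, and `sq_dvd` expresses its nondegeneracy. -/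
structure CartierSetting (A B : Type u) [CommRing A] [CommRing B] where
  φ : A →+* A
  sec : WittSection 2 φ
  red : A →+* B
  red_surjective : Function.Surjective red
  red_eq_zero_iff : ∀ a, red a = 0 ↔ 2 ∣ a
  red_φ : ∀ a, red (φ a) = red a ^ 2
  u : B →+ B
  u_sq_mul : ∀ a b, u (a ^ 2 * b) = a * u b
  u_surjective : Function.Surjective u
  exists_repr : ∀ {S : Type u} [CommRing S] (ρ : B →+* S), Function.Surjective ρ →
    ∀ κ : B →+ S, (∀ a b, κ (a ^ 2 * b) = ρ a * κ b) → ∃ h, ∀ b, κ b = ρ (u (h * b))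
  sq_dvd : ∀ f g, (∀ b, f ∣ u (g * b)) → f ^ 2 ∣ g

namespace CartierSetting

variable {A B : Type u} [CommRing A] [CommRing B] (D : CartierSetting A B) (f : A)

/-- The residue map `A → A / (f) → A / (2, f)`. -/
abbrev ev : A →+* ModP 2 (A ⧸ Ideal.span {f}) :=
  (Ideal.Quotient.mk (Ideal.span {((2 : ℕ) : A ⧸ Ideal.span {f})})).comp
    (Ideal.Quotient.mk (Ideal.span {f}))

theorem ev_surjective : Function.Surjective (ev f) :=
  Ideal.Quotient.mk_surjective.comp Ideal.Quotient.mk_surjective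

theorem ev_two : ev f 2 = 0 := by
  have := natCast_modP_eq_zero 2 (A ⧸ Ideal.span {f})
  rw [← Nat.cast_ofNat (R := A), map_natCast]
  exact this

theorem ev_self : ev f f = 0 := by
  simp [Ideal.Quotient.eq_zero_iff_mem.2 (Ideal.mem_span_singleton_self f)]

theorem modP_two_eq_zero : (2 : ModP 2 (A ⧸ Ideal.span {f})) = 0 := by
  have := natCast_modP_eq_zero 2 (A ⧸ Ideal.span {f})
  simpa using this

theorem modP_add_self (x : ModP 2 (A ⧸ Ideal.span {f})) : x + x = 0 := by
  rw [← two_mul, modP_two_eq_zero, zero_mul]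

theorem ev_eq_zero {a : A} (h : ev f a = 0) : ∃ b c, a = 2 * b + f * c := by
  have h1 : Ideal.Quotient.mk (Ideal.span {f}) a ∈ Ideal.span {((2 : ℕ) : A ⧸ Ideal.span {f})} :=
    Ideal.Quotient.eq_zero_iff_mem.1 h
  obtain ⟨b, hb⟩ := Ideal.mem_span_singleton.1 h1
  obtain ⟨b, rfl⟩ := Ideal.Quotient.mk_surjective b
  have h2 : a - 2 * b ∈ Ideal.span {f} := by
    rw [← Ideal.Quotient.eq_zero_iff_mem, map_sub, hb, map_mul, ← Nat.cast_ofNat (R := A),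
      map_natCast]
    exact sub_self _
  obtain ⟨c, hc⟩ := Ideal.mem_span_singleton.1 h2
  exact ⟨b, c, by rw [← hc]; ring⟩

/-- The residue map `B → B / (f)`, where `B / (f)` is realized as `A / (2, f)`. -/
noncomputable def ρ : B →+* ModP 2 (A ⧸ Ideal.span {f}) :=
  RingHom.liftOfSurjective D.red D.red_surjective ⟨ev f, by
    intro a ha
    obtain ⟨b, rfl⟩ := (D.red_eq_zero_iff a).1 ha
    rw [RingHom.mem_ker, map_mul, ev_two, zero_mul]⟩

@[simp]
theorem ρ_red (a : A) : D.ρ f (D.red a) = ev f a :=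
  RingHom.liftOfRightInverse_comp_apply _ _ _ _ a

theorem ρ_surjective : Function.Surjective (D.ρ f) := by
  intro x
  obtain ⟨a, rfl⟩ := ev_surjective f x
  exact ⟨D.red a, D.ρ_red f a⟩

theorem ρ_eq_zero_iff (b : B) : D.ρ f b = 0 ↔ D.red f ∣ b := by
  obtain ⟨a, rfl⟩ := D.red_surjective b
  constructor
  · intro h
    rw [ρ_red] at h
    obtain ⟨b, c, rfl⟩ := ev_eq_zero f h
    rw [map_add, map_mul, map_mul, (D.red_eq_zero_iff 2).2 dvd_rfl, zero_mul, zero_add]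
    exact dvd_mul_right _ _
  · rintro ⟨d, hd⟩
    rw [hd, map_mul, ρ_red, ev_self, zero_mul]

theorem ev_φ (a : A) : ev f (D.φ a) = ev f a ^ 2 := by
  rw [← ρ_red D, red_φ, map_pow, ρ_red]

/-- The trace on `B / (f)`, given by `b ↦ u (f b)`. -/
noncomputable def τ : ModP 2 (A ⧸ Ideal.span {f}) →+ ModP 2 (A ⧸ Ideal.span {f}) :=
  AddMonoidHom.liftOfSurjective (D.ρ f).toAddMonoidHom (D.ρ_surjective f)
    ⟨((D.ρ f).toAddMonoidHom.comp D.u).comp (AddMonoidHom.mulLeft (D.red f)), by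
      intro b hb
      obtain ⟨d, rfl⟩ := (D.ρ_eq_zero_iff f b).1 hb
      change D.ρ f (D.u (D.red f * (D.red f * d))) = 0
      rw [← mul_assoc, ← pow_two, D.u_sq_mul, map_mul, ρ_red, ev_self, zero_mul]⟩

theorem τ_ρ (b : B) : D.τ f (D.ρ f b) = D.ρ f (D.u (D.red f * b)) :=
  AddMonoidHom.liftOfRightInverse_comp_apply (D.ρ f).toAddMonoidHom _ _ _ b

theorem τ_sq_mul (a b : ModP 2 (A ⧸ Ideal.span {f})) : D.τ f (a ^ 2 * b) = a * D.τ f b := by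
  obtain ⟨a, rfl⟩ := D.ρ_surjective f a
  obtain ⟨b, rfl⟩ := D.ρ_surjective f b
  rw [← map_pow, ← map_mul, τ_ρ, τ_ρ, ← map_mul, ← D.u_sq_mul]
  congr 2
  ring

variable [IsDomain B] (hf : D.red f ≠ 0)

include hf in
theorem eq_of_τ_mul_eq {g g' : ModP 2 (A ⧸ Ideal.span {f})}
    (h : ∀ b, D.τ f (g * b) = D.τ f (g' * b)) : g = g' := by
  obtain ⟨d, hd⟩ := D.ρ_surjective f (g - g')
  rw [← sub_eq_zero, ← hd, D.ρ_eq_zero_iff]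
  have h1 : D.red f ^ 2 ∣ D.red f * d := by
    refine D.sq_dvd _ _ fun b => ?_
    rw [← D.ρ_eq_zero_iff, mul_assoc, ← τ_ρ, map_mul, hd, sub_mul, map_sub, h, sub_self]
  rw [pow_two] at h1
  exact (mul_dvd_mul_iff_left hf).1 h1

include hf in
/-- Duality for Frobenius on `B / (f)`: every Cartier-linear map is a multiple of the
trace, and by `eq_of_τ_mul_eq` the multiplier is unique. -/
theorem exists_τ_mul (κ : ModP 2 (A ⧸ Ideal.span {f}) →+ ModP 2 (A ⧸ Ideal.span {f}))
    (hκ : ∀ a b, κ (a ^ 2 * b) = a * κ b) : ∃ g, ∀ b, κ b = D.τ f (g * b) := by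
  obtain ⟨h, hh⟩ := D.exists_repr (D.ρ f) (D.ρ_surjective f) (κ.comp (D.ρ f).toAddMonoidHom) (by
    intro a b
    change κ (D.ρ f (a ^ 2 * b)) = D.ρ f a * κ (D.ρ f b)
    rw [map_mul, map_pow, hκ])
  replace hh : ∀ b, κ (D.ρ f b) = D.ρ f (D.u (h * b)) := hh
  have h1 : D.red f ^ 2 ∣ h * D.red f := by
    refine D.sq_dvd _ _ fun b => ?_
    rw [← D.ρ_eq_zero_iff, mul_assoc, ← hh, map_mul, ρ_red, ev_self, zero_mul, map_zero]
  rw [pow_two, mul_comm h] at h1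
  obtain ⟨w, rfl⟩ := (mul_dvd_mul_iff_left hf).1 h1
  refine ⟨D.ρ f w, fun b => ?_⟩
  obtain ⟨b, rfl⟩ := D.ρ_surjective f b
  rw [hh, ← map_mul, τ_ρ, mul_assoc]

theorem τ_iterate_pow_mul (m : ℕ) (a b : ModP 2 (A ⧸ Ideal.span {f})) :
    (D.τ f)^[m] (a ^ 2 ^ m * b) = a * (D.τ f)^[m] b := by
  induction m generalizing b with
  | zero => simp
  | succ m ih => rw [Function.iterate_succ_apply, pow_succ, pow_mul, τ_sq_mul, ih,
      Function.iterate_succ_apply]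

include hf in
/-- Duality for iterates of Frobenius and arbitrary modules: an additive map `κ` on a module `M`
with `κ (a ^ (2 ^ m) x) = a κ x` is the composite of a linear form on `M` with the `m`-th
iterate of the trace. -/
theorem exists_linearMap_eq_τ_iterate {M : Type*} [AddCommGroup M]
    [Module (ModP 2 (A ⧸ Ideal.span {f})) M] (m : ℕ) (κ : M →+ ModP 2 (A ⧸ Ideal.span {f}))
    (hκ : ∀ (a : ModP 2 (A ⧸ Ideal.span {f})) x, κ (a ^ 2 ^ m • x) = a * κ x) :
    ∃ l : M →ₗ[ModP 2 (A ⧸ Ideal.span {f})] ModP 2 (A ⧸ Ideal.span {f}),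
      ∀ x, κ x = (D.τ f)^[m] (l x) := by
  induction m generalizing κ with
  | zero => exact ⟨{ κ with map_smul' := fun a x => by simpa using hκ a x }, fun x => rfl⟩
  | succ m ih =>
    -- For fixed `x` the map `a ↦ κ (a ^ (2 ^ m) x)` is Cartier-linear.
    have h1 : ∀ x, ∃ g, ∀ a : ModP 2 (A ⧸ Ideal.span {f}), κ (a ^ 2 ^ m • x) = D.τ f (g * a) := by
      intro x
      refine D.exists_τ_mul f hf
        { toFun := fun a => κ (a ^ 2 ^ m • x), map_zero' := ?_, map_add' := ?_ } ?_
      · simp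
      · intro a b
        have := map_add (frob 2 (A ⧸ Ideal.span {f}) m) a b
        simp only [frob, RingHom.coe_mk, MonoidHom.coe_mk, OneHom.coe_mk] at this
        rw [this, add_smul, map_add]
      · intro a b
        change κ ((a ^ 2 * b) ^ 2 ^ m • x) = a * κ (b ^ 2 ^ m • x)
        rw [mul_pow, ← pow_mul, ← pow_succ', mul_smul, hκ]
    choose g hg using h1
    have hg1 : ∀ x, κ x = D.τ f (g x) := fun x => by simpa using hg x 1
    obtain ⟨l, hl⟩ := ih
      { toFun := g
        map_zero' := D.eq_of_τ_mul_eq f hf fun b => by rw [← hg]; simp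
        map_add' := fun x y => D.eq_of_τ_mul_eq f hf fun b => by
          rw [← hg, smul_add, map_add, hg, hg, add_mul, map_add] }
      (fun a x => D.eq_of_τ_mul_eq f hf fun b => by
        change D.τ f (g (a ^ 2 ^ m • x) * b) = D.τ f (a * g x * b)
        rw [← hg, smul_smul, ← mul_pow, hg]
        congr 1; ring)
    exact ⟨l, fun x => by
      rw [hg1 x, Function.iterate_succ_apply', ← hl x]; rfl⟩

end CartierSetting

/-! ### Linear forms on Witt vectors modulo two -/

namespace CartierSetting

variable {A B : Type u} [CommRing A] [CommRing B] (D : CartierSetting A B) (f : A)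

/-- The map `W(A) → W(A / (f))`. -/
noncomputable abbrev wittQuot : WittVector 2 A →+* WittVector 2 (A ⧸ Ideal.span {f}) :=
  WittVector.map (Ideal.Quotient.mk (Ideal.span {f}))

/-- The `A / (2, f)`-linear forms on `F_* (W_m(R) / 2 W_m(R))` for `R = A / (f)`, viewed as additive
maps on `W(A)`. -/
structure IsForm (m : ℕ) (ψ : WittVector 2 A →+ ModP 2 (A ⧸ Ideal.span {f})) : Prop where
  smul : ∀ a x, ψ (D.sec.toHom (D.φ a) * x) = ev f a * ψ x
  ker : ∀ x, wittQuot f x = 0 → ψ x = 0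
  ver : ∀ x, ψ (WittVector.verschiebung^[m] x) = 0

theorem map_two_mul_eq_zero (ψ : WittVector 2 A →+ ModP 2 (A ⧸ Ideal.span {f}))
    (x : WittVector 2 A) : ψ (2 * x) = 0 := by
  rw [two_mul, map_add, modP_add_self]

theorem exists_eq_sec_add (x : WittVector 2 A) :
    ∃ z, x = D.sec.toHom (x.coeff 0) + WittVector.verschiebung z :=
  exists_eq_add_verschiebung 2 A x _ (D.sec.coeff_zero _).symm

/-- The Witt vector `δ x` with `x = s(x_0) + V (δ x)`. -/
noncomputable def delta (x : WittVector 2 A) : WittVector 2 A := (D.exists_eq_sec_add x).choose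

theorem eq_sec_add (x : WittVector 2 A) :
    x = D.sec.toHom (x.coeff 0) + WittVector.verschiebung (D.delta x) :=
  (D.exists_eq_sec_add x).choose_spec

theorem delta_eq {x z : WittVector 2 A} {a : A}
    (h : x = D.sec.toHom a + WittVector.verschiebung z) : D.delta x = z := by
  have h0 : x.coeff 0 = a := by
    have := congrArg (WittVector.constantCoeff (p := 2) (R := A)) h
    rw [map_add] at this
    simpa [D.sec.coeff_zero] using this
  have := D.eq_sec_add x
  rw [h0] at this
  exact (WittVector.verschiebung_injective 2 A (add_left_cancel (h.symm.trans this))).symm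

theorem sec_mul_verschiebung (a : A) (x : WittVector 2 A) :
    D.sec.toHom a * WittVector.verschiebung x =
      WittVector.verschiebung (D.sec.toHom (D.φ a) * x) := by
  rw [← D.sec.frobenius, mul_comm, mul_comm _ x, WittVector.verschiebung_mul_frobenius]

theorem verschiebung_mul_verschiebung (x y : WittVector 2 A) :
    WittVector.verschiebung x * WittVector.verschiebung y =
      2 * WittVector.verschiebung (x * y) := by
  have := WittVector.verschiebung_mul_frobenius x (WittVector.verschiebung y)
  rw [WittVector.frobenius_verschiebung] at this
  have h2 : x * (y * ((2 : ℕ) : WittVector 2 A)) = x * y + x * y := by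
    push_cast
    ring
  rw [h2, map_add] at this
  rw [← this]
  ring

theorem exists_φ_eq (a : A) : ∃ d, D.φ a = a ^ 2 + 2 * d := by
  have : D.red (D.φ a - a ^ 2) = 0 := by rw [map_sub, red_φ, map_pow, sub_self]
  obtain ⟨d, hd⟩ := (D.red_eq_zero_iff _).1 this
  exact ⟨d, by rw [← hd]; ring⟩

theorem sq_eq_sec_sq_add (x : WittVector 2 A) :
    ∃ y, x ^ 2 = D.sec.toHom (x.coeff 0) ^ 2 + 2 * y := by
  refine ⟨D.sec.toHom (x.coeff 0) * WittVector.verschiebung (D.delta x) +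
    WittVector.verschiebung (D.delta x * D.delta x), ?_⟩
  have h := verschiebung_mul_verschiebung (D.delta x) (D.delta x)
  conv_lhs => rw [D.eq_sec_add x]
  linear_combination h

/-- The Witt vector `γ` with `[f] = s(f) + V γ`. -/
noncomputable def gamma : WittVector 2 A := D.delta (WittVector.teichmuller 2 f)

theorem teichmuller_eq :
    WittVector.teichmuller 2 f = D.sec.toHom f + WittVector.verschiebung (D.gamma f) := by
  have := D.eq_sec_add (WittVector.teichmuller 2 f)
  rwa [WittVector.teichmuller_coeff_zero] at this

variable {f} in
variable [IsDomain A] [CharZero A] in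
/-- Comparing `F [f] = [f] ^ 2` with `[f] = s(f) + V γ` determines `γ` recursively. -/
theorem gamma_eq {c : A} (hc : f ^ 2 = D.φ f + 2 * c) :
    D.gamma f = D.sec.toHom c +
      WittVector.verschiebung (D.gamma f ^ 2 + D.sec.toHom (D.φ f) * D.gamma f) := by
  rw [← sub_eq_zero]
  refine witt_eq_zero_of_natCast_mul (p := 2) ?_
  have h1 := frobenius_teichmuller (p := 2) f
  rw [D.teichmuller_eq f, map_add, D.sec.frobenius, WittVector.frobenius_verschiebung] at h1
  have h2 := D.sec_mul_verschiebung f (D.gamma f)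
  have h3 := verschiebung_mul_verschiebung (D.gamma f) (D.gamma f)
  have h4 := congrArg D.sec.toHom hc
  simp only [map_add, map_mul, map_pow, map_ofNat, Nat.cast_ofNat] at h1 h4 ⊢
  rw [pow_two (D.gamma f)]
  linear_combination h1 + h4 + 2 * h2 + h3

variable {f}

variable [IsDomain A] [CharZero A] in
theorem IsForm.map_verschiebung_gamma {D : CartierSetting A B} {m : ℕ}
    {ψ : WittVector 2 A →+ ModP 2 (A ⧸ Ideal.span {f})} (hψ : D.IsForm f m ψ) {c : A}
    (hc : f ^ 2 = D.φ f + 2 * c) :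
    ψ (D.gamma f ^ 2 + D.sec.toHom (D.φ f) * D.gamma f) = ev f c * ψ 1 := by
  have h0 : (D.gamma f).coeff 0 = c := by
    rw [D.gamma_eq hc]
    have := map_add (WittVector.constantCoeff (p := 2) (R := A)) (D.sec.toHom c)
      (WittVector.verschiebung (D.gamma f ^ 2 + D.sec.toHom (D.φ f) * D.gamma f))
    simp only [WittVector.constantCoeff_apply] at this
    rw [this, D.sec.coeff_zero, WittVector.verschiebung_coeff_zero, add_zero]
  obtain ⟨y, hy⟩ := D.sq_eq_sec_sq_add (D.gamma f)
  obtain ⟨d, hd⟩ := D.exists_φ_eq c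
  have h1 : D.sec.toHom c ^ 2 = D.sec.toHom (D.φ c) * 1 + 2 * (-D.sec.toHom d) := by
    rw [hd]
    simp only [map_add, map_mul, map_pow, map_ofNat]
    ring
  rw [map_add, hψ.smul, ev_self, zero_mul, add_zero, hy, h0, h1, map_add, map_add, hψ.smul,
    map_two_mul_eq_zero, map_two_mul_eq_zero, add_zero, add_zero]

variable [IsDomain B]

theorem IsForm.map_sec_mul_verschiebung {D : CartierSetting A B} {m : ℕ}
    {ψ : WittVector 2 A →+ ModP 2 (A ⧸ Ideal.span {f})} (hψ : D.IsForm f m ψ) (a : A)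
    (x : WittVector 2 A) :
    ψ (WittVector.verschiebung (D.sec.toHom (D.φ (D.φ a)) * x)) =
      ev f a * ψ (WittVector.verschiebung x) := by
  rw [← D.sec_mul_verschiebung, hψ.smul]

/-- The restriction of a form to `V W(A)` is the composite of a form of smaller level with the
trace. -/
theorem IsForm.exists_verschiebung {D : CartierSetting A B} (hf : D.red f ≠ 0) {m : ℕ}
    {ψ : WittVector 2 A →+ ModP 2 (A ⧸ Ideal.span {f})} (hψ : D.IsForm f (m + 1) ψ) :
    ∃ ψ' : WittVector 2 A →+ ModP 2 (A ⧸ Ideal.span {f}), D.IsForm f m ψ' ∧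
      ∀ x, ψ (WittVector.verschiebung x) = D.τ f (ψ' x) := by
  -- For fixed `x`, the value `ψ (V (s (φ a) x))` depends on the residue of `a` only.
  have hzero : ∀ x a, ev f a = 0 → ψ (WittVector.verschiebung (D.sec.toHom (D.φ a) * x)) = 0 := by
    intro x a ha
    obtain ⟨b, d, rfl⟩ := ev_eq_zero f ha
    have h1 : D.sec.toHom (D.φ (2 * b + f * d)) * x =
        2 * (D.sec.toHom (D.φ b) * x - D.gamma f * D.sec.toHom (D.φ d) * x) +
          WittVector.frobenius (WittVector.teichmuller 2 f) * (D.sec.toHom (D.φ d) * x) := by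
      rw [D.teichmuller_eq f, map_add WittVector.frobenius, D.sec.frobenius,
        WittVector.frobenius_verschiebung]
      simp only [map_add, map_mul, map_ofNat, Nat.cast_ofNat]
      ring
    rw [h1, map_add, map_add, two_mul, map_add, ← two_mul, map_two_mul_eq_zero, zero_add]
    rw [mul_comm (WittVector.frobenius _), WittVector.verschiebung_mul_frobenius]
    apply hψ.ker
    have h2 : wittQuot f (WittVector.teichmuller 2 f) = 0 := by
      rw [WittVector.map_teichmuller,
        Ideal.Quotient.eq_zero_iff_mem.2 (Ideal.mem_span_singleton_self f),
        WittVector.teichmuller_zero]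
    rw [map_mul, h2, mul_zero]
  have h1 : ∀ x, ∃ g, ∀ a, ψ (WittVector.verschiebung (D.sec.toHom (D.φ a) * x)) =
      D.τ f (g * ev f a) := by
    intro x
    let κ₀ : A →+ ModP 2 (A ⧸ Ideal.span {f}) :=
      { toFun := fun a => ψ (WittVector.verschiebung (D.sec.toHom (D.φ a) * x))
        map_zero' := by simp
        map_add' := fun a b => by simp only [map_add, add_mul] }
    let κ := AddMonoidHom.liftOfSurjective (ev f).toAddMonoidHom (ev_surjective f)
      ⟨κ₀, fun a ha => hzero x a ha⟩
    have hκ : ∀ a, κ (ev f a) = κ₀ a := fun a =>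
      AddMonoidHom.liftOfRightInverse_comp_apply (ev f).toAddMonoidHom _ _ _ a
    obtain ⟨g, hg⟩ := D.exists_τ_mul f hf κ (by
      intro a b
      obtain ⟨a, rfl⟩ := ev_surjective f a
      obtain ⟨b, rfl⟩ := ev_surjective f b
      rw [← ev_φ D, ← map_mul, hκ, hκ]
      change ψ (WittVector.verschiebung (D.sec.toHom (D.φ (D.φ a * b)) * x)) =
        ev f a * ψ (WittVector.verschiebung (D.sec.toHom (D.φ b) * x))
      rw [map_mul D.φ, map_mul D.sec.toHom, mul_assoc, hψ.map_sec_mul_verschiebung])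
    exact ⟨g, fun a => by rw [← hg, hκ]; rfl⟩
  choose g hg using h1
  have hg1 : ∀ x, ψ (WittVector.verschiebung x) = D.τ f (g x) := fun x => by simpa using hg x 1
  have key : ∀ {y z : ModP 2 (A ⧸ Ideal.span {f})},
      (∀ a, D.τ f (y * ev f a) = D.τ f (z * ev f a)) → y = z := fun h =>
    D.eq_of_τ_mul_eq f hf fun b => by
      obtain ⟨a, rfl⟩ := ev_surjective f b
      exact h a
  refine ⟨⟨⟨g, ?_⟩, ?_⟩, ⟨?_, ?_, ?_⟩, hg1⟩
  · exact key fun a => by rw [← hg, mul_zero, map_zero, map_zero, zero_mul, map_zero]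
  · intro x y
    exact key fun a => by rw [← hg, mul_add, map_add, map_add, hg, hg, add_mul, map_add]
  · intro a x
    refine key fun b => ?_
    change D.τ f (g (D.sec.toHom (D.φ a) * x) * ev f b) = D.τ f (ev f a * g x * ev f b)
    rw [← hg, ← mul_assoc, ← map_mul, ← map_mul, hg, map_mul (ev f)]
    congr 1; ring
  · intro x hx
    refine key fun b => ?_
    change D.τ f (g x * ev f b) = _
    rw [← hg, zero_mul, map_zero]
    apply hψ.ker
    rw [WittVector.map_verschiebung, map_mul, hx, mul_zero, map_zero]
  · intro x
    refine key fun b => ?_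
    change D.τ f (g _ * ev f b) = _
    rw [← hg, zero_mul, map_zero, ← D.sec.frobenius, mul_comm,
      WittVector.verschiebung_mul_frobenius,
      ← Function.iterate_succ_apply' WittVector.verschiebung, mul_comm]
    obtain ⟨d, hd⟩ : ∃ y, D.sec.toHom b * WittVector.verschiebung^[m + 1] x =
        WittVector.verschiebung^[m + 1] y := by
      rw [mul_comm, WittVector.iterate_verschiebung_mul_left]
      exact ⟨_, rfl⟩
    rw [hd, hψ.ver]

/-- The restriction of a form to `s(A)` is represented by an element which is determined modulo
`f` by the value at `γ` of the form of smaller level. -/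
theorem IsForm.exists_sec {D : CartierSetting A B} (hf : D.red f ≠ 0) {m : ℕ}
    {ψ ψ' : WittVector 2 A →+ ModP 2 (A ⧸ Ideal.span {f})} (hψ : D.IsForm f (m + 1) ψ)
    (hψ' : D.IsForm f m ψ') (h : ∀ x, ψ (WittVector.verschiebung x) = D.τ f (ψ' x)) :
    ∃ h, (∀ a, ψ (D.sec.toHom a) = D.ρ f (D.u (h * D.red a))) ∧ D.ρ f h = ψ' (D.gamma f) := by
  let κ₀ : A →+ ModP 2 (A ⧸ Ideal.span {f}) := ψ.comp D.sec.toHom.toAddMonoidHom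
  let κ := AddMonoidHom.liftOfSurjective D.red.toAddMonoidHom D.red_surjective
    ⟨κ₀, fun a ha => by
      obtain ⟨b, rfl⟩ := (D.red_eq_zero_iff a).1 ha
      change ψ (D.sec.toHom (2 * b)) = 0
      rw [map_mul, map_ofNat, map_two_mul_eq_zero]⟩
  have hκ : ∀ a, κ (D.red a) = ψ (D.sec.toHom a) := fun a =>
    AddMonoidHom.liftOfRightInverse_comp_apply D.red.toAddMonoidHom _ _ _ a
  obtain ⟨t, ht⟩ := D.exists_repr (D.ρ f) (D.ρ_surjective f) κ (by
    intro a b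
    obtain ⟨a, rfl⟩ := D.red_surjective a
    obtain ⟨b, rfl⟩ := D.red_surjective b
    rw [← D.red_φ, ← map_mul, hκ, hκ, map_mul, hψ.smul, ρ_red])
  refine ⟨t, fun a => by rw [← hκ, ht], ?_⟩
  refine D.eq_of_τ_mul_eq f hf fun b => ?_
  obtain ⟨a, rfl⟩ := ev_surjective f b
  -- The relation `[f] s(a) = 0`.
  have h1 : ψ (WittVector.teichmuller 2 f * D.sec.toHom a) = 0 := by
    apply hψ.ker
    rw [map_mul, WittVector.map_teichmuller,
      Ideal.Quotient.eq_zero_iff_mem.2 (Ideal.mem_span_singleton_self f),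
      WittVector.teichmuller_zero, zero_mul]
  rw [D.teichmuller_eq f, add_mul, ← map_mul, mul_comm (WittVector.verschiebung _),
    D.sec_mul_verschiebung, map_add, h, hψ'.smul, ← hκ, ht, map_mul D.red, ← mul_assoc, mul_comm t,
    mul_assoc, ← τ_ρ, map_mul (D.ρ f), ρ_red] at h1
  rw [mul_comm (ψ' _), eq_neg_of_add_eq_zero_left h1, neg_eq_iff_add_eq_zero, modP_add_self]

/-- Conversely forms of smaller level extend. -/
theorem IsForm.exists_extension {D : CartierSetting A B} {m : ℕ}
    {ψ' : WittVector 2 A →+ ModP 2 (A ⧸ Ideal.span {f})}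
    (hψ' : D.IsForm f m ψ') (h : B) (hh : D.ρ f h = ψ' (D.gamma f)) :
    ∃ ψ, D.IsForm f (m + 1) ψ ∧ (∀ x, ψ (WittVector.verschiebung x) = D.τ f (ψ' x)) ∧
      ∀ a, ψ (D.sec.toHom a) = D.ρ f (D.u (h * D.red a)) := by
  let ψ₀ : WittVector 2 A → ModP 2 (A ⧸ Ideal.span {f}) := fun x =>
    D.ρ f (D.u (h * D.red (x.coeff 0))) + D.τ f (ψ' (D.delta x))
  have hψ₀ : ∀ {x : WittVector 2 A} {a z}, x = D.sec.toHom a + WittVector.verschiebung z →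
      ψ₀ x = D.ρ f (D.u (h * D.red a)) + D.τ f (ψ' z) := by
    intro x a z hx
    have h0 : x.coeff 0 = a := by
      have := congrArg (WittVector.constantCoeff (p := 2) (R := A)) hx
      rw [map_add] at this
      simpa [D.sec.coeff_zero] using this
    simp only [ψ₀]
    rw [D.delta_eq hx, h0]
  let ψ : WittVector 2 A →+ ModP 2 (A ⧸ Ideal.span {f}) :=
    { toFun := ψ₀
      map_zero' := by
        rw [hψ₀ (x := 0) (a := 0) (z := 0) (by simp)]
        simp
      map_add' := by
        intro x y
        have hx := D.eq_sec_add x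
        have hy := D.eq_sec_add y
        rw [hψ₀ hx, hψ₀ hy, hψ₀ (x := x + y) (a := x.coeff 0 + y.coeff 0)
          (z := D.delta x + D.delta y)]
        · simp only [map_add, mul_add]
          abel
        · conv_lhs => rw [hx, hy]
          simp only [map_add]
          abel }
  have hψV : ∀ x, ψ (WittVector.verschiebung x) = D.τ f (ψ' x) := by
    intro x
    change ψ₀ _ = _
    rw [hψ₀ (a := 0) (z := x) (by simp)]
    simp
  have hψs : ∀ a, ψ (D.sec.toHom a) = D.ρ f (D.u (h * D.red a)) := by
    intro a
    change ψ₀ _ = _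
    rw [hψ₀ (a := a) (z := 0) (by simp)]
    simp
  refine ⟨ψ, ⟨?_, ?_, ?_⟩, hψV, hψs⟩
  · intro a x
    have hx := D.eq_sec_add x
    rw [hx, mul_add, ← map_mul, D.sec_mul_verschiebung, map_add, map_add, hψV, hψV, hψs, hψs,
      hψ'.smul, map_mul D.red, red_φ, ev_φ, τ_sq_mul, mul_left_comm, D.u_sq_mul, map_mul (D.ρ f),
      ρ_red, mul_add]
  · intro x hx
    obtain ⟨a, ha⟩ : ∃ a, x.coeff 0 = f * a := by
      have := congrArg (fun y => y.coeff 0) hx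
      simp only [WittVector.map_coeff, WittVector.zero_coeff] at this
      exact Ideal.mem_span_singleton.1 (Ideal.Quotient.eq_zero_iff_mem.1 this)
    have hT : wittQuot f (WittVector.teichmuller 2 f) = 0 := by
      rw [WittVector.map_teichmuller,
        Ideal.Quotient.eq_zero_iff_mem.2 (Ideal.mem_span_singleton_self f),
        WittVector.teichmuller_zero]
    have h1 : wittQuot f (D.delta x - D.sec.toHom (D.φ a) * D.gamma f) = 0 := by
      apply WittVector.verschiebung_injective
      rw [← WittVector.map_verschiebung, map_zero, map_sub, ← D.sec_mul_verschiebung]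
      have h2 := D.teichmuller_eq f
      have h3 := D.eq_sec_add x
      rw [ha, map_mul] at h3
      have : WittVector.verschiebung (D.delta x) -
          D.sec.toHom a * WittVector.verschiebung (D.gamma f) =
          x - WittVector.teichmuller 2 f * D.sec.toHom a := by
        linear_combination (-1 : WittVector 2 A) * h3 + D.sec.toHom a * h2
      rw [this, map_sub, map_mul, hx, hT, zero_mul, sub_zero]
    have h2 := hψ'.ker _ h1
    rw [map_sub, hψ'.smul, sub_eq_zero, ← hh] at h2
    rw [D.eq_sec_add x, map_add, hψV, hψs, h2, ha, map_mul D.red, mul_left_comm, ← τ_ρ,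
      map_mul (D.ρ f), ρ_red, mul_comm, modP_add_self]
  · intro x
    rw [Function.iterate_succ_apply', hψV, hψ'.ver, map_zero]

end CartierSetting

/-! ### The ideals of Fedder type -/

namespace CartierSetting

variable {A B : Type u} [CommRing A] [CommRing B] (D : CartierSetting A B) {f : A}

/-- The image of an ideal under the trace. -/
def trIdeal (I : Ideal B) : Ideal B where
  carrier := D.u '' I
  zero_mem' := ⟨0, I.zero_mem, map_zero _⟩
  add_mem' := by
    rintro _ _ ⟨a, ha, rfl⟩ ⟨b, hb, rfl⟩
    exact ⟨a + b, I.add_mem ha hb, map_add _ _ _⟩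
  smul_mem' := by
    rintro a _ ⟨b, hb, rfl⟩
    exact ⟨a ^ 2 * b, I.mul_mem_left _ hb, D.u_sq_mul a b⟩

theorem mem_trIdeal {I : Ideal B} {x : B} : x ∈ D.trIdeal I ↔ ∃ a ∈ I, D.u a = x := Iff.rfl

/-- The ideals `I_1 = f J` and `I_{j+1} = u (c I_j) + (f)` of the Fedder type criterion, indexed
from zero. -/
def fedder (f c : B) (J : Ideal B) : ℕ → Ideal B
  | 0 => Ideal.span {f} * J
  | j + 1 => D.trIdeal (Ideal.span {c} * fedder f c J j) ⊔ Ideal.span {f}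

theorem mem_fedder_zero {f c : B} {J : Ideal B} {x : B} :
    x ∈ D.fedder f c J 0 ↔ ∃ g ∈ J, f * g = x := by
  rw [fedder, Ideal.mem_span_singleton_mul]

theorem mem_fedder_succ {f c : B} {J : Ideal B} {j : ℕ} {x : B} :
    x ∈ D.fedder f c J (j + 1) ↔ ∃ h ∈ D.fedder f c J j, ∃ b, x = D.u (c * h) + f * b := by
  rw [fedder, Submodule.mem_sup]
  constructor
  · rintro ⟨_, ⟨y, hy, rfl⟩, z, hz, rfl⟩
    obtain ⟨h, hh, rfl⟩ := Ideal.mem_span_singleton_mul.1 hy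
    obtain ⟨b, rfl⟩ := Ideal.mem_span_singleton.1 hz
    exact ⟨h, hh, b, rfl⟩
  · rintro ⟨h, hh, b, rfl⟩
    exact ⟨_, ⟨c * h, Ideal.mem_span_singleton_mul.2 ⟨h, hh, rfl⟩, rfl⟩, _,
      Ideal.mem_span_singleton.2 ⟨b, rfl⟩, rfl⟩

variable [IsDomain A] [CharZero A] [IsDomain B]

theorem IsForm.map_gamma {D : CartierSetting A B} {m : ℕ}
    {ψ ψ' : WittVector 2 A →+ ModP 2 (A ⧸ Ideal.span {f})}
    (hψ' : D.IsForm f m ψ') (hV : ∀ x, ψ (WittVector.verschiebung x) = D.τ f (ψ' x))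
    {h w : B} (hs : ∀ a, ψ (D.sec.toHom a) = D.ρ f (D.u (h * D.red a)))
    (hw : D.ρ f w = ψ' 1) {c : A} (hc : f ^ 2 = D.φ f + 2 * c) :
    ψ (D.gamma f) = D.ρ f (D.u (D.red c * (h + D.red f * w))) := by
  rw [D.gamma_eq hc, map_add, hs, hV, hψ'.map_verschiebung_gamma hc, ← hw, ← ρ_red D, ← map_mul,
    τ_ρ, ← map_add, ← map_add]
  congr 2
  ring

theorem IsForm.eq_zero {D : CartierSetting A B}
    {ψ : WittVector 2 A →+ ModP 2 (A ⧸ Ideal.span {f})} (hψ : D.IsForm f 0 ψ)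
    (x : WittVector 2 A) : ψ x = 0 := hψ.ver x

/-- If the restriction of a form to the last graded piece `V ^ j W(A)` is given by an element of
`J`, then its restriction to `s(A)` is given by an element of the `j`-th Fedder ideal of `J`. -/
theorem IsForm.exists_mem_fedder {D : CartierSetting A B} (hf : D.red f ≠ 0) {c : A}
    (hc : f ^ 2 = D.φ f + 2 * c) {J : Ideal B} {g : B} (hg : g ∈ J) (j : ℕ)
    {ψ : WittVector 2 A →+ ModP 2 (A ⧸ Ideal.span {f})} (hψ : D.IsForm f (j + 1) ψ)
    (hψg : ∀ x, ψ (WittVector.verschiebung^[j] x) =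
      (D.τ f)^[j + 1] (D.ρ f g * ev f (x.coeff 0))) :
    ∃ h ∈ D.fedder (D.red f) (D.red c) J j, ∀ a, ψ (D.sec.toHom a) = D.ρ f (D.u (h * D.red a)) := by
  induction j generalizing ψ with
  | zero =>
    refine ⟨D.red f * g, D.mem_fedder_zero.2 ⟨g, hg, rfl⟩, fun a => ?_⟩
    have := hψg (D.sec.toHom a)
    rw [D.sec.coeff_zero, ← ρ_red D, ← map_mul] at this
    simp only [Function.iterate_zero, id_eq, zero_add, Function.iterate_one] at this
    rw [this, τ_ρ, mul_assoc]
  | succ j ih =>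
    obtain ⟨ψ', hψ', hV⟩ := hψ.exists_verschiebung hf
    have hψ'g : ∀ x, ψ' (WittVector.verschiebung^[j] x) =
        (D.τ f)^[j + 1] (D.ρ f g * ev f (x.coeff 0)) := by
      intro x
      refine D.eq_of_τ_mul_eq f hf fun b => ?_
      obtain ⟨a, rfl⟩ := ev_surjective f b
      -- Both sides are compared after scaling `x` by a section.
      have h1 : ∀ (i : ℕ) (y : WittVector 2 A), D.sec.toHom (D.φ a) *
          WittVector.verschiebung^[i] y =
            WittVector.verschiebung^[i] (D.sec.toHom (D.φ^[i + 1] a) * y) := by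
        intro i
        induction i with
        | zero => intro y; rfl
        | succ i ih =>
          intro y
          rw [Function.iterate_succ_apply, ih, D.sec_mul_verschiebung,
            ← Function.iterate_succ_apply' D.φ, ← Function.iterate_succ_apply]
      have h2 : ∀ i : ℕ, ev f (D.φ^[i] a) = ev f a ^ 2 ^ i := by
        intro i
        induction i with
        | zero => simp
        | succ i ih => rw [Function.iterate_succ_apply', ev_φ, ih, ← pow_mul, ← pow_succ]
      rw [mul_comm, ← hψ'.smul, ← hV, h1, ← Function.iterate_succ_apply' WittVector.verschiebung,
        hψg, WittVector.mul_coeff_zero, D.sec.coeff_zero, map_mul, h2, mul_left_comm,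
        Function.iterate_succ_apply', τ_iterate_pow_mul, mul_comm]
    obtain ⟨h', hh', hs'⟩ := ih hψ' hψ'g
    obtain ⟨h, hs, hh⟩ := hψ.exists_sec hf hψ' hV
    obtain ⟨ψ'', hψ'', hV'⟩ := hψ'.exists_verschiebung hf
    obtain ⟨w, hw⟩ := D.ρ_surjective f (ψ'' 1)
    have hmem : h' + D.red f * w ∈ D.fedder (D.red f) (D.red c) J j ∨ j = 0 ∧ ψ'' 1 = 0 := by
      rcases j with _ | j
      · exact Or.inr ⟨rfl, hψ''.eq_zero 1⟩
      · refine Or.inl (Ideal.add_mem _ hh' (D.mem_fedder_succ.2 ⟨0, Ideal.zero_mem _, w, ?_⟩))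
        simp
    obtain ⟨w, hw, hmem⟩ : ∃ w, D.ρ f w = ψ'' 1 ∧
        h' + D.red f * w ∈ D.fedder (D.red f) (D.red c) J j := by
      rcases hmem with hmem | ⟨-, h0⟩
      · exact ⟨w, hw, hmem⟩
      · exact ⟨0, by rw [h0, map_zero], by simpa using hh'⟩
    rw [hψ''.map_gamma hV' hs' hw hc] at hh
    refine ⟨h, ?_, hs⟩
    have h3 : D.ρ f (h - D.u (D.red c * (h' + D.red f * w))) = 0 := by
      rw [map_sub, hh, sub_self]
    obtain ⟨b, hb⟩ := (D.ρ_eq_zero_iff f _).1 h3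
    exact D.mem_fedder_succ.2 ⟨_, hmem, b, by rw [← hb]; ring⟩

/-- The converse of `IsForm.exists_mem_fedder`, in a form suited for induction: the value at `γ` is
prescribed instead of the restriction to `s(A)`. -/
theorem exists_isForm_gamma {c : A} (hc : f ^ 2 = D.φ f + 2 * c) {J : Ideal B} (j : ℕ) {h : B}
    (hh : h ∈ D.fedder (D.red f) (D.red c) J j) :
    ∃ ψ, D.IsForm f (j + 1) ψ ∧ (∃ g ∈ J, ∀ x, ψ (WittVector.verschiebung^[j] x) =
      (D.τ f)^[j + 1] (D.ρ f g * ev f (x.coeff 0))) ∧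
      ψ (D.gamma f) = D.ρ f (D.u (D.red c * h)) ∧
      (j = 0 → ∀ a, ψ (D.sec.toHom a) = D.ρ f (D.u (h * D.red a))) := by
  induction j generalizing h with
  | zero =>
    obtain ⟨g, hg, rfl⟩ := D.mem_fedder_zero.1 hh
    have hs : ∀ a, (D.τ f) (D.ρ f g * ev f a) = D.ρ f (D.u (D.red f * g * D.red a)) := by
      intro a
      rw [← ρ_red D, ← map_mul, τ_ρ, mul_assoc]
    refine ⟨(D.τ f).comp ((AddMonoidHom.mulLeft (D.ρ f g)).comp
      ((ev f).comp (WittVector.constantCoeff (p := 2))).toAddMonoidHom), ⟨?_, ?_, ?_⟩,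
      ⟨g, hg, ?_⟩, ?_, ?_⟩
    · intro a x
      change D.τ f (D.ρ f g * ev f ((D.sec.toHom (D.φ a) * x).coeff 0)) =
        ev f a * D.τ f (D.ρ f g * ev f (x.coeff 0))
      rw [WittVector.mul_coeff_zero, D.sec.coeff_zero, map_mul (ev f), ev_φ, mul_left_comm,
        τ_sq_mul]
    · intro x hx
      change D.τ f (D.ρ f g * ev f (x.coeff 0)) = 0
      have h0 := congrArg (fun y => y.coeff 0) hx
      simp only [WittVector.map_coeff, WittVector.zero_coeff] at h0
      rw [RingHom.comp_apply, h0, map_zero, mul_zero, map_zero]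
    · intro x
      change D.τ f (D.ρ f g * ev f ((WittVector.verschiebung x).coeff 0)) = 0
      rw [WittVector.verschiebung_coeff_zero, map_zero, mul_zero, map_zero]
    · intro x
      rfl
    · change D.τ f (D.ρ f g * ev f ((D.gamma f).coeff 0)) = _
      have h0 : (D.gamma f).coeff 0 = c := by
        rw [D.gamma_eq hc]
        have := map_add (WittVector.constantCoeff (p := 2) (R := A)) (D.sec.toHom c)
          (WittVector.verschiebung (D.gamma f ^ 2 + D.sec.toHom (D.φ f) * D.gamma f))
        simp only [WittVector.constantCoeff_apply] at this
        rw [this, D.sec.coeff_zero, WittVector.verschiebung_coeff_zero, add_zero]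
      rw [h0, hs, mul_comm]
    · intro _ a
      change D.τ f (D.ρ f g * ev f ((D.sec.toHom a).coeff 0)) = _
      rw [D.sec.coeff_zero, hs]
  | succ j ih =>
    obtain ⟨h', hh', b, rfl⟩ := D.mem_fedder_succ.1 hh
    obtain ⟨ψ', hψ', ⟨g, hg, hψ'g⟩, hγ, -⟩ := ih hh'
    obtain ⟨w, hw⟩ := D.ρ_surjective f (ψ' 1)
    obtain ⟨ψ, hψ, hV, hs⟩ := hψ'.exists_extension
      (D.u (D.red c * h') + D.red f * (b - w)) (by
        rw [map_add, map_mul (D.ρ f), ρ_red, ev_self, zero_mul, add_zero, hγ])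
    refine ⟨ψ, hψ, ⟨g, hg, fun x => ?_⟩, ?_, fun h0 => absurd h0 (Nat.succ_ne_zero j)⟩
    · rw [Function.iterate_succ_apply', hV, hψ'g, ← Function.iterate_succ_apply' (D.τ f)]
    · rw [hψ'.map_gamma hV hs hw hc]
      congr 3
      ring

/-- The converse of `IsForm.exists_mem_fedder`. -/
theorem exists_isForm_sec {c : A} (hc : f ^ 2 = D.φ f + 2 * c) {J : Ideal B} (j : ℕ) {h : B}
    (hh : h ∈ D.fedder (D.red f) (D.red c) J j) :
    ∃ ψ, D.IsForm f (j + 1) ψ ∧ (∃ g ∈ J, ∀ x, ψ (WittVector.verschiebung^[j] x) =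
      (D.τ f)^[j + 1] (D.ρ f g * ev f (x.coeff 0))) ∧
      ∀ a, ψ (D.sec.toHom a) = D.ρ f (D.u (h * D.red a)) := by
  rcases j with _ | j
  · obtain ⟨ψ, h1, h2, -, h3⟩ := D.exists_isForm_gamma hc 0 hh
    exact ⟨ψ, h1, h2, h3 rfl⟩
  · obtain ⟨h', hh', b, rfl⟩ := D.mem_fedder_succ.1 hh
    obtain ⟨ψ', hψ', ⟨g, hg, hψ'g⟩, hγ, -⟩ := D.exists_isForm_gamma hc j hh'
    obtain ⟨ψ, hψ, hV, hs⟩ := hψ'.exists_extension (D.u (D.red c * h') + D.red f * b) (by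
        rw [map_add, map_mul (D.ρ f), ρ_red, ev_self, zero_mul, add_zero, hγ])
    refine ⟨ψ, hψ, ⟨g, hg, fun x => ?_⟩, hs⟩
    rw [Function.iterate_succ_apply', hV, hψ'g, ← Function.iterate_succ_apply' (D.τ f)]

end CartierSetting

/-! ### Splittings and the iterated pushouts -/

section Pushout

variable (p : ℕ) (R : Type u) [CommRing R] [hp : Fact p.Prime]

/-- Pasting the pushout squares of the inductive construction exhibits
`Q_{R,(n_0,…,n_{r+1})}` as the pushout of `F^{n_0}_* Q_{R,(n_1,…,n_{r+1})}` and `Q_{R,n_0}` over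
`F^{n_0}_* R̄`. -/
theorem exists_isPushout_level (r : ℕ) (n : ℕ → ℕ) :
    ∃ inr : QOne p R (n 0) ⟶ (level p R (r + 1)).cod n,
      IsPushout ((push p R (n 0)).map (Phi p R r fun i => n (i + 1))) (verOne p R (n 0))
        ((level p R (r + 1)).ver n) inr ∧
      PhiOne p R (n 0) ≫ inr = Phi p R (r + 1) n := by
  induction r with
  | zero => exact ⟨(level p R 1).psi n, IsPushout.of_hasPushout _ _, rfl⟩
  | succ r ih =>
    obtain ⟨inr, h1, h2⟩ := ih
    have h3 : IsPushout ((push p R (n 0)).map ((level p R (r + 1)).psi fun i => n (i + 1)))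
        ((level p R (r + 1)).ver n) ((level p R (r + 2)).ver n) ((level p R (r + 2)).psi n) :=
      IsPushout.of_hasPushout _ _
    refine ⟨inr ≫ (level p R (r + 2)).psi n, ?_, ?_⟩
    · have h4 : (push p R (n 0)).map (Phi p R (r + 1) fun i => n (i + 1)) =
          (push p R (n 0)).map (Phi p R r fun i => n (i + 1)) ≫
            (push p R (n 0)).map ((level p R (r + 1)).psi fun i => n (i + 1)) :=
        (push p R (n 0)).map_comp (Phi p R r fun i => n (i + 1)) _
      rw [h4]
      exact h1.paste_horiz h3
    · exact (Category.assoc (PhiOne p R (n 0)) inr ((level p R (r + 2)).psi n)).symm.trans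
        (congrArg (fun q : _ ⟶ (level p R (r + 1)).cod n => q ≫ (level p R (r + 2)).psi n) h2)

/-- The ideal of values at `Φ (1)` of linear forms on `Q_{R,(n_0,…,n_r)}`. -/
def valueIdeal (r : ℕ) (n : ℕ → ℕ) : Ideal (ModP p R) where
  carrier := {t | ∃ ψ : (level p R r).cod n ⟶ ModuleCat.of (ModP p R) (ModP p R),
    ψ.hom ((Phi p R r n).hom (1 : ModP p R)) = t}
  zero_mem' := ⟨0, rfl⟩
  add_mem' := by
    rintro _ _ ⟨ψ, rfl⟩ ⟨ψ', rfl⟩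
    exact ⟨ψ + ψ', rfl⟩
  smul_mem' := by
    rintro a _ ⟨ψ, rfl⟩
    exact ⟨ModuleCat.ofHom (a • ψ.hom), rfl⟩

theorem mem_valueIdeal {r : ℕ} {n : ℕ → ℕ} {t : ModP p R} :
    t ∈ valueIdeal p R r n ↔ ∃ ψ : (level p R r).cod n ⟶ ModuleCat.of (ModP p R) (ModP p R),
      ψ.hom ((Phi p R r n).hom (1 : ModP p R)) = t := Iff.rfl

theorem isSplitMono_iff_exists_eq_one {S : Type u} [CommRing S] {M : ModuleCat.{u} S}
    (φ : ModuleCat.of S S ⟶ M) :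
    IsSplitMono φ ↔ ∃ ψ : M ⟶ ModuleCat.of S S, ψ.hom (φ.hom (1 : S)) = (1 : S) := by
  constructor
  · rintro ⟨⟨ψ, hψ⟩⟩
    exact ⟨ψ, congrArg (fun q => q.hom (1 : S)) hψ⟩
  · rintro ⟨ψ, hψ⟩
    exact ⟨⟨ψ, ModuleCat.hom_ext (LinearMap.ext_ring hψ)⟩⟩

theorem isSplitMono_Phi_iff (r : ℕ) (n : ℕ → ℕ) :
    IsSplitMono (Phi p R r n) ↔ valueIdeal p R r n = ⊤ := by
  rw [Ideal.eq_top_iff_one, mem_valueIdeal]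
  exact isSplitMono_iff_exists_eq_one _

end Pushout

namespace CartierSetting

variable {A B : Type u} [CommRing A] [CommRing B] (D : CartierSetting A B) {f : A}

/-- The projection `W(A) → W_m(R) / 2 W_m(R)` for `R = A / (f)`. -/
noncomputable def toWBarQuot (f : A) (m : ℕ) : WittVector 2 A →+* WBar 2 (A ⧸ Ideal.span {f}) m :=
  (toWBar 2 (A ⧸ Ideal.span {f}) m).comp (wittQuot f)

theorem toWBarQuot_surjective (m : ℕ) : Function.Surjective (toWBarQuot f m) :=
  (Ideal.Quotient.mk_surjective.comp (WittVector.truncate_surjective 2 m _)).comp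
    (WittVector.map_surjective _ Ideal.Quotient.mk_surjective)

theorem toWBarQuot_sec (m : ℕ) (a : A) :
    toWBarQuot f m (D.sec.toHom (D.φ a)) = frobWitt 2 (A ⧸ Ideal.span {f}) m (ev f a) := by
  rw [← D.sec.frobenius]
  have h1 : wittQuot f (WittVector.frobenius (D.sec.toHom a)) =
      WittVector.frobenius (wittQuot f (D.sec.toHom a)) :=
    (WittVector.frobenius_isPoly 2).map _ _
  change toWBar 2 _ m (wittQuot f _) =
    toWBar 2 _ m (WittVector.frobenius (WittVector.teichmuller 2 _))
  rw [h1]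
  apply toWBar_frobenius_congr
  rw [WittVector.map_coeff, D.sec.coeff_zero, WittVector.teichmuller_coeff_zero]

theorem toWBarQuot_verschiebung (j : ℕ) (x : WittVector 2 A) :
    toWBarQuot f (j + 1) (WittVector.verschiebung^[j] x) =
      verWitt 2 (A ⧸ Ideal.span {f}) (j + 1) (ev f (x.coeff 0)) := by
  have h1 : wittQuot f (WittVector.verschiebung^[j] x) =
      WittVector.verschiebung^[j] (wittQuot f x) := by
    induction j with
    | zero => rfl
    | succ j ih =>
      rw [Function.iterate_succ_apply', Function.iterate_succ_apply', WittVector.map_verschiebung,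
        ih]
  have h2 := verWitt_coeff_zero 2 (A ⧸ Ideal.span {f}) (j + 1) (wittQuot f x)
  rw [Nat.add_sub_cancel, WittVector.map_coeff] at h2
  rw [toWBarQuot, RingHom.comp_apply, h1, h2]
  rfl

theorem toWBarQuot_iterate_verschiebung (m : ℕ) (x : WittVector 2 A) :
    toWBarQuot f m (WittVector.verschiebung^[m] x) = 0 := by
  have : WittVector.truncate m (wittQuot f (WittVector.verschiebung^[m] x)) = 0 := by
    ext i
    rw [WittVector.coeff_truncate, TruncatedWittVector.coeff_zero, WittVector.map_coeff,
      WittVector.iterate_verschiebung_coeff_eq_zero _ i.2, map_zero]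
  rw [toWBarQuot, RingHom.comp_apply, toWBar, RingHom.comp_apply, this, map_zero]

/-- The kernel of `W(A) → W_m(R) / 2 W_m(R)` is spanned by `V ^ m W(A)`, multiples of two and the
kernel of `W(A) → W(R)`. -/
theorem exists_of_toWBarQuot_eq_zero {m : ℕ} {x : WittVector 2 A} (hx : toWBarQuot f m x = 0) :
    ∃ y z, wittQuot f (x - 2 * y - WittVector.verschiebung^[m] z) = 0 := by
  have h1 : WittVector.truncate m (wittQuot f x) ∈ Ideal.span
      {((2 : ℕ) : TruncatedWittVector 2 m (A ⧸ Ideal.span {f}))} :=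
    Ideal.Quotient.eq_zero_iff_mem.1 hx
  obtain ⟨t, ht⟩ := Ideal.mem_span_singleton.1 h1
  obtain ⟨t, rfl⟩ := WittVector.truncate_surjective 2 m _ t
  obtain ⟨y, rfl⟩ := WittVector.map_surjective _ Ideal.Quotient.mk_surjective t
  have h2 : ∀ i < m, (wittQuot f (x - 2 * y)).coeff i = 0 := by
    rw [← WittVector.mem_ker_truncate, RingHom.mem_ker, map_sub, map_sub, ht, map_mul, map_mul,
      map_ofNat (wittQuot f), map_ofNat (WittVector.truncate m), Nat.cast_ofNat, sub_self]
  have h3 := WittVector.eq_iterate_verschiebung h2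
  obtain ⟨z, hz⟩ := WittVector.map_surjective (Ideal.Quotient.mk (Ideal.span {f}))
    Ideal.Quotient.mk_surjective ((wittQuot f (x - 2 * y)).shift m)
  refine ⟨y, z, ?_⟩
  have h4 : ∀ (j : ℕ) (z : WittVector 2 A), wittQuot f (WittVector.verschiebung^[j] z) =
      WittVector.verschiebung^[j] (wittQuot f z) := by
    intro j
    induction j with
    | zero => intro z; rfl
    | succ j ih =>
      intro z
      rw [Function.iterate_succ_apply, ih, WittVector.map_verschiebung,
        Function.iterate_succ_apply]
  rw [map_sub, h4, hz, ← h3, sub_self]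

/-- The form on `W(A)` attached to a linear form on `Q_{R,m}`. -/
noncomputable def formOfHom {m : ℕ} (ψ : QOne 2 (A ⧸ Ideal.span {f}) m ⟶
    ModuleCat.of (ModP 2 (A ⧸ Ideal.span {f})) (ModP 2 (A ⧸ Ideal.span {f}))) :
    WittVector 2 A →+ ModP 2 (A ⧸ Ideal.span {f}) where
  toFun x := ψ.hom (toWBarQuot f m x : WBar 2 (A ⧸ Ideal.span {f}) m)
  map_zero' := by
    rw [map_zero]
    exact map_zero ψ.hom
  map_add' x y := by
    rw [map_add]
    exact map_add ψ.hom _ _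

theorem formOfHom_apply {m : ℕ} (ψ : QOne 2 (A ⧸ Ideal.span {f}) m ⟶
    ModuleCat.of (ModP 2 (A ⧸ Ideal.span {f})) (ModP 2 (A ⧸ Ideal.span {f})))
    (x : WittVector 2 A) :
    formOfHom ψ x = ψ.hom (toWBarQuot f m x : WBar 2 (A ⧸ Ideal.span {f}) m) := rfl

theorem isForm_formOfHom {m : ℕ} (ψ : QOne 2 (A ⧸ Ideal.span {f}) m ⟶
    ModuleCat.of (ModP 2 (A ⧸ Ideal.span {f})) (ModP 2 (A ⧸ Ideal.span {f}))) :
    D.IsForm f m (formOfHom ψ) := by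
  refine ⟨fun a x => ?_, fun x hx => ?_, fun x => ?_⟩
  · rw [formOfHom_apply, map_mul (toWBarQuot f m), D.toWBarQuot_sec]
    exact map_smul ψ.hom (ev f a) _
  · rw [formOfHom_apply, toWBarQuot, RingHom.comp_apply, hx, map_zero]
    exact map_zero ψ.hom
  · rw [formOfHom_apply, toWBarQuot_iterate_verschiebung]
    exact map_zero ψ.hom

theorem exists_formOfHom_eq {m : ℕ} {ψ : WittVector 2 A →+ ModP 2 (A ⧸ Ideal.span {f})}
    (hψ : D.IsForm f m ψ) : ∃ ψ' : QOne 2 (A ⧸ Ideal.span {f}) m ⟶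
      ModuleCat.of (ModP 2 (A ⧸ Ideal.span {f})) (ModP 2 (A ⧸ Ideal.span {f})),
      formOfHom ψ' = ψ := by
  let l : WBar 2 (A ⧸ Ideal.span {f}) m →+ ModP 2 (A ⧸ Ideal.span {f}) :=
    AddMonoidHom.liftOfSurjective (toWBarQuot f m).toAddMonoidHom (toWBarQuot_surjective m)
      ⟨ψ, fun x hx => by
        obtain ⟨y, z, h⟩ := exists_of_toWBarQuot_eq_zero hx
        have := hψ.ker _ h
        rwa [map_sub, map_sub, map_two_mul_eq_zero, hψ.ver, sub_zero, sub_zero] at this⟩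
  have hl : ∀ x, l (toWBarQuot f m x) = ψ x := fun x =>
    AddMonoidHom.liftOfRightInverse_comp_apply (toWBarQuot f m).toAddMonoidHom _ _ _ x
  refine ⟨ModuleCat.ofHom (X := QOne 2 (A ⧸ Ideal.span {f}) m)
    { toFun := fun x => l (x : WBar 2 (A ⧸ Ideal.span {f}) m)
      map_add' := fun x y => map_add l x y
      map_smul' := fun a x => ?_ }, ?_⟩
  · obtain ⟨a, rfl⟩ := ev_surjective f a
    obtain ⟨x, rfl⟩ := toWBarQuot_surjective (f := f) m x
    change l (frobWitt 2 (A ⧸ Ideal.span {f}) m (ev f a) * toWBarQuot f m x) =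
      ev f a * l (toWBarQuot f m x)
    rw [← D.toWBarQuot_sec, ← map_mul (toWBarQuot f m), hl, hl, hψ.smul]
  · ext x
    exact hl x

variable [IsDomain B]

/-- The recursion for the ideals of values: a linear form on the pushout is a linear form on
`Q_{R,n_0}` whose restriction to `V ^ (n_0 - 1)` is given, through duality for Frobenius, by a value
of a linear form on `Q_{R,(n_1,…,n_{r+1})}`. -/
theorem mem_valueIdeal_succ (hf : D.red f ≠ 0) {r : ℕ} {n : ℕ → ℕ}
    {t : ModP 2 (A ⧸ Ideal.span {f})} :
    t ∈ valueIdeal 2 (A ⧸ Ideal.span {f}) (r + 1) n ↔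
      ∃ ψ : QOne 2 (A ⧸ Ideal.span {f}) (n 0) ⟶
        ModuleCat.of (ModP 2 (A ⧸ Ideal.span {f})) (ModP 2 (A ⧸ Ideal.span {f})),
      ψ.hom ((PhiOne 2 (A ⧸ Ideal.span {f}) (n 0)).hom (1 : ModP 2 (A ⧸ Ideal.span {f}))) = t ∧
      ∃ g ∈ valueIdeal 2 (A ⧸ Ideal.span {f}) r fun i => n (i + 1),
        ∀ b : ModP 2 (A ⧸ Ideal.span {f}),
          ψ.hom ((verOne 2 (A ⧸ Ideal.span {f}) (n 0)).hom b) = (D.τ f)^[n 0] (g * b) := by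
  obtain ⟨inr, hpo, hinr⟩ := exists_isPushout_level 2 (A ⧸ Ideal.span {f}) r n
  rw [mem_valueIdeal]
  constructor
  · rintro ⟨Ψ, rfl⟩
    refine ⟨inr ≫ Ψ, by rw [← hinr]; rfl, ?_⟩
    obtain ⟨l, hl⟩ := D.exists_linearMap_eq_τ_iterate f hf
      (M := (level 2 (A ⧸ Ideal.span {f}) r).cod fun i => n (i + 1)) (n 0)
      (((level 2 (A ⧸ Ideal.span {f}) (r + 1)).ver n ≫ Ψ).hom.toAddMonoidHom)
      (fun a x => ((level 2 (A ⧸ Ideal.span {f}) (r + 1)).ver n ≫ Ψ).hom.map_smul a x)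
    refine ⟨l ((Phi 2 (A ⧸ Ideal.span {f}) r fun i => n (i + 1)).hom
      (1 : ModP 2 (A ⧸ Ideal.span {f}))), ⟨ModuleCat.ofHom l, rfl⟩, fun b => ?_⟩
    have h1 := congrArg (fun q => (q ≫ Ψ).hom b) hpo.w
    have h2 : (verOne 2 (A ⧸ Ideal.span {f}) (n 0) ≫ inr ≫ Ψ).hom b =
        (D.τ f)^[n 0] (l ((Phi 2 (A ⧸ Ideal.span {f}) r fun i => n (i + 1)).hom b)) := by
      rw [← hl, ← Category.assoc]
      exact h1.symm
    have h3 : (Phi 2 (A ⧸ Ideal.span {f}) r fun i => n (i + 1)).hom b =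
        b • (Phi 2 (A ⧸ Ideal.span {f}) r fun i => n (i + 1)).hom
          (1 : ModP 2 (A ⧸ Ideal.span {f})) := by
      rw [← map_smul]
      congr 1
      exact (mul_one b).symm
    rw [h3, map_smul, smul_eq_mul, mul_comm] at h2
    exact h2
  · rintro ⟨ψ, rfl, g, ⟨l, rfl⟩, hg⟩
    let Ψ' : (push 2 (A ⧸ Ideal.span {f}) (n 0)).obj
        ((level 2 (A ⧸ Ideal.span {f}) r).cod fun i => n (i + 1)) ⟶
        ModuleCat.of (ModP 2 (A ⧸ Ideal.span {f})) (ModP 2 (A ⧸ Ideal.span {f})) :=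
      ModuleCat.ofHom (X := (push 2 (A ⧸ Ideal.span {f}) (n 0)).obj
          ((level 2 (A ⧸ Ideal.span {f}) r).cod fun i => n (i + 1)))
        { toFun := fun x => (D.τ f)^[n 0] (l.hom x)
          map_add' := fun x y => by
            rw [← iterate_map_add]
            exact congrArg _ (map_add l.hom x y)
          map_smul' := fun a x => by
            rw [RingHom.id_apply, smul_eq_mul, ← τ_iterate_pow_mul]
            exact congrArg _ (l.hom.map_smul (a ^ 2 ^ n 0) x) }
    have hw : (push 2 (A ⧸ Ideal.span {f}) (n 0)).map
        (Phi 2 (A ⧸ Ideal.span {f}) r fun i => n (i + 1)) ≫ Ψ' =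
        verOne 2 (A ⧸ Ideal.span {f}) (n 0) ≫ ψ := by
      refine ModuleCat.hom_ext (LinearMap.ext fun (b : ModP 2 (A ⧸ Ideal.span {f})) => ?_)
      refine Eq.trans ?_ (hg b).symm
      change (D.τ f)^[n 0] (l.hom ((Phi 2 (A ⧸ Ideal.span {f}) r fun i => n (i + 1)).hom b)) = _
      have h3 : (Phi 2 (A ⧸ Ideal.span {f}) r fun i => n (i + 1)).hom b =
          b •
          (Phi 2 (A ⧸ Ideal.span {f}) r fun i => n (i + 1)).hom
            (1 : ModP 2 (A ⧸ Ideal.span {f})) := by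
        rw [← map_smul]
        congr 1
        exact (mul_one _).symm
      rw [h3, map_smul, smul_eq_mul, mul_comm]
    refine ⟨hpo.desc Ψ' ψ hw, ?_⟩
    have h1 := congrArg (fun q => ((PhiOne 2 (A ⧸ Ideal.span {f}) (n 0)) ≫ q).hom
      (1 : ModP 2 (A ⧸ Ideal.span {f}))) (hpo.inr_desc Ψ' ψ hw)
    rw [← hinr]
    exact h1

variable [IsDomain A] [CharZero A]

theorem mem_trIdeal_fedder (hf : D.red f ≠ 0) {c : A} (hc : f ^ 2 = D.φ f + 2 * c) {j : ℕ}
    {J : Ideal (ModP 2 (A ⧸ Ideal.span {f}))} {t : B} :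
    t ∈ D.trIdeal (D.fedder (D.red f) (D.red c) (J.comap (D.ρ f)) j) ↔
      ∃ ψ : QOne 2 (A ⧸ Ideal.span {f}) (j + 1) ⟶
        ModuleCat.of (ModP 2 (A ⧸ Ideal.span {f})) (ModP 2 (A ⧸ Ideal.span {f})),
      ψ.hom ((PhiOne 2 (A ⧸ Ideal.span {f}) (j + 1)).hom (1 : ModP 2 (A ⧸ Ideal.span {f}))) =
        D.ρ f t ∧
      ∃ g ∈ J, ∀ b : ModP 2 (A ⧸ Ideal.span {f}),
          ψ.hom ((verOne 2 (A ⧸ Ideal.span {f}) (j + 1)).hom b) = (D.τ f)^[j + 1] (g * b) := by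
  have hone : ∀ ψ : QOne 2 (A ⧸ Ideal.span {f}) (j + 1) ⟶
      ModuleCat.of (ModP 2 (A ⧸ Ideal.span {f})) (ModP 2 (A ⧸ Ideal.span {f})),
      ψ.hom ((PhiOne 2 (A ⧸ Ideal.span {f}) (j + 1)).hom (1 : ModP 2 (A ⧸ Ideal.span {f}))) =
        formOfHom ψ (D.sec.toHom 1) := by
    intro ψ
    rw [formOfHom_apply]
    apply congrArg
    change frobWitt 2 _ _ 1 = _
    rw [map_one, map_one, map_one]
  have hver : ∀ (ψ : QOne 2 (A ⧸ Ideal.span {f}) (j + 1) ⟶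
      ModuleCat.of (ModP 2 (A ⧸ Ideal.span {f})) (ModP 2 (A ⧸ Ideal.span {f})))
      (x : WittVector 2 A),
      formOfHom ψ (WittVector.verschiebung^[j] x) =
        ψ.hom ((verOne 2 (A ⧸ Ideal.span {f}) (j + 1)).hom (ev f (x.coeff 0))) := by
    intro ψ x
    rw [formOfHom_apply, toWBarQuot_verschiebung]
    rfl
  rw [mem_trIdeal]
  constructor
  · rintro ⟨h, hh, rfl⟩
    obtain ⟨ψ, hψ, ⟨g, hg, hψg⟩, hs⟩ := D.exists_isForm_sec hc j hh
    obtain ⟨ψ, rfl⟩ := D.exists_formOfHom_eq hψ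
    refine ⟨ψ, by rw [hone, hs, map_one, mul_one], D.ρ f g, hg, fun b => ?_⟩
    obtain ⟨a, rfl⟩ := ev_surjective f b
    have := hψg (D.sec.toHom a)
    rwa [hver, D.sec.coeff_zero] at this
  · rintro ⟨ψ, h1, g, hg, hψ⟩
    obtain ⟨g, rfl⟩ := D.ρ_surjective f g
    obtain ⟨h, hh, hs⟩ := (D.isForm_formOfHom ψ).exists_mem_fedder hf hc
      (J := J.comap (D.ρ f)) hg j (fun x => by rw [hver, hψ])
    rw [hone, hs, map_one, mul_one, eq_comm, ← sub_eq_zero, ← map_sub, ρ_eq_zero_iff] at h1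
    obtain ⟨d, hd⟩ := h1
    obtain ⟨e, rfl⟩ := D.u_surjective d
    refine ⟨h + D.red f * (D.red f * e), Ideal.add_mem _ hh ?_, ?_⟩
    · rcases j with _ | j
      · refine D.mem_fedder_zero.2 ⟨_, ?_, rfl⟩
        rw [Ideal.mem_comap, map_mul, ρ_red, ev_self, zero_mul]
        exact J.zero_mem
      · exact D.mem_fedder_succ.2 ⟨0, Ideal.zero_mem _, D.red f * e, by simp⟩
    · rw [map_add, ← mul_assoc, ← pow_two, D.u_sq_mul, ← hd]
      ring

/-- The Fedder type criterion, recursive form. -/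
theorem comap_valueIdeal_succ (hf : D.red f ≠ 0) {c : A} (hc : f ^ 2 = D.φ f + 2 * c) (r : ℕ)
    (n : ℕ → ℕ) (hn : 1 ≤ n 0) :
    (valueIdeal 2 (A ⧸ Ideal.span {f}) (r + 1) n).comap (D.ρ f) =
      D.trIdeal (D.fedder (D.red f) (D.red c)
        ((valueIdeal 2 (A ⧸ Ideal.span {f}) r fun i => n (i + 1)).comap (D.ρ f)) (n 0 - 1)) := by
  ext t
  rw [Ideal.mem_comap, D.mem_valueIdeal_succ hf, D.mem_trIdeal_fedder hf hc, Nat.sub_add_cancel hn]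

/-- The Fedder type criterion for one-term sequences. -/
theorem comap_valueIdeal_zero (hf : D.red f ≠ 0) {c : A} (hc : f ^ 2 = D.φ f + 2 * c)
    (n : ℕ → ℕ) (hn : 1 ≤ n 0) :
    (valueIdeal 2 (A ⧸ Ideal.span {f}) 0 n).comap (D.ρ f) =
      D.trIdeal (D.fedder (D.red f) (D.red c) ⊤ (n 0 - 1)) := by
  ext t
  rw [Ideal.mem_comap, ← Ideal.comap_top (f := D.ρ f), D.mem_trIdeal_fedder hf hc,
    Nat.sub_add_cancel hn, mem_valueIdeal]
  constructor
  · rintro ⟨ψ, hψ⟩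
    refine ⟨ψ, hψ, ?_⟩
    obtain ⟨l, hl⟩ := D.exists_linearMap_eq_τ_iterate f hf
      (M := ModP 2 (A ⧸ Ideal.span {f})) (n 0)
      ((verOne 2 (A ⧸ Ideal.span {f}) (n 0) ≫ ψ).hom.toAddMonoidHom)
      (fun a x => (verOne 2 (A ⧸ Ideal.span {f}) (n 0) ≫ ψ).hom.map_smul a x)
    refine ⟨l 1, trivial, fun b => (hl b).trans ?_⟩
    rw [mul_comm, ← smul_eq_mul, ← map_smul, smul_eq_mul, mul_one]
  · rintro ⟨ψ, hψ, -⟩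
    exact ⟨ψ, hψ⟩

end CartierSetting

/-! ### The chain of ideals computing the multi-height -/

namespace CartierSetting

variable {A B : Type u} [CommRing A] [CommRing B] (D : CartierSetting A B)

/-- The Frobenius power `P^{[2]}` of an ideal, described through the trace. -/
def frobIdeal (P : Ideal B) : Ideal B where
  carrier := {g | ∀ a, D.u (a * g) ∈ P}
  zero_mem' := fun a => by simp
  add_mem' := fun {g h} hg hh a => by
    rw [mul_add, map_add]
    exact P.add_mem (hg a) (hh a)
  smul_mem' := fun b g hg a => by
    rw [smul_eq_mul, ← mul_assoc]
    exact hg _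

theorem trIdeal_le_iff {I P : Ideal B} : D.trIdeal I ≤ P ↔ I ≤ D.frobIdeal P := by
  constructor
  · intro h g hg a
    exact h ⟨_, I.mul_mem_left a hg, rfl⟩
  · rintro h _ ⟨g, hg, rfl⟩
    simpa using h hg 1

/-- The element `f c ^ (2 ^ (m - 1) - 1)` governing the splitting at level `m`. -/
def testElt (f c : B) (m : ℕ) : B := f * c ^ (2 ^ (m - 1) - 1)

theorem pow_mul_mem_fedder_iff (f c : B) (J : Ideal B) (j e : ℕ) (Q : Ideal B) :
    (∀ h ∈ D.fedder f c J j, c ^ e * h ∈ Q) ↔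
      (∀ i < j, f * c ^ ((e + 1) * 2 ^ i - 1) ∈ D.frobIdeal^[i] Q) ∧
        ∀ g ∈ J, f * c ^ ((e + 1) * 2 ^ j - 1) * g ∈ D.frobIdeal^[j] Q := by
  induction j generalizing e Q with
  | zero =>
    simp only [not_lt_zero, IsEmpty.forall_iff, implies_true, true_and, pow_zero, mul_one,
      Nat.add_sub_cancel, Function.iterate_zero, id_eq]
    constructor
    · intro h g hg
      have := h _ (D.mem_fedder_zero.2 ⟨g, hg, rfl⟩)
      rwa [mul_comm f, mul_assoc]
    · intro h x hx
      obtain ⟨g, hg, rfl⟩ := D.mem_fedder_zero.1 hx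
      have := h g hg
      rwa [mul_comm f, mul_assoc] at this
  | succ j ih =>
    have h1 : (∀ h ∈ D.fedder f c J (j + 1), c ^ e * h ∈ Q) ↔
        f * c ^ e ∈ Q ∧ ∀ h ∈ D.fedder f c J j, c ^ (2 * e + 1) * h ∈ D.frobIdeal Q := by
      have h2 : ∀ x, c ^ e * D.u (c * x) = D.u (c ^ (2 * e + 1) * x) := by
        intro x
        rw [← D.u_sq_mul, ← pow_mul, mul_comm e 2, ← mul_assoc, ← pow_succ]
      constructor
      · intro h
        refine ⟨?_, fun x hx a => ?_⟩
        · have := h _ (D.mem_fedder_succ.2 ⟨0, Ideal.zero_mem _, 1, rfl⟩)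
          rwa [mul_zero, map_zero, zero_add, mul_one, mul_comm] at this
        · have := h _ (D.mem_fedder_succ.2 ⟨a * x, Ideal.mul_mem_left _ a hx, 0, rfl⟩)
          rwa [mul_zero, add_zero, h2, mul_left_comm] at this
      · rintro ⟨h3, h4⟩ x hx
        obtain ⟨y, hy, b, rfl⟩ := D.mem_fedder_succ.1 hx
        rw [mul_add, h2]
        refine Q.add_mem ?_ ?_
        · simpa using h4 y hy 1
        · rw [← mul_assoc, mul_comm _ f]
          exact Q.mul_mem_right _ h3
    have h5 : ∀ i, (2 * e + 1 + 1) * 2 ^ i = (e + 1) * 2 ^ (i + 1) := fun i => by ring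
    rw [h1, ih]
    simp only [h5, ← Function.iterate_succ_apply D.frobIdeal]
    constructor
    · rintro ⟨h2, h3, h4⟩
      refine ⟨fun i hi => ?_, h4⟩
      rcases i with _ | i
      · simpa using h2
      · exact h3 i (by omega)
    · rintro ⟨h3, h4⟩
      refine ⟨by simpa using h3 0 (by omega), fun i hi => h3 (i + 1) (by omega), h4⟩

/-- The ideal of all `g` with `f c ^ (2 ^ (m - 1) - 1) g ∈ P^{[2 ^ m]}`. -/
def nextIdeal (f c : B) (P : Ideal B) (m : ℕ) : Ideal B :=
  Submodule.comap (LinearMap.mulLeft B (testElt f c m)) (D.frobIdeal^[m] P)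

theorem mem_nextIdeal {f c : B} {P : Ideal B} {m : ℕ} {g : B} :
    g ∈ D.nextIdeal f c P m ↔ testElt f c m * g ∈ D.frobIdeal^[m] P := Iff.rfl

theorem trIdeal_fedder_le_iff (f c : B) (J : Ideal B) (j : ℕ) (P : Ideal B) :
    D.trIdeal (D.fedder f c J j) ≤ P ↔
      (∀ m, 1 ≤ m → m < j + 1 → testElt f c m ∈ D.frobIdeal^[m] P) ∧
        J ≤ D.nextIdeal f c P (j + 1) := by
  have h1 := D.pow_mul_mem_fedder_iff f c J j 0 (D.frobIdeal P)
  simp only [pow_zero, one_mul, zero_add, ← Function.iterate_succ_apply D.frobIdeal] at h1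
  rw [trIdeal_le_iff]
  refine h1.trans ?_
  constructor
  · rintro ⟨h2, h3⟩
    refine ⟨fun m hm hmj => ?_, fun g hg => ?_⟩
    · obtain ⟨i, rfl⟩ : ∃ i, m = i + 1 := ⟨m - 1, by omega⟩
      exact h2 i (by omega)
    · exact h3 g hg
  · rintro ⟨h2, h3⟩
    exact ⟨fun i hi => h2 (i + 1) (by omega) (by omega), fun g hg => h3 hg⟩

/-- The sequence of ideals `P_0 = P` and `P_{i+1} = (P_i^{[2 ^ {n_i}]} : f c ^ (2 ^ {n_i - 1} - 1))`
belonging to a sequence `n`. -/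
def chainIdeal (f c : B) (P : Ideal B) (n : ℕ → ℕ) : ℕ → Ideal B
  | 0 => P
  | i + 1 => D.nextIdeal f c (chainIdeal f c P n i) (n i)

theorem chainIdeal_nextIdeal (f c : B) (P : Ideal B) (n : ℕ → ℕ) (i : ℕ) :
    D.chainIdeal f c (D.nextIdeal f c P (n 0)) (fun j => n (j + 1)) i =
      D.chainIdeal f c P n (i + 1) := by
  induction i with
  | zero => rfl
  | succ i ih => rw [chainIdeal, ih]; rfl

theorem chainIdeal_congr (f c : B) (P : Ideal B) {n n' : ℕ → ℕ} {i : ℕ}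
    (h : ∀ j < i, n j = n' j) : D.chainIdeal f c P n i = D.chainIdeal f c P n' i := by
  induction i with
  | zero => rfl
  | succ i ih => rw [chainIdeal, chainIdeal, ih fun j hj => h j (by omega), h i (by omega)]

/-- The levels at which the ideal `P` detects a splitting; the entry of the multi-height belonging
to `P` is the least of them. -/
def splitLevels (f c : B) (P : Ideal B) : Set ℕ :=
  {m | 1 ≤ m ∧ testElt f c m ∉ D.frobIdeal^[m] P}

variable {f : A} [IsDomain A] [CharZero A] [IsDomain B]

theorem comap_valueIdeal_le_iff (hf : D.red f ≠ 0) {c : A} (hc : f ^ 2 = D.φ f + 2 * c) (r : ℕ)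
    (n : ℕ → ℕ) (hn : ∀ i ≤ r, 1 ≤ n i) (P : Ideal B)
    (hmin : ∀ i < r, ∀ m, 1 ≤ m → m < n i → testElt (D.red f) (D.red c) m ∈
      D.frobIdeal^[m] (D.chainIdeal (D.red f) (D.red c) P n i)) :
    (valueIdeal 2 (A ⧸ Ideal.span {f}) r n).comap (D.ρ f) ≤ P ↔
      ∀ m, 1 ≤ m → m ≤ n r → testElt (D.red f) (D.red c) m ∈
        D.frobIdeal^[m] (D.chainIdeal (D.red f) (D.red c) P n r) := by
  induction r generalizing n P with
  | zero =>
    rw [D.comap_valueIdeal_zero hf hc n (hn 0 le_rfl), trIdeal_fedder_le_iff,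
      Nat.sub_add_cancel (hn 0 le_rfl)]
    constructor
    · rintro ⟨h1, h2⟩ m hm hmn
      rcases hmn.lt_or_eq with h | rfl
      · exact h1 m hm h
      · have := h2 (show (1 : B) ∈ (⊤ : Ideal B) from trivial)
        rwa [mem_nextIdeal, mul_one] at this
    · intro h
      refine ⟨fun m hm hmn => h m hm hmn.le, fun g _ => ?_⟩
      rw [mem_nextIdeal]
      exact Ideal.mul_mem_right _ _ (h _ (hn 0 le_rfl) le_rfl)
  | succ r ih =>
    rw [D.comap_valueIdeal_succ hf hc r n (hn 0 (Nat.zero_le _)), trIdeal_fedder_le_iff,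
      Nat.sub_add_cancel (hn 0 (Nat.zero_le _)), ih _ (fun i hi => hn (i + 1) (by omega)),
      chainIdeal_nextIdeal]
    · exact and_iff_right (hmin 0 (Nat.succ_pos r))
    · intro i hi m hm hmn
      rw [chainIdeal_nextIdeal]
      exact hmin (i + 1) (by omega) m hm hmn

/-- The multi-height is read off from the ideals `P_i`: the entry `h_i` is the least `m ≥ 1` with
`f c ^ (2 ^ (m - 1) - 1) ∉ P_i^{[2 ^ m]}`. -/
theorem isMultiHeight_iff [IsLocalRing B] (hf : D.red f ≠ 0) {c : A}
    (hc : f ^ 2 = D.φ f + 2 * c) (h : ℕ → ℕ) :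
    IsMultiHeight 2 (A ⧸ Ideal.span {f}) h ↔
      ∀ r, IsLeast (D.splitLevels (D.red f) (D.red c)
        (D.chainIdeal (D.red f) (D.red c) (IsLocalRing.maximalIdeal B) h r)) (h r) := by
  -- The two families of sets have the same least elements, given the earlier entries.
  have key : ∀ r, (∀ i < r, IsLeast (D.splitLevels (D.red f) (D.red c)
        (D.chainIdeal (D.red f) (D.red c) (IsLocalRing.maximalIdeal B) h i)) (h i)) →
      ∀ m, 1 ≤ m → (IsSplitMono (Phi 2 (A ⧸ Ideal.span {f}) r fun i => if i < r then h i else m) ↔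
        ∃ m', 1 ≤ m' ∧ m' ≤ m ∧ testElt (D.red f) (D.red c) m' ∉ D.frobIdeal^[m']
          (D.chainIdeal (D.red f) (D.red c) (IsLocalRing.maximalIdeal B) h r)) := by
    intro r hr m hm
    have hcongr : ∀ i ≤ r, D.chainIdeal (D.red f) (D.red c) (IsLocalRing.maximalIdeal B)
        (fun i => if i < r then h i else m) i =
        D.chainIdeal (D.red f) (D.red c) (IsLocalRing.maximalIdeal B) h i := fun i hi =>
      D.chainIdeal_congr _ _ _ fun j hj => if_pos (by omega)
    have h1 := D.comap_valueIdeal_le_iff hf hc r (fun i => if i < r then h i else m)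
      (fun i hi => by
        split_ifs with hir
        · exact (hr i hir).1.1
        · exact hm) (IsLocalRing.maximalIdeal B) (fun i hi m' hm' hlt => by
        rw [hcongr i hi.le]
        simp only [if_pos hi] at hlt
        by_contra hcon
        exact absurd ((hr i hi).2 ⟨hm', hcon⟩) (by omega))
    rw [hcongr r le_rfl] at h1
    simp only [lt_irrefl, if_false] at h1
    have h2 : IsSplitMono (Phi 2 (A ⧸ Ideal.span {f}) r fun i => if i < r then h i else m) ↔
        ¬ (valueIdeal 2 (A ⧸ Ideal.span {f}) r fun i => if i < r then h i else m).comap (D.ρ f) ≤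
          IsLocalRing.maximalIdeal B := by
      rw [isSplitMono_Phi_iff]
      constructor
      · intro h3 h4
        rw [h3, Ideal.comap_top] at h4
        exact Ideal.IsPrime.ne_top inferInstance (top_le_iff.1 h4)
      · intro h3
        by_contra h4
        apply h3
        apply IsLocalRing.le_maximalIdeal
        rw [Ne, Ideal.eq_top_iff_one, Ideal.mem_comap, map_one, ← Ideal.eq_top_iff_one]
        exact h4
    rw [h2, h1]
    push Not
    rfl
  have key2 : ∀ (S T : Set ℕ) (a : ℕ), (∀ m, m ∈ T ↔ ∃ m' ≤ m, m' ∈ S) →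
      (IsLeast T a ↔ IsLeast S a) := by
    intro S T a hST
    constructor
    · rintro ⟨h1, h2⟩
      obtain ⟨m', hm', hS⟩ := (hST a).1 h1
      have := h2 ((hST m').2 ⟨m', le_rfl, hS⟩)
      obtain rfl : m' = a := le_antisymm hm' this
      exact ⟨hS, fun b hb => h2 ((hST b).2 ⟨b, le_rfl, hb⟩)⟩
    · rintro ⟨h1, h2⟩
      refine ⟨(hST a).2 ⟨a, le_rfl, h1⟩, fun b hb => ?_⟩
      obtain ⟨m', hm', hS⟩ := (hST b).1 hb
      exact (h2 hS).trans hm'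
  have key3 : ∀ r, (∀ i < r, IsLeast (D.splitLevels (D.red f) (D.red c)
        (D.chainIdeal (D.red f) (D.red c) (IsLocalRing.maximalIdeal B) h i)) (h i)) →
      (IsLeast {m : ℕ | 1 ≤ m ∧ IsSplitMono (Phi 2 (A ⧸ Ideal.span {f}) r
        fun i => if i < r then h i else m)} (h r) ↔
      IsLeast (D.splitLevels (D.red f) (D.red c)
        (D.chainIdeal (D.red f) (D.red c) (IsLocalRing.maximalIdeal B) h r)) (h r)) := by
    intro r hr
    apply key2
    intro m
    constructor
    · rintro ⟨hm, hs⟩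
      obtain ⟨m', h1, h2, h3⟩ := (key r hr m hm).1 hs
      exact ⟨m', h2, h1, h3⟩
    · rintro ⟨m', h2, h1, h3⟩
      exact ⟨h1.trans h2, (key r hr m (h1.trans h2)).2 ⟨m', h1, h2, h3⟩⟩
  constructor
  · intro hh r
    induction r using Nat.strong_induction_on with
    | _ r ih => exact (key3 r ih).1 (hh r)
  · intro hh r
    exact (key3 r fun i _ => hh i).2 (hh r)

end CartierSetting

/-! ### Coordinates and the distinguished equations -/

/-- Three coordinates of `B` whose squarefree monomials are a basis of `B` over its squares, with
the usual values of the trace. -/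
structure Coords {A B : Type u} [CommRing A] [CommRing B] (D : CartierSetting A B) where
  x : B
  y : B
  z : B
  u_monomial : ∀ a b c, D.u (x ^ a * y ^ b * z ^ c) =
    if a % 2 = 1 ∧ b % 2 = 1 ∧ c % 2 = 1 then x ^ (a / 2) * y ^ (b / 2) * z ^ (c / 2) else 0
  decomp : ∀ g, g = D.u (x * y * z * g) ^ 2 + x * D.u (y * z * g) ^ 2 + y * D.u (x * z * g) ^ 2 +
    z * D.u (x * y * g) ^ 2 + x * y * D.u (z * g) ^ 2 + x * z * D.u (y * g) ^ 2 +
    y * z * D.u (x * g) ^ 2 + x * y * z * D.u g ^ 2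
  exists_order : ∀ g, ∃ a b, g = x * a + z * b ∨ ∃ e w, IsUnit w ∧ g = x * a + z * b + y ^ e * w

namespace CartierSetting

variable {A B : Type u} [CommRing A] [CommRing B] (D : CartierSetting A B)

include D in
theorem two_eq_zero : (2 : B) = 0 := by
  rw [← map_ofNat D.red 2]
  exact (D.red_eq_zero_iff 2).2 dvd_rfl

variable {D} in
theorem u_mul_mem {P : Ideal B} {h : ℕ} {g : B} (hg : g ∈ D.frobIdeal^[h + 1] P) (a : B) :
    D.u (a * g) ∈ D.frobIdeal^[h] P := by
  rw [Function.iterate_succ_apply'] at hg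
  exact hg a

variable {D} in
theorem sq_mem {P : Ideal B} {h : ℕ} {g : B} (hg : g ∈ D.frobIdeal^[h] P) :
    g ^ 2 ∈ D.frobIdeal^[h + 1] P := by
  rw [Function.iterate_succ_apply']
  intro a
  rw [mul_comm, D.u_sq_mul]
  exact Ideal.mul_mem_right _ _ hg

variable {D} in
theorem pow_mem {P : Ideal B} (h : ℕ) {g : B} (hg : g ∈ P) :
    g ^ 2 ^ h ∈ D.frobIdeal^[h] P := by
  induction h with
  | zero => simpa using hg
  | succ h ih =>
    rw [pow_succ, pow_mul]
    exact sq_mem ih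

end CartierSetting

namespace Coords

variable {A B : Type u} [CommRing A] [CommRing B] {D : CartierSetting A B} (K : Coords D)

/-- The part of `g` of odd degree in `x` and in `z`, divided by `x z`. -/
def v (g : B) : B := D.u (K.y * g) ^ 2 + K.y * D.u g ^ 2

theorem v_add (g h : B) : K.v (g + h) = K.v g + K.v h := by
  simp only [v, mul_add, map_add]
  linear_combination (D.u (K.y * g) * D.u (K.y * h) + K.y * D.u g * D.u h) * D.two_eq_zero

theorem v_sq_mul (a g : B) : K.v (a ^ 2 * g) = a ^ 2 * K.v g := by
  simp only [v]
  rw [mul_left_comm, D.u_sq_mul, D.u_sq_mul]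
  ring

theorem v_y_mul (g : B) : K.v (K.y * g) = K.y * K.v g := by
  simp only [v]
  rw [← mul_assoc, ← pow_two, D.u_sq_mul]
  ring

theorem v_y_pow_mul (b : ℕ) (g : B) : K.v (K.y ^ b * g) = K.y ^ b * K.v g := by
  induction b with
  | zero => simp
  | succ b ih => rw [pow_succ', mul_assoc, v_y_mul, ih, mul_assoc]

theorem v_monomial (a b c : ℕ) : K.v (K.x ^ a * K.y ^ b * K.z ^ c) =
    if a % 2 = 1 ∧ c % 2 = 1 then (K.x ^ (a / 2)) ^ 2 * K.y ^ b * (K.z ^ (c / 2)) ^ 2 else 0 := by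
  have h0 : D.u (K.y * (K.x ^ a * K.y ^ 0 * K.z ^ c)) = _ :=
    (congrArg D.u (by ring)).trans (K.u_monomial a 1 c)
  have h1 := K.u_monomial a 0 c
  have h2 : K.v (K.x ^ a * K.y ^ 0 * K.z ^ c) =
      if a % 2 = 1 ∧ c % 2 = 1 then (K.x ^ (a / 2)) ^ 2 * (K.z ^ (c / 2)) ^ 2 else 0 := by
    rw [v, h0, h1]
    by_cases h : a % 2 = 1 ∧ c % 2 = 1
    · simp [h, mul_pow]
    · have h' : ¬ (a % 2 = 1 ∧ 1 % 2 = 1 ∧ c % 2 = 1) := fun h'' => h ⟨h''.1, h''.2.2⟩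
      simp [h]
  rw [show K.x ^ a * K.y ^ b * K.z ^ c = K.y ^ b * (K.x ^ a * K.y ^ 0 * K.z ^ c) by ring,
    v_y_pow_mul, h2]
  split_ifs
  · ring
  · ring

theorem v_mem {P : Ideal B} {h : ℕ} {g : B} (hg : g ∈ D.frobIdeal^[h + 1] P) :
    K.v g ∈ D.frobIdeal^[h + 1] P := by
  refine Ideal.add_mem _ (CartierSetting.sq_mem (CartierSetting.u_mul_mem hg _))
    (Ideal.mul_mem_left _ _ (CartierSetting.sq_mem ?_))
  simpa using CartierSetting.u_mul_mem hg 1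

/-- If `x g` and `z g` lie in a Frobenius power, then `g` agrees with `x z v(g)` modulo it. -/
theorem sub_v_mem {P : Ideal B} {h : ℕ} {g : B} (hx : K.x * g ∈ D.frobIdeal^[h + 1] P)
    (hz : K.z * g ∈ D.frobIdeal^[h + 1] P) :
    g - K.x * K.z * K.v g ∈ D.frobIdeal^[h + 1] P := by
  have hx' : ∀ a, D.u (K.x * a * g) ^ 2 ∈ D.frobIdeal^[h + 1] P := fun a =>
    CartierSetting.sq_mem (by
      rw [mul_comm K.x, mul_assoc]
      exact CartierSetting.u_mul_mem hx a)
  have hz' : ∀ a, D.u (a * K.z * g) ^ 2 ∈ D.frobIdeal^[h + 1] P := fun a =>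
    CartierSetting.sq_mem (by
      rw [mul_assoc]
      exact CartierSetting.u_mul_mem hz a)
  have h1 : g - K.x * K.z * K.v g = D.u (K.x * K.y * K.z * g) ^ 2 + K.x * D.u (K.y * K.z * g) ^ 2 +
      K.y * D.u (K.x * K.z * g) ^ 2 + K.z * D.u (K.x * K.y * g) ^ 2 +
      K.x * K.y * D.u (1 * K.z * g) ^ 2 + K.y * K.z * D.u (K.x * 1 * g) ^ 2 := by
    have := K.decomp g
    rw [one_mul, mul_one, v]
    linear_combination this
  rw [h1]
  exact Ideal.add_mem _ (Ideal.add_mem _ (Ideal.add_mem _ (Ideal.add_mem _ (Ideal.add_mem _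
    (hz' _) (Ideal.mul_mem_left _ _ (hz' _))) (Ideal.mul_mem_left _ _ (hx' _)))
    (Ideal.mul_mem_left _ _ (hx' _))) (Ideal.mul_mem_left _ _ (hz' _)))
    (Ideal.mul_mem_left _ _ (hx' _))

/-- The ideal `P` equals `(x, z, y ^ m)`, expressed through membership. -/
structure IsXZ (P : Ideal B) (m : ℕ) : Prop where
  x_mem : K.x ∈ P
  z_mem : K.z ∈ P
  y_mem_iff : ∀ b, K.y ^ b ∈ P ↔ m ≤ b

variable {K} in
theorem IsXZ.eq {P P' : Ideal B} {m : ℕ} (h : K.IsXZ P m) (h' : K.IsXZ P' m) : P = P' := by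
  have key : ∀ {P P' : Ideal B}, K.IsXZ P m → K.IsXZ P' m → P ≤ P' := by
    intro P P' h h' g hg
    obtain ⟨a, b, rfl | ⟨e, w, hw, rfl⟩⟩ := K.exists_order g
    · exact P'.add_mem (P'.mul_mem_right _ h'.x_mem) (P'.mul_mem_right _ h'.z_mem)
    · have h1 : K.x * a + K.z * b ∈ P :=
        P.add_mem (P.mul_mem_right _ h.x_mem) (P.mul_mem_right _ h.z_mem)
      have h2 := (P.add_mem_iff_right h1).1 hg
      rw [Ideal.mul_unit_mem_iff_mem P hw, h.y_mem_iff, ← h'.y_mem_iff] at h2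
      exact P'.add_mem (P'.add_mem (P'.mul_mem_right _ h'.x_mem) (P'.mul_mem_right _ h'.z_mem))
        (P'.mul_mem_right _ h2)
  exact le_antisymm (key h h') (key h' h)

/-- The shape of the equations under consideration, reduced modulo two: the element `c` is the
second elementary symmetric function of the four terms plus `G ^ 2`. The third term `m` of `f` is
`x y ^ n` or `y ^ n z`; for `n = 0` it is not divisible by `y`, but then `f` does not lie in the
Frobenius power of any proper ideal, as `dvd_or` expresses. -/
structure XZForm (f c : B) where
  N : ℕ
  G : B
  m : B
  N_pos : 1 ≤ N
  f_eq : f = K.z ^ 2 + K.x ^ 2 * K.y + m + K.x * K.y ^ N * K.z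
  c_eq : c = K.z ^ 2 * (K.x ^ 2 * K.y) + K.z ^ 2 * m + K.z ^ 2 * (K.x * K.y ^ N * K.z) +
    K.x ^ 2 * K.y * m + K.x ^ 2 * K.y * (K.x * K.y ^ N * K.z) + m * (K.x * K.y ^ N * K.z) + G ^ 2
  v_m : K.v m = 0
  v_m_mul : K.v (m * (K.x * K.y ^ N * K.z)) = 0
  u_xyz_m : D.u (K.x * K.y * K.z * m) = 0
  u_xz_m : D.u (K.x * K.z * m) = 0
  dvd_or : K.y ∣ m ∨ ∃ w, D.u (w * f) = 1
  isUnit_u : IsUnit (D.u (K.y * G))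

variable {K} {f c : B} (X : K.XZForm f c)

namespace XZForm

include X

theorem u_xyz_f : D.u (K.x * K.y * K.z * f) = K.z := by
  have h1 : D.u (K.x * K.y * K.z * K.z ^ 2) = K.z := by
    rw [show K.x * K.y * K.z * K.z ^ 2 = K.x ^ 1 * K.y ^ 1 * K.z ^ 3 by ring, K.u_monomial]
    simp
  have h2 : D.u (K.x * K.y * K.z * (K.x ^ 2 * K.y)) = 0 := by
    rw [show K.x * K.y * K.z * (K.x ^ 2 * K.y) = K.x ^ 3 * K.y ^ 2 * K.z ^ 1 by ring, K.u_monomial]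
    simp
  have h3 : D.u (K.x * K.y * K.z * (K.x * K.y ^ X.N * K.z)) = 0 := by
    rw [show K.x * K.y * K.z * (K.x * K.y ^ X.N * K.z) =
      K.x ^ 2 * K.y ^ (X.N + 1) * K.z ^ 2 by ring, K.u_monomial]
    simp
  rw [X.f_eq]
  simp only [mul_add, map_add, h1, h2, h3, X.u_xyz_m, add_zero]

theorem u_xz_f : D.u (K.x * K.z * f) = K.x := by
  have h1 : D.u (K.x * K.z * K.z ^ 2) = 0 := by
    rw [show K.x * K.z * K.z ^ 2 = K.x ^ 1 * K.y ^ 0 * K.z ^ 3 by ring, K.u_monomial]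
    simp
  have h2 : D.u (K.x * K.z * (K.x ^ 2 * K.y)) = K.x := by
    rw [show K.x * K.z * (K.x ^ 2 * K.y) = K.x ^ 3 * K.y ^ 1 * K.z ^ 1 by ring, K.u_monomial]
    simp
  have h3 : D.u (K.x * K.z * (K.x * K.y ^ X.N * K.z)) = 0 := by
    rw [show K.x * K.z * (K.x * K.y ^ X.N * K.z) = K.x ^ 2 * K.y ^ X.N * K.z ^ 2 by ring,
      K.u_monomial]
    simp
  rw [X.f_eq]
  simp only [mul_add, map_add, h1, h2, h3, X.u_xz_m, add_zero, zero_add]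

/-- If `f ∈ P^{[2]}` or just `z f ∈ P^{[2]}`, then `x, z ∈ P`. -/
theorem x_mem_z_mem {P : Ideal B} (h : K.z * f ∈ D.frobIdeal P) : K.x ∈ P ∧ K.z ∈ P := by
  constructor
  · have := h K.x
    rwa [← mul_assoc, X.u_xz_f] at this
  · have := h (K.x * K.y)
    rwa [← mul_assoc, X.u_xyz_f] at this

theorem v_f : K.v f = K.y ^ X.N := by
  have h1 := K.v_monomial 0 0 2
  have h2 := K.v_monomial 2 1 0
  have h3 := K.v_monomial 1 X.N 1
  simp at h1 h2 h3
  refine (congrArg K.v X.f_eq).trans ?_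
  simp only [K.v_add, h1, h2, h3, X.v_m, add_zero, zero_add]

/-- The part of `f c` of odd degree in `x` and `z`. -/
theorem v_f_mul_c : K.v (f * c) = K.y ^ X.N *
    ((X.G + K.z ^ 2 + K.x ^ 2 * K.y + X.m) ^ 2 + K.y * (K.x * K.z) ^ 2) := by
  obtain ⟨q, hq⟩ : ∃ q, q = K.x * K.y ^ X.N * K.z := ⟨_, rfl⟩
  have h3 : K.v q = K.y ^ X.N := by
    have h3 := K.v_monomial 1 X.N 1
    simpa [hq] using h3
  have hz : ∀ g, K.v (K.z ^ 2 * g) = K.z ^ 2 * K.v g := K.v_sq_mul K.z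
  have hx : ∀ g, K.v (K.x ^ 2 * K.y * g) = K.x ^ 2 * K.y * K.v g := fun g => by
    rw [mul_assoc, K.v_sq_mul, K.v_y_mul, mul_assoc]
  have hmq : K.v (X.m * q) = 0 := hq ▸ X.v_m_mul
  have hxx : K.v (K.x ^ 2 * K.y) = 0 := by simpa using K.v_monomial 2 1 0
  have hzz : K.v (K.z ^ 2) = 0 := by simpa using K.v_monomial 0 0 2
  have key : f * c = X.G ^ 2 * f +
      ((K.z ^ 2) ^ 2 * (K.x ^ 2 * K.y + X.m + q) + (K.x ^ 2 * K.y) ^ 2 * (K.z ^ 2 + X.m + q) +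
      X.m ^ 2 * (K.z ^ 2 + K.x ^ 2 * K.y + q) + q ^ 2 * (K.z ^ 2 + K.x ^ 2 * K.y + X.m)) +
      (K.z ^ 2 * (K.x ^ 2 * K.y * X.m) + K.z ^ 2 * (K.x ^ 2 * K.y * q) + K.z ^ 2 * (X.m * q) +
        K.x ^ 2 * K.y * (X.m * q)) := by
    have hf := X.f_eq
    have hc := X.c_eq
    rw [← hq] at hf hc
    linear_combination (c - X.G ^ 2) * hf + (K.z ^ 2 + K.x ^ 2 * K.y + X.m + q) * hc +
      (K.z ^ 2 * (K.x ^ 2 * K.y * X.m) + K.z ^ 2 * (K.x ^ 2 * K.y * q) +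
      K.z ^ 2 * (X.m * q) + K.x ^ 2 * K.y * (X.m * q)) * D.two_eq_zero
  rw [key]
  have hg : ∀ a b, K.v (a ^ 2 * b) = a ^ 2 * K.v b := K.v_sq_mul
  have e1 : K.v (K.x ^ 2 * K.y + X.m + q) = K.y ^ X.N := by
    rw [K.v_add, K.v_add, hxx, X.v_m, h3, zero_add, zero_add]
  have e2 : K.v (K.z ^ 2 + X.m + q) = K.y ^ X.N := by
    rw [K.v_add, K.v_add, hzz, X.v_m, h3, zero_add, zero_add]
  have e3 : K.v (K.z ^ 2 + K.x ^ 2 * K.y + q) = K.y ^ X.N := by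
    rw [K.v_add, K.v_add, hzz, hxx, h3, zero_add, zero_add]
  have e4 : K.v (K.z ^ 2 + K.x ^ 2 * K.y + X.m) = 0 := by
    rw [K.v_add, K.v_add, hzz, hxx, X.v_m, zero_add, zero_add]
  rw [K.v_add, K.v_add, K.v_add, K.v_add, K.v_add, K.v_add, K.v_add, K.v_add, hz, hz, hz, hx, hx,
    hx, hmq, hg, hg, hg, hg, hg, X.v_f, e1, e2, e3, e4, h3, X.v_m]
  linear_combination (-K.y ^ X.N * (X.G * K.z ^ 2 + X.G * (K.x ^ 2 * K.y) + X.G * X.m +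
    K.z ^ 2 * (K.x ^ 2 * K.y) + K.z ^ 2 * X.m + K.x ^ 2 * K.y * X.m)) * D.two_eq_zero

theorem testElt_succ_succ (h : ℕ) :
    CartierSetting.testElt f c (h + 2) = (c ^ (2 ^ h - 1)) ^ 2 * (f * c) := by
  have h1 : 2 ^ (h + 1) - 1 = (2 ^ h - 1) * 2 + 1 := by
    have := Nat.one_le_two_pow (n := h)
    rw [pow_succ]
    omega
  rw [CartierSetting.testElt, show h + 2 - 1 = h + 1 from rfl, h1, pow_succ, pow_mul]
  ring

theorem dvd_v_testElt (h : ℕ) : K.y ^ X.N ∣ K.v (CartierSetting.testElt f c (h + 1)) := by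
  rcases h with _ | h
  · simp [CartierSetting.testElt, X.v_f]
  · rw [X.testElt_succ_succ, K.v_sq_mul, X.v_f_mul_c]
    exact Dvd.dvd.mul_left (dvd_mul_right _ _) _

/-- Membership of `y ^ b f c ^ (2 ^ h - 1)` in the Frobenius power of an ideal containing
`y ^ m`. -/
theorem y_pow_mul_testElt_mem {P : Ideal B} {m h b : ℕ} (hm : K.y ^ m ∈ P)
    (hx : K.x * CartierSetting.testElt f c (h + 1) ∈ D.frobIdeal^[h + 1] P)
    (hz : K.z * CartierSetting.testElt f c (h + 1) ∈ D.frobIdeal^[h + 1] P)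
    (hb : 2 ^ (h + 1) * m ≤ b + X.N) :
    K.y ^ b * CartierSetting.testElt f c (h + 1) ∈ D.frobIdeal^[h + 1] P := by
  have h1 := K.sub_v_mem hx hz
  obtain ⟨t, ht⟩ := X.dvd_v_testElt h
  have h2 : K.y ^ (b + X.N) ∈ D.frobIdeal^[h + 1] P := by
    obtain ⟨d, hd⟩ := Nat.exists_eq_add_of_le hb
    rw [hd, pow_add, mul_comm (2 ^ (h + 1)), pow_mul]
    exact Ideal.mul_mem_right _ _ (CartierSetting.pow_mem (h + 1) hm)
  have h3 : K.y ^ b * CartierSetting.testElt f c (h + 1) =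
      K.y ^ b * (CartierSetting.testElt f c (h + 1) -
        K.x * K.z * K.v (CartierSetting.testElt f c (h + 1))) +
      K.y ^ (b + X.N) * (K.x * K.z * t) := by
    rw [ht]
    ring
  rw [h3]
  exact Ideal.add_mem _ (Ideal.mul_mem_left _ _ h1) (Ideal.mul_mem_right _ _ h2)

theorem two_pow_mul_sub_one {h m : ℕ} (hm : 1 ≤ m) :
    2 ^ (h + 1) * m - 1 = 1 + 2 * (2 ^ h * m - 1) := by
  have : 1 ≤ 2 ^ h * m := Nat.mul_pos (Nat.two_pow_pos h) hm
  rw [pow_succ', mul_assoc]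
  omega

/-- For `G = x z` the element is the monomial `y ^ (2 ^ h m - 1) (x z) ^ (2 ^ h - 1)`, whose
`h`-fold trace is `y ^ (m - 1)`. In general `u (y G)` is a unit in place of `1`. -/
theorem not_mem_of_pow_G {P : Ideal B} {m : ℕ} (hm : 1 ≤ m) (hP : K.y ^ (m - 1) ∉ P) (h : ℕ) :
    K.y ^ (2 ^ h * m - 1) * X.G ^ (2 ^ h - 1) ∉ D.frobIdeal^[h] P := by
  induction h with
  | zero => simpa using hP
  | succ h ih =>
    intro hmem
    apply ih
    have h1 : 2 ^ (h + 1) - 1 = 1 + 2 * (2 ^ h - 1) := by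
      simpa using two_pow_mul_sub_one X (h := h) (m := 1) le_rfl
    have h2 := CartierSetting.u_mul_mem hmem 1
    rw [h1, two_pow_mul_sub_one X hm, show 1 * (K.y ^ (1 + 2 * (2 ^ h * m - 1)) *
      X.G ^ (1 + 2 * (2 ^ h - 1))) =
        (K.y ^ (2 ^ h * m - 1) * X.G ^ (2 ^ h - 1)) ^ 2 * (K.y * X.G) by ring, D.u_sq_mul] at h2
    exact (Ideal.mul_unit_mem_iff_mem _ X.isUnit_u).1 h2

/-- Nonmembership of `y ^ b f c ^ (2 ^ h - 1)` in the Frobenius power of `(x, z, y ^ m)`. -/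
theorem y_pow_mul_testElt_notMem {P : Ideal B} {m h b : ℕ} (hm : 1 ≤ m) (hP : K.y ^ (m - 1) ∉ P)
    (hP' : K.y ^ m ∈ P) (hy : K.y ∣ X.m ∨ h = 0) (hb : b + X.N < 2 ^ (h + 1) * m) :
    K.y ^ b * CartierSetting.testElt f c (h + 1) ∉ D.frobIdeal^[h + 1] P := by
  intro hmem
  have h1 := K.v_mem hmem
  rw [K.v_y_pow_mul] at h1
  obtain ⟨d, hd⟩ := Nat.exists_eq_add_of_lt hb
  have hd' : 2 ^ (h + 1) * m - 1 = d + b + X.N := by omega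
  rcases h with _ | h
  · -- Only the term `x y ^ N z` of `f` matters.
    refine X.not_mem_of_pow_G hm hP 1 ?_
    have h2 := Ideal.mul_mem_left _ (K.y ^ d * X.G) h1
    rw [hd']
    simp only [CartierSetting.testElt, Nat.sub_self, pow_zero, pow_one, mul_one,
      zero_add, X.v_f, Nat.add_one_sub_one] at h2 ⊢
    convert h2 using 1
    ring
  · have hy : K.y ∣ X.m := hy.resolve_right (Nat.succ_ne_zero h)
    rw [X.testElt_succ_succ, K.v_sq_mul, X.v_f_mul_c] at h1
    have hq : ∀ i, K.y ^ (2 ^ i * m) ∈ D.frobIdeal^[i] P := fun i => by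
      rw [mul_comm, pow_mul]
      exact CartierSetting.pow_mem i hP'
    have hq1 : ∀ i, K.y ^ (2 ^ i * m) = K.y ^ (2 ^ i * m - 1) * K.y := fun i => by
      rw [← pow_succ, Nat.sub_add_cancel (Nat.mul_pos (Nat.two_pow_pos i) hm)]
    -- Removing the terms divisible by `y ^ (2 ^ (h + 2) m)` leaves `y` times a square.
    have h2 : K.y * (K.y ^ (2 ^ (h + 1) * m - 1) * c ^ (2 ^ h - 1) *
        (X.G + K.z ^ 2 + K.x ^ 2 * K.y + X.m)) ^ 2 ∈ D.frobIdeal^[h + 2] P := by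
      have h3 := Ideal.sub_mem _ (Ideal.mul_mem_left _ (K.y ^ d) h1)
        (Ideal.mul_mem_right ((c ^ (2 ^ h - 1)) ^ 2 * (K.x * K.z) ^ 2) _ (hq (h + 2)))
      rw [hq1, hd'] at h3
      have h4 := two_pow_mul_sub_one X (h := h + 1) hm
      rw [hd'] at h4
      convert h3 using 1
      rw [show K.y * (K.y ^ (2 ^ (h + 1) * m - 1) * c ^ (2 ^ h - 1) *
        (X.G + K.z ^ 2 + K.x ^ 2 * K.y + X.m)) ^ 2 = K.y ^ (1 + 2 * (2 ^ (h + 1) * m - 1)) *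
        (c ^ (2 ^ h - 1) * (X.G + K.z ^ 2 + K.x ^ 2 * K.y + X.m)) ^ 2 by ring, ← h4]
      ring
    have h5 : K.y ^ (2 ^ (h + 1) * m - 1) * c ^ (2 ^ h - 1) *
        (X.G + K.z ^ 2 + K.x ^ 2 * K.y + X.m) ∈ D.frobIdeal^[h + 1] P := by
      have h6 := CartierSetting.u_mul_mem h2 (K.x * K.z)
      have h7 : D.u (K.x * K.y * K.z) = 1 := by simpa using K.u_monomial 1 1 1
      rwa [← mul_assoc, mul_comm (K.x * K.z * K.y), D.u_sq_mul,
        show K.x * K.z * K.y = K.x * K.y * K.z by ring, h7, mul_one] at h6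
    -- Modulo `y` the element `c` is the square of `G`.
    have hc : K.y ∣ c ^ (2 ^ h - 1) * (X.G + K.z ^ 2 + K.x ^ 2 * K.y + X.m) -
        (X.G ^ 2) ^ (2 ^ h - 1) * (X.G + K.z ^ 2) := by
      have hyN : K.y ∣ K.y ^ X.N := dvd_pow_self _ (by have := X.N_pos; omega)
      have hq : K.y ∣ K.x * K.y ^ X.N * K.z := Dvd.dvd.mul_right (Dvd.dvd.mul_left hyN _) _
      have h8 : K.y ∣ c - X.G ^ 2 := by
        rw [sub_eq_of_eq_add X.c_eq]
        exact dvd_add (dvd_add (dvd_add (dvd_add (dvd_add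
          (Dvd.dvd.mul_left (dvd_mul_left _ _) _) (Dvd.dvd.mul_left hy _))
          (Dvd.dvd.mul_left hq _)) (Dvd.dvd.mul_left hy _)) (Dvd.dvd.mul_left hq _))
          (Dvd.dvd.mul_left hq _)
      have h9 : K.y ∣ K.x ^ 2 * K.y + X.m := dvd_add (dvd_mul_left _ _) hy
      have h10 := (h8.trans (sub_dvd_pow_sub_pow c (X.G ^ 2) (2 ^ h - 1))).mul_right
        (X.G + K.z ^ 2 + K.x ^ 2 * K.y + X.m)
      have h11 := h9.mul_left ((X.G ^ 2) ^ (2 ^ h - 1))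
      convert dvd_add h10 h11 using 1
      ring
    obtain ⟨t, ht⟩ := hc
    have h12 : K.y ^ (2 ^ (h + 1) * m - 1) * ((X.G ^ 2) ^ (2 ^ h - 1) * (X.G + K.z ^ 2)) ∈
        D.frobIdeal^[h + 1] P := by
      have h13 := Ideal.sub_mem _ h5 (Ideal.mul_mem_right t _ (hq (h + 1)))
      rw [hq1] at h13
      convert h13 using 1
      linear_combination (-K.y ^ (2 ^ (h + 1) * m - 1)) * ht
    refine X.not_mem_of_pow_G hm hP h ?_
    have h14 := CartierSetting.u_mul_mem h12 1
    have h15 : D.u (K.y * K.z ^ 2) = 0 := by simpa using K.u_monomial 0 1 2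
    rw [two_pow_mul_sub_one X hm, show 1 * (K.y ^ (1 + 2 * (2 ^ h * m - 1)) *
      ((X.G ^ 2) ^ (2 ^ h - 1) * (X.G + K.z ^ 2))) = (K.y ^ (2 ^ h * m - 1) *
        X.G ^ (2 ^ h - 1)) ^ 2 * (K.y * X.G + K.y * K.z ^ 2) by ring, D.u_sq_mul, map_add, h15,
      add_zero] at h14
    exact (Ideal.mul_unit_mem_iff_mem _ X.isUnit_u).1 h14

end XZForm

end Coords

/-! ### The recursion for the ideals `(x, z, y ^ M)` -/

/-- The recursion of the numbers `e_i` and `M_i = 1 + α_i`, in natural numbers. -/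
structure IsXZSeq (N : ℕ) (M E : ℕ → ℕ) : Prop where
  zero : M 0 = 1
  one_le : ∀ i, 1 ≤ M i
  le : ∀ i, M i ≤ N
  lt : ∀ i, N < 2 ^ E i * M i
  le_of_lt : ∀ i, ∀ e < E i, 2 ^ e * M i ≤ N
  succ : ∀ i, M (i + 1) = 2 ^ E i * M i - N

theorem IsXZSeq.one_le_exp {N : ℕ} {M E : ℕ → ℕ} (S : IsXZSeq N M E) (i : ℕ) : 1 ≤ E i := by
  by_contra h
  have h1 := S.lt i
  have h2 := S.le i
  rw [show E i = 0 by omega, pow_zero, one_mul] at h1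
  omega

namespace Coords

variable {A B : Type u} [CommRing A] [CommRing B] {D : CartierSetting A B} {K : Coords D}

namespace XZForm

open CartierSetting

variable {f c : B} (X : K.XZForm f c) {P : Ideal B}

include X

theorem x_mem_z_mem_of_one_notMem (h : 1 ∉ D.splitLevels f c P) : K.x ∈ P ∧ K.z ∈ P := by
  refine X.x_mem_z_mem (Ideal.mul_mem_left _ _ ?_)
  simpa [splitLevels, testElt] using h

theorem one_mem_splitLevels (h : ¬ (K.x ∈ P ∧ K.z ∈ P)) : 1 ∈ D.splitLevels f c P := by
  by_contra h1
  exact h (X.x_mem_z_mem_of_one_notMem h1)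

theorem x_mem_z_mem_of_nextIdeal {h : ℕ} (hh : IsLeast (D.splitLevels f c P) h)
    (hx : K.z ∈ D.nextIdeal f c P h) : K.x ∈ P ∧ K.z ∈ P := by
  by_cases h1 : 1 ∈ D.splitLevels f c P
  · obtain rfl : h = 1 := le_antisymm (hh.2 h1) hh.1.1
    refine X.x_mem_z_mem ?_
    rw [mem_nextIdeal] at hx
    simpa [testElt, mul_comm] using hx
  · exact X.x_mem_z_mem_of_one_notMem h1

theorem dvd_or_one_mem (hP : (1 : B) ∉ P) : K.y ∣ X.m ∨ 1 ∈ D.splitLevels f c P := by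
  refine X.dvd_or.imp_right ?_
  rintro ⟨w, hw⟩
  refine ⟨le_rfl, fun h => hP ?_⟩
  rw [← hw]
  simpa [testElt] using h w

variable {M e : ℕ} (hP : K.IsXZ P M) (hM : 1 ≤ M) (he : 1 ≤ e) (hlt : X.N < 2 ^ e * M)

include hP hM he hlt

/-- The upper bound for the entry of the multi-height belonging to `(x, z, y ^ M)`. -/
theorem exists_mem_splitLevels : ∃ m ≤ e, m ∈ D.splitLevels f c P := by
  have hpred : K.y ^ (M - 1) ∉ P := by
    rw [hP.y_mem_iff]
    omega
  have hone : (1 : B) ∉ P := fun h => hpred (by simpa using P.mul_mem_left (K.y ^ (M - 1)) h)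
  rcases X.dvd_or_one_mem hone with hy | h1
  · obtain ⟨j, rfl⟩ : ∃ j, e = j + 1 := ⟨e - 1, by omega⟩
    refine ⟨j + 1, le_rfl, he, ?_⟩
    have := X.y_pow_mul_testElt_notMem (b := 0) hM hpred ((hP.y_mem_iff M).2 le_rfl) (Or.inl hy)
      (by omega : 0 + X.N < 2 ^ (j + 1) * M)
    simpa using this
  · exact ⟨1, he, h1⟩

/-- If the next ideal contains `x` and `z`, then the entry of the multi-height attains its upper
bound, and the next ideal has the same shape. -/
theorem eq_and_isXZ_nextIdeal {h : ℕ} (hle : ∀ e' < e, 2 ^ e' * M ≤ X.N)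
    (hh : IsLeast (D.splitLevels f c P) h) (hx : K.x ∈ D.nextIdeal f c P h)
    (hz : K.z ∈ D.nextIdeal f c P h) :
    h = e ∧ K.IsXZ (D.nextIdeal f c P h) (2 ^ e * M - X.N) := by
  have hpred : K.y ^ (M - 1) ∉ P := by
    rw [hP.y_mem_iff]
    omega
  have hone : (1 : B) ∉ P := fun h => hpred (by simpa using P.mul_mem_left (K.y ^ (M - 1)) h)
  have hyM : K.y ^ M ∈ P := (hP.y_mem_iff M).2 le_rfl
  obtain ⟨j, rfl⟩ : ∃ j, h = j + 1 := ⟨h - 1, by have := hh.1.1; omega⟩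
  have hx' := D.mem_nextIdeal.1 hx
  have hz' := D.mem_nextIdeal.1 hz
  rw [mul_comm] at hx' hz'
  have hmem : ∀ b, 2 ^ (j + 1) * M ≤ b + X.N →
      K.y ^ b * testElt f c (j + 1) ∈ D.frobIdeal^[j + 1] P := fun b hb =>
    X.y_pow_mul_testElt_mem hyM hx' hz' hb
  have hnot : ∀ b, b + X.N < 2 ^ (j + 1) * M →
      K.y ^ b * testElt f c (j + 1) ∉ D.frobIdeal^[j + 1] P := fun b hb =>
    X.y_pow_mul_testElt_notMem hM hpred hyM
      ((X.dvd_or_one_mem hone).imp_right fun h1 => by have := hh.2 h1; omega) hb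
  have heq : j + 1 = e := by
    obtain ⟨m, hme, hm⟩ := X.exists_mem_splitLevels hP hM he hlt
    refine le_antisymm ((hh.2 hm).trans hme) (not_lt.1 fun hlt' => hh.1.2 ?_)
    simpa using hmem 0 (by have := hle _ hlt'; omega)
  subst heq
  refine ⟨rfl, hx, hz, fun b => ?_⟩
  rw [mem_nextIdeal, mul_comm]
  constructor
  · intro hb
    by_contra hcon
    exact hnot b (by omega) hb
  · intro hb
    exact hmem b (by omega)

end XZForm

open CartierSetting

variable {f c : B} (X : K.XZForm f c) {P : Ideal B} (hP : K.IsXZ P 1) {M E : ℕ → ℕ}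
  (S : IsXZSeq X.N M E) {h : ℕ → ℕ}

include X hP S in
/-- As long as the ideal `P_i` contains `x` and `z`, all earlier entries of the multi-height attain
their upper bounds and all earlier ideals are of the form `(x, z, y ^ M)`. -/
theorem isXZ_chainIdeal {i : ℕ}
    (hh : ∀ r < i, IsLeast (D.splitLevels f c (D.chainIdeal f c P h r)) (h r))
    (hx : K.x ∈ D.chainIdeal f c P h i) (hz : K.z ∈ D.chainIdeal f c P h i) :
    (∀ j ≤ i, K.IsXZ (D.chainIdeal f c P h j) (M j)) ∧ ∀ j < i, h j = E j := by
  induction i with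
  | zero =>
    refine ⟨fun j hj => ?_, fun j hj => absurd hj (Nat.not_lt_zero j)⟩
    obtain rfl : j = 0 := by omega
    rw [S.zero]
    exact hP
  | succ i ih =>
    have h1 := hh i (Nat.lt_succ_self i)
    obtain ⟨hx', hz'⟩ := X.x_mem_z_mem_of_nextIdeal h1 hz
    obtain ⟨h2, h3⟩ := ih (fun r hr => hh r (by omega)) hx' hz'
    obtain ⟨h4, h5⟩ := X.eq_and_isXZ_nextIdeal (h2 i le_rfl) (S.one_le i) (S.one_le_exp i) (S.lt i)
      (S.le_of_lt i) h1 hx hz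
    rw [← S.succ] at h5
    refine ⟨fun j hj => ?_, fun j hj => ?_⟩
    · rcases hj.lt_or_eq with hj | rfl
      · exact h2 j (by omega)
      · exact h5
    · rcases (Nat.lt_succ_iff.1 hj).lt_or_eq with hj | rfl
      · exact h3 j hj
      · exact h4

include X hP S in
theorem exists_mem_splitLevels_chainIdeal {i : ℕ}
    (hh : ∀ r < i, IsLeast (D.splitLevels f c (D.chainIdeal f c P h r)) (h r)) :
    ∃ m ≤ E i, m ∈ D.splitLevels f c (D.chainIdeal f c P h i) := by
  by_cases hxz : K.x ∈ D.chainIdeal f c P h i ∧ K.z ∈ D.chainIdeal f c P h i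
  · exact X.exists_mem_splitLevels ((isXZ_chainIdeal X hP S hh hxz.1 hxz.2).1 i le_rfl) (S.one_le i)
      (S.one_le_exp i) (S.lt i)
  · exact ⟨1, S.one_le_exp i, X.one_mem_splitLevels hxz⟩

/-- The ideals `P_i` belonging to the multi-height itself. -/
noncomputable def leastChain (D : CartierSetting A B) (f c : B) (P : Ideal B) : ℕ → Ideal B
  | 0 => P
  | i + 1 =>
    D.nextIdeal f c (leastChain D f c P i) (sInf (D.splitLevels f c (leastChain D f c P i)))

include X hP S in
theorem existsUnique_isLeast :
    ∃! h : ℕ → ℕ, ∀ r, IsLeast (D.splitLevels f c (D.chainIdeal f c P h r)) (h r) := by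
  refine ⟨fun i => sInf (D.splitLevels f c (leastChain D f c P i)), ?_, fun h hh => ?_⟩
  · have h1 : ∀ i, D.chainIdeal f c P
        (fun i => sInf (D.splitLevels f c (leastChain D f c P i))) i = leastChain D f c P i := by
      intro i
      induction i with
      | zero => rfl
      | succ i ih => rw [chainIdeal, ih, leastChain]
    intro r
    induction r using Nat.strong_induction_on with
    | _ r ih =>
      obtain ⟨m, -, hm⟩ := exists_mem_splitLevels_chainIdeal X hP S ih
      rw [h1] at hm ⊢
      exact ⟨Nat.sInf_mem ⟨m, hm⟩, fun _ h => Nat.sInf_le h⟩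
  · have h1 : ∀ i, D.chainIdeal f c P h i = leastChain D f c P i := by
      intro i
      induction i with
      | zero => rfl
      | succ i ih => rw [chainIdeal, ih, leastChain, (hh i).csInf_eq.symm, ih]
    funext i
    rw [← h1]
    exact (hh i).csInf_eq.symm

variable (hh : ∀ r, IsLeast (D.splitLevels f c (D.chainIdeal f c P h r)) (h r))

include X hP S hh

theorem height_le (i : ℕ) : h i ≤ E i := by
  obtain ⟨m, hm, hm'⟩ := exists_mem_splitLevels_chainIdeal X hP S (i := i) fun r _ => hh r
  exact ((hh i).2 hm').trans hm

theorem isXZ_of_two_le {i : ℕ} (hi : 2 ≤ h i) :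
    (∀ j ≤ i, K.IsXZ (D.chainIdeal f c P h j) (M j)) ∧ ∀ j < i, h j = E j := by
  have h1 : 1 ∉ D.splitLevels f c (D.chainIdeal f c P h i) := fun h1 => by
    have := (hh i).2 h1
    omega
  obtain ⟨hx, hz⟩ := X.x_mem_z_mem_of_one_notMem h1
  exact isXZ_chainIdeal X hP S (fun r _ => hh r) hx hz

theorem height_eq_one {j : ℕ} (hj : h j < E j) (i : ℕ) (hi : j < i) : h i = 1 := by
  have h1 := (hh i).1.1
  by_contra h2
  have := (isXZ_of_two_le X hP S hh (i := i) (by omega)).2 j hi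
  omega

/-- If `M_s = M_t` and the ideals `P_s` and `P_t` are of the form `(x, z, y ^ M)`, then they agree
and the multi-height is periodic from there on. -/
theorem height_eq {s t : ℕ} (hst : s < t) (hM : M s = M t) (hex : ∃ j, 2 ≤ h (t + j)) (i : ℕ) :
    h i = E i := by
  obtain ⟨j, hj⟩ := hex
  have h1 := isXZ_of_two_le X hP S hh hj
  have h2 : ∀ i, D.chainIdeal f c P h (s + i) = D.chainIdeal f c P h (t + i) ∧
      h (s + i) = h (t + i) := by
    have h4 : ∀ i, D.chainIdeal f c P h (s + i) = D.chainIdeal f c P h (t + i) →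
        h (s + i) = h (t + i) := fun i hi => by
      have h5 := hh (s + i)
      rw [hi] at h5
      exact h5.unique (hh (t + i))
    intro i
    induction i with
    | zero =>
      have h3 : D.chainIdeal f c P h s = D.chainIdeal f c P h t :=
        (h1.1 s (by omega)).eq (hM ▸ h1.1 t (by omega))
      exact ⟨h3, h4 0 h3⟩
    | succ i ih =>
      have h3 : D.chainIdeal f c P h (s + (i + 1)) = D.chainIdeal f c P h (t + (i + 1)) := by
        rw [← add_assoc, ← add_assoc, chainIdeal, chainIdeal, ih.1, ih.2]
      exact ⟨h3, h4 (i + 1) h3⟩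
  have h3 : ∀ k, 2 ≤ h (t + j + k * (t - s)) := by
    intro k
    induction k with
    | zero => simpa using hj
    | succ k ih =>
      have h4 := (h2 (t - s + j + k * (t - s))).2
      rw [show s + (t - s + j + k * (t - s)) = t + j + k * (t - s) by omega,
        show t + (t - s + j + k * (t - s)) = t + j + (k + 1) * (t - s) by
          rw [Nat.succ_mul]; omega] at h4
      rwa [← h4]
  refine (isXZ_of_two_le X hP S hh (h3 (i + 1))).2 i ?_
  have : i + 1 ≤ (i + 1) * (t - s) := Nat.le_mul_of_pos_right _ (by omega)
  omega

end Coords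

/-! ### The sequences `e` and `α` -/

theorem xzStep_spec {N m : ℕ} (hm : 1 ≤ m) :
    N < 2 ^ xzStep N ((m : ℤ) - 1) * m ∧ ∀ e < xzStep N ((m : ℤ) - 1), 2 ^ e * m ≤ N := by
  have h1 : ∀ e : ℕ, 0 ≤ 2 ^ e * (1 + ((m : ℤ) - 1)) - 1 - N ↔ N < 2 ^ e * m := fun e => by
    rw [add_sub_cancel]
    zify
    omega
  have h2 : {e : ℕ | 0 ≤ 2 ^ e * (1 + ((m : ℤ) - 1)) - 1 - N} = {e | N < 2 ^ e * m} :=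
    Set.ext h1
  rw [xzStep, h2]
  constructor
  · have : N < 2 ^ N * m := Nat.lt_two_pow_self.trans_le (Nat.le_mul_of_pos_right _ hm)
    exact Nat.sInf_mem (⟨N, this⟩ : {e : ℕ | N < 2 ^ e * m}.Nonempty)
  · intro e he
    exact not_lt.1 fun h => absurd (Nat.sInf_le (s := {e | N < 2 ^ e * m}) h) (not_le.2 he)

theorem xzAlpha_bounds {N : ℕ} (hN : 1 ≤ N) (i : ℕ) : 0 ≤ xzAlpha N i ∧ xzAlpha N i < N := by
  induction i with
  | zero => exact ⟨le_rfl, by rw [xzAlpha]; omega⟩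
  | succ i ih =>
    obtain ⟨m, hm⟩ : ∃ m : ℕ, xzAlpha N i = (m : ℤ) - 1 := ⟨(xzAlpha N i + 1).toNat, by omega⟩
    obtain ⟨h1, h2⟩ := xzStep_spec (N := N) (m := m) (by omega)
    rw [xzAlpha, hm]
    set e := xzStep N ((m : ℤ) - 1)
    have he : e ≠ 0 := fun h => by
      rw [h, pow_zero, one_mul] at h1
      omega
    obtain ⟨j, hj⟩ := Nat.exists_eq_succ_of_ne_zero he
    have h3 := h2 j (by omega)
    rw [hj, Nat.pow_succ'] at h1
    rw [hj, pow_succ']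
    zify at h1 h3
    constructor <;> linarith

theorem isXZSeq {N : ℕ} (hN : 1 ≤ N) :
    IsXZSeq N (fun i => (1 + xzAlpha N i).toNat) (xzE N) := by
  have h0 := xzAlpha_bounds hN
  have h1 : ∀ i, xzAlpha N i = ((1 + xzAlpha N i).toNat : ℤ) - 1 := fun i => by
    have := h0 i
    omega
  have h2 : ∀ i, N < 2 ^ xzE N i * (1 + xzAlpha N i).toNat ∧
      ∀ e < xzE N i, 2 ^ e * (1 + xzAlpha N i).toNat ≤ N := fun i => by
    have h3 := h0 i
    have h4 := xzStep_spec (N := N) (m := (1 + xzAlpha N i).toNat) (by omega)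
    rwa [← h1 i] at h4
  refine ⟨by simp [xzAlpha], fun i => ?_, fun i => ?_, fun i => (h2 i).1, fun i => (h2 i).2,
    fun i => ?_⟩
  · have := h0 i
    omega
  · have := h0 i
    omega
  · have h3 := (h2 i).1
    have h4 : xzAlpha N (i + 1) = 2 ^ xzE N i * (1 + xzAlpha N i) - 1 - N := rfl
    have h5 : (1 + xzAlpha N i) = ((1 + xzAlpha N i).toNat : ℤ) := by
      have := h0 i
      omega
    rw [h5] at h4
    zify [h3.le]
    have := h0 (i + 1)
    omega

theorem exists_xzAlpha_periodic {N : ℕ} (hN : 1 ≤ N) :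
    ∃ s t : ℕ, s < t ∧ ∀ i : ℕ, xzAlpha N (s + i) = xzAlpha N (t + i) := by
  obtain ⟨s, t, hst, h⟩ : ∃ s t : ℕ, s < t ∧ xzAlpha N s = xzAlpha N t := by
    have hmaps : Set.MapsTo (xzAlpha N) Set.univ (Set.Ico (0 : ℤ) N) := fun i _ =>
      xzAlpha_bounds hN i
    obtain ⟨s, -, t, -, hne, h⟩ :=
      Set.infinite_univ.exists_ne_map_eq_of_mapsTo hmaps (Set.finite_Ico _ _)
    rcases lt_or_gt_of_ne hne with h' | h'
    · exact ⟨s, t, h', h⟩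
    · exact ⟨t, s, h', h.symm⟩
  refine ⟨s, t, hst, fun i => ?_⟩
  induction i with
  | zero => exact h
  | succ i ih => rw [← add_assoc, ← add_assoc, xzAlpha, xzAlpha, ih]

theorem possibleHeights_finite (e : ℕ → ℕ) (t : ℕ) : (possibleHeights e t).Finite := by
  refine Set.Finite.union ?_ (Set.finite_singleton e)
  refine Set.Finite.subset ((Set.finite_Iic fun i : Fin (t + 1) => e i).image
    fun a i => if h : i < t + 1 then a ⟨i, h⟩ else 1) ?_
  rintro g ⟨h1, h2⟩
  refine ⟨fun i => g i, fun i => (h1 i (by omega)).2, funext fun i => ?_⟩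
  by_cases hi : i < t + 1
  · simp [hi]
  · simp [hi, h2 i (by omega)]

/-! ### The equations over `W(k)[[x, y, z]]` -/

namespace Coords

variable {A B : Type u} [CommRing A] [CommRing B] {D : CartierSetting A B} (K : Coords D)

theorem XZForm.ne_zero [IsDomain B] {f c : B} {K : Coords D} (X : K.XZForm f c) : f ≠ 0 := by
  rintro rfl
  have h1 := X.v_f
  have h2 : K.v 0 = 0 := by simpa using K.v_sq_mul 0 0
  have h3 : K.y = 0 := pow_eq_zero_iff (n := X.N) (by have := X.N_pos; omega) |>.1
    (h1.symm.trans h2)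
  have h4 := K.u_monomial 1 1 1
  simp [h3] at h4

/-- The equation with the term `x y ^ n`. -/
def xzFormLeft (n N : ℕ) (G : B) (hN : 1 ≤ N) (hG : IsUnit (D.u (K.y * G))) {f c : B}
    (hf : f = K.z ^ 2 + K.x ^ 2 * K.y + K.x * K.y ^ n + K.x * K.y ^ N * K.z)
    (hc : c = K.z ^ 2 * (K.x ^ 2 * K.y) + K.z ^ 2 * (K.x * K.y ^ n) +
      K.z ^ 2 * (K.x * K.y ^ N * K.z) + K.x ^ 2 * K.y * (K.x * K.y ^ n) +
      K.x ^ 2 * K.y * (K.x * K.y ^ N * K.z) + K.x * K.y ^ n * (K.x * K.y ^ N * K.z) + G ^ 2) :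
    K.XZForm f c where
  N := N
  G := G
  m := K.x * K.y ^ n
  N_pos := hN
  f_eq := hf
  c_eq := hc
  v_m := by simpa using K.v_monomial 1 n 0
  v_m_mul := by
    rw [show K.x * K.y ^ n * (K.x * K.y ^ N * K.z) = K.x ^ 2 * K.y ^ (n + N) * K.z ^ 1 by ring,
      K.v_monomial]
    simp
  u_xyz_m := by
    rw [show K.x * K.y * K.z * (K.x * K.y ^ n) = K.x ^ 2 * K.y ^ (n + 1) * K.z ^ 1 by ring,
      K.u_monomial]
    simp
  u_xz_m := by
    rw [show K.x * K.z * (K.x * K.y ^ n) = K.x ^ 2 * K.y ^ n * K.z ^ 1 by ring, K.u_monomial]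
    simp
  dvd_or := by
    rcases Nat.eq_zero_or_pos n with rfl | hn
    · right
      refine ⟨K.y * K.z, ?_⟩
      rw [hf, show K.y * K.z * (K.z ^ 2 + K.x ^ 2 * K.y + K.x * K.y ^ 0 + K.x * K.y ^ N * K.z) =
        K.x ^ 0 * K.y ^ 1 * K.z ^ 3 + K.x ^ 2 * K.y ^ 2 * K.z ^ 1 + K.x ^ 1 * K.y ^ 1 * K.z ^ 1 +
        K.x ^ 1 * K.y ^ (N + 1) * K.z ^ 2 by ring]
      simp only [map_add, K.u_monomial]
      simp
    · exact Or.inl (Dvd.dvd.mul_left (dvd_pow_self _ hn.ne') _)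
  isUnit_u := hG

/-- The equation with the term `y ^ n z`. -/
def xzFormRight (n N : ℕ) (G : B) (hN : 1 ≤ N) (hG : IsUnit (D.u (K.y * G))) {f c : B}
    (hf : f = K.z ^ 2 + K.x ^ 2 * K.y + K.y ^ n * K.z + K.x * K.y ^ N * K.z)
    (hc : c = K.z ^ 2 * (K.x ^ 2 * K.y) + K.z ^ 2 * (K.y ^ n * K.z) +
      K.z ^ 2 * (K.x * K.y ^ N * K.z) + K.x ^ 2 * K.y * (K.y ^ n * K.z) +
      K.x ^ 2 * K.y * (K.x * K.y ^ N * K.z) + K.y ^ n * K.z * (K.x * K.y ^ N * K.z) + G ^ 2) :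
    K.XZForm f c where
  N := N
  G := G
  m := K.y ^ n * K.z
  N_pos := hN
  f_eq := hf
  c_eq := hc
  v_m := by simpa using K.v_monomial 0 n 1
  v_m_mul := by
    rw [show K.y ^ n * K.z * (K.x * K.y ^ N * K.z) = K.x ^ 1 * K.y ^ (n + N) * K.z ^ 2 by ring,
      K.v_monomial]
    simp
  u_xyz_m := by
    rw [show K.x * K.y * K.z * (K.y ^ n * K.z) = K.x ^ 1 * K.y ^ (n + 1) * K.z ^ 2 by ring,
      K.u_monomial]
    simp
  u_xz_m := by
    rw [show K.x * K.z * (K.y ^ n * K.z) = K.x ^ 1 * K.y ^ n * K.z ^ 2 by ring, K.u_monomial]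
    simp
  dvd_or := by
    rcases Nat.eq_zero_or_pos n with rfl | hn
    · right
      refine ⟨K.x * K.y, ?_⟩
      rw [hf, show K.x * K.y * (K.z ^ 2 + K.x ^ 2 * K.y + K.y ^ 0 * K.z + K.x * K.y ^ N * K.z) =
        K.x ^ 1 * K.y ^ 1 * K.z ^ 2 + K.x ^ 3 * K.y ^ 2 * K.z ^ 0 + K.x ^ 1 * K.y ^ 1 * K.z ^ 1 +
        K.x ^ 2 * K.y ^ (N + 1) * K.z ^ 1 by ring]
      simp only [map_add, K.u_monomial]
      simp
    · exact Or.inl (Dvd.dvd.mul_right (dvd_pow_self _ hn.ne') _)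
  isUnit_u := hG

end Coords

instance isDomain_mvPowerSeries {σ R : Type*} [CommRing R] [IsDomain R] :
    IsDomain (MvPowerSeries σ R) :=
  NoZeroDivisors.to_isDomain _

section Concrete

variable (k : Type u) [Field k] [CharP k 2] [PerfectRing k 2]

theorem charZero_wittVector : CharZero (WittVector 2 k) := by
  obtain ⟨q, hq⟩ := CharP.exists (WittVector 2 k)
  rcases CharP.char_is_prime_or_zero (WittVector 2 k) q with h | rfl
  · exfalso
    have h1 : ((q : ℕ) : k) = 0 := by
      rw [← map_natCast (WittVector.constantCoeff (p := 2) (R := k)), CharP.cast_eq_zero, map_zero]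
    have h2 : q = 2 := ((Nat.prime_dvd_prime_iff_eq Nat.prime_two h).1
      ((CharP.cast_eq_zero_iff k 2 q).1 h1)).symm
    subst h2
    exact WittVector.p_nonzero 2 k (CharP.cast_eq_zero _ _)
  · exact CharP.charP_to_charZero _

theorem charZero_mvPowerSeries_wittVector {σ : Type*} :
    CharZero (MvPowerSeries σ (WittVector 2 k)) := by
  have := charZero_wittVector k
  exact charZero_of_injective_ringHom (f := MvPowerSeries.C (σ := σ) (R := WittVector 2 k))
    (Function.LeftInverse.injective (g := MvPowerSeries.constantCoeff) fun a => by simp)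

/-- The ring `W(k)[[x, y, z]]` with its Frobenius lift, and its reduction `k[[x, y, z]]`. -/
noncomputable def powerSeriesSetting :
    CartierSetting (MvPowerSeries (Fin 3) (WittVector 2 k)) (MvPowerSeries (Fin 3) k) where
  φ := frobLift 2
  sec := by
    have := charZero_mvPowerSeries_wittVector k (σ := Fin 3)
    exact (exists_wittSection (p := 2)
      (frobLift 2 : MvPowerSeries (Fin 3) (WittVector 2 k) →+* _)
      (frobLift_sub_pow_dvd 2)).some
  red := redPS 2
  red_surjective := redPS_surjective 2
  red_eq_zero_iff := fun a => by exact_mod_cast redPS_eq_zero_iff 2 a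
  red_φ := redPS_frobLift 2
  u := tr
  u_sq_mul := tr_sq_mul
  u_surjective := tr_surjective
  exists_repr := fun ρ hρ κ hκ => exists_eq_tr_mul ρ hρ κ hκ
  sq_dvd := sq_dvd_of_dvd_tr

variable {k}

theorem monomial_sqfreeExp {σ : Type*} [Fintype σ] [DecidableEq σ] (T : Finset σ) :
    MvPowerSeries.monomial (sqfreeExp T) (1 : k) = ∏ i ∈ T, MvPowerSeries.X i := by
  have h : sqfreeExp T = ∑ i ∈ T, Finsupp.single i 1 := by
    ext j
    simp [Finsupp.single_apply, Finsupp.finsetSum_apply]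
  have h1 := MvPowerSeries.prod_monomial (R := k) (s := T) (f := fun i => Finsupp.single i 1)
    (g := fun _ => 1)
  rw [Finset.prod_const_one] at h1
  rw [h, ← h1]
  rfl

theorem monomial_fin_three (a b c : ℕ) :
    (MvPowerSeries.X 0 ^ a * MvPowerSeries.X 1 ^ b * MvPowerSeries.X 2 ^ c :
      MvPowerSeries (Fin 3) k) = MvPowerSeries.monomial
        (Finsupp.single 0 a + Finsupp.single 1 b + Finsupp.single 2 c) 1 := by
  rw [MvPowerSeries.X_pow_eq, MvPowerSeries.X_pow_eq, MvPowerSeries.X_pow_eq,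
    MvPowerSeries.monomial_mul_monomial, MvPowerSeries.monomial_mul_monomial, one_mul, one_mul]

theorem tr_X_pow (a b c : ℕ) :
    tr (MvPowerSeries.X 0 ^ a * MvPowerSeries.X 1 ^ b * MvPowerSeries.X 2 ^ c :
      MvPowerSeries (Fin 3) k) = if a % 2 = 1 ∧ b % 2 = 1 ∧ c % 2 = 1 then
        MvPowerSeries.X 0 ^ (a / 2) * MvPowerSeries.X 1 ^ (b / 2) * MvPowerSeries.X 2 ^ (c / 2)
      else 0 := by
  rw [monomial_fin_three]
  split_ifs with h
  · rw [monomial_fin_three]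
    have h1 : Finsupp.single (0 : Fin 3) a + Finsupp.single 1 b + Finsupp.single 2 c =
        2 • (Finsupp.single (0 : Fin 3) (a / 2) + Finsupp.single 1 (b / 2) +
          Finsupp.single 2 (c / 2)) + sqfreeExp Finset.univ := by
      ext i
      fin_cases i <;> simp <;> omega
    rw [h1, tr_monomial]
  · obtain ⟨i, hi⟩ : ∃ i, 2 ∣ (Finsupp.single (0 : Fin 3) a + Finsupp.single 1 b +
        Finsupp.single 2 c : Fin 3 →₀ ℕ) i := by
      by_contra! hcon
      have h0 := hcon 0
      have h1 := hcon 1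
      have h2 := hcon 2
      simp at h0 h1 h2
      exact h ⟨by omega, by omega, by omega⟩
    exact tr_monomial_of_even _ _ i hi

theorem eq_sum_tr_sq_fin_three (g : MvPowerSeries (Fin 3) k) :
    g = tr (MvPowerSeries.X 0 * MvPowerSeries.X 1 * MvPowerSeries.X 2 * g) ^ 2 +
      MvPowerSeries.X 0 * tr (MvPowerSeries.X 1 * MvPowerSeries.X 2 * g) ^ 2 +
      MvPowerSeries.X 1 * tr (MvPowerSeries.X 0 * MvPowerSeries.X 2 * g) ^ 2 +
      MvPowerSeries.X 2 * tr (MvPowerSeries.X 0 * MvPowerSeries.X 1 * g) ^ 2 +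
      MvPowerSeries.X 0 * MvPowerSeries.X 1 * tr (MvPowerSeries.X 2 * g) ^ 2 +
      MvPowerSeries.X 0 * MvPowerSeries.X 2 * tr (MvPowerSeries.X 1 * g) ^ 2 +
      MvPowerSeries.X 1 * MvPowerSeries.X 2 * tr (MvPowerSeries.X 0 * g) ^ 2 +
      MvPowerSeries.X 0 * MvPowerSeries.X 1 * MvPowerSeries.X 2 * tr g ^ 2 := by
  have h := eq_sum_monomial_mul_tr_sq g
  simp only [monomial_sqfreeExp] at h
  rw [show (Finset.univ : Finset (Finset (Fin 3))) =
    {∅, {0}, {1}, {2}, {0, 1}, {0, 2}, {1, 2}, {0, 1, 2}} by decide,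
    Finset.sum_insert (by decide), Finset.sum_insert (by decide), Finset.sum_insert (by decide),
    Finset.sum_insert (by decide), Finset.sum_insert (by decide), Finset.sum_insert (by decide),
    Finset.sum_insert (by decide), Finset.sum_singleton,
    show (∅ᶜ : Finset (Fin 3)) = {0, 1, 2} by decide,
    show ({0}ᶜ : Finset (Fin 3)) = {1, 2} by decide,
    show ({1}ᶜ : Finset (Fin 3)) = {0, 2} by decide,
    show ({2}ᶜ : Finset (Fin 3)) = {0, 1} by decide,
    show ({0, 1}ᶜ : Finset (Fin 3)) = {2} by decide,
    show ({0, 2}ᶜ : Finset (Fin 3)) = {1} by decide,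
    show ({1, 2}ᶜ : Finset (Fin 3)) = {0} by decide,
    show ({0, 1, 2}ᶜ : Finset (Fin 3)) = ∅ by decide] at h
  have p3 : ∏ i ∈ ({0, 1, 2} : Finset (Fin 3)), (MvPowerSeries.X i : MvPowerSeries (Fin 3) k) =
      MvPowerSeries.X 0 * MvPowerSeries.X 1 * MvPowerSeries.X 2 := by
    rw [Finset.prod_insert (by decide), Finset.prod_pair (by decide), mul_assoc]
  have p01 : ∏ i ∈ ({0, 1} : Finset (Fin 3)), (MvPowerSeries.X i : MvPowerSeries (Fin 3) k) =
      MvPowerSeries.X 0 * MvPowerSeries.X 1 := Finset.prod_pair (by decide)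
  have p02 : ∏ i ∈ ({0, 2} : Finset (Fin 3)), (MvPowerSeries.X i : MvPowerSeries (Fin 3) k) =
      MvPowerSeries.X 0 * MvPowerSeries.X 2 := Finset.prod_pair (by decide)
  have p12 : ∏ i ∈ ({1, 2} : Finset (Fin 3)), (MvPowerSeries.X i : MvPowerSeries (Fin 3) k) =
      MvPowerSeries.X 1 * MvPowerSeries.X 2 := Finset.prod_pair (by decide)
  simp only [p3, p01, p02, p12, Finset.prod_singleton, Finset.prod_empty, one_mul] at h
  refine h.trans ?_
  ring

theorem exists_eq_X_mul_add_X_mul {g : MvPowerSeries (Fin 3) k}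
    (h : ∀ d : Fin 3 →₀ ℕ, d 0 = 0 → d 2 = 0 → MvPowerSeries.coeff d g = 0) :
    ∃ a b, g = MvPowerSeries.X 0 * a + MvPowerSeries.X 2 * b := by
  let g' : MvPowerSeries (Fin 3) k := fun d => if d 0 = 0 then 0 else MvPowerSeries.coeff d g
  have hg' : ∀ d, MvPowerSeries.coeff d g' = if d 0 = 0 then 0 else MvPowerSeries.coeff d g :=
    fun _ => rfl
  obtain ⟨a, ha⟩ : (MvPowerSeries.X 0 : MvPowerSeries (Fin 3) k) ∣ g' :=
    MvPowerSeries.X_dvd_iff.2 fun d hd => by rw [hg', if_pos hd]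
  obtain ⟨b, hb⟩ : (MvPowerSeries.X 2 : MvPowerSeries (Fin 3) k) ∣ g - g' :=
    MvPowerSeries.X_dvd_iff.2 fun d hd => by
      rw [map_sub, hg']
      split_ifs with h0
      · rw [h d h0 hd, sub_zero]
      · exact sub_self _
  exact ⟨a, b, by rw [← ha, ← hb]; ring⟩

theorem exists_order_fin_three (g : MvPowerSeries (Fin 3) k) :
    ∃ a b, g = MvPowerSeries.X 0 * a + MvPowerSeries.X 2 * b ∨ ∃ e w, IsUnit w ∧
      g = MvPowerSeries.X 0 * a + MvPowerSeries.X 2 * b + MvPowerSeries.X 1 ^ e * w := by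
  have hsingle : ∀ d : Fin 3 →₀ ℕ, d 0 = 0 → d 2 = 0 → d = Finsupp.single 1 (d 1) := by
    intro d h0 h2
    ext i
    fin_cases i <;> simp [h0, h2]
  by_cases h : ∃ e, MvPowerSeries.coeff (Finsupp.single 1 e) g ≠ 0
  · classical
    let w : MvPowerSeries (Fin 3) k := fun d =>
      MvPowerSeries.coeff (Finsupp.single 1 (Nat.find h) + d) g
    have hw : ∀ d, MvPowerSeries.coeff d w =
        MvPowerSeries.coeff (Finsupp.single 1 (Nat.find h) + d) g := fun _ => rfl
    have hunit : IsUnit w := by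
      rw [MvPowerSeries.isUnit_iff_constantCoeff, ← MvPowerSeries.coeff_zero_eq_constantCoeff_apply,
        hw, add_zero]
      exact (Nat.find_spec h).isUnit
    obtain ⟨a, b, hab⟩ := exists_eq_X_mul_add_X_mul
        (g := g - MvPowerSeries.X 1 ^ Nat.find h * w) (by
      intro d h0 h2
      rw [hsingle d h0 h2, map_sub, MvPowerSeries.X_pow_eq, MvPowerSeries.coeff_monomial_mul,
        one_mul]
      split_ifs with hle
      · rw [hw, add_tsub_cancel_of_le hle, sub_self]
      · rw [sub_zero]
        by_contra hne
        exact hle (Finsupp.single_mono (Nat.find_min' h hne)))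
    exact ⟨a, b, Or.inr ⟨Nat.find h, w, hunit, by rw [← hab]; ring⟩⟩
  · push Not at h
    obtain ⟨a, b, hab⟩ := exists_eq_X_mul_add_X_mul (g := g) fun d h0 h2 => by
      rw [hsingle d h0 h2, h]
    exact ⟨a, b, Or.inl hab⟩

variable (k) in
/-- The variables as coordinates of `k[[x, y, z]]`. -/
noncomputable def powerSeriesCoords : Coords (powerSeriesSetting k) where
  x := MvPowerSeries.X 0
  y := MvPowerSeries.X 1
  z := MvPowerSeries.X 2
  u_monomial := tr_X_pow
  decomp := eq_sum_tr_sq_fin_three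
  exists_order := exists_order_fin_three

theorem isXZ_maximalIdeal :
    (powerSeriesCoords k).IsXZ (IsLocalRing.maximalIdeal (MvPowerSeries (Fin 3) k)) 1 := by
  have hX : ∀ i, (MvPowerSeries.X i : MvPowerSeries (Fin 3) k) ∈
      IsLocalRing.maximalIdeal (MvPowerSeries (Fin 3) k) := fun i => by
    rw [IsLocalRing.mem_maximalIdeal, mem_nonunits_iff, MvPowerSeries.isUnit_iff_constantCoeff]
    simp
  refine ⟨hX 0, hX 2, fun b => ⟨fun h => ?_, fun h => Ideal.pow_mem_of_mem _ (hX 1) b h⟩⟩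
  by_contra hb
  obtain rfl : b = 0 := by omega
  rw [pow_zero] at h
  exact (Ideal.ne_top_iff_one _).1 (IsLocalRing.maximalIdeal.isMaximal _).ne_top h

theorem isUnit_tr_X_mul {G : MvPowerSeries (Fin 3) (WittVector 2 k)}
    (hG : ¬ (2 : WittVector 2 k) ∣
      MvPowerSeries.coeff (Finsupp.single (0 : Fin 3) 1 + Finsupp.single (2 : Fin 3) 1) G) :
    IsUnit (tr (MvPowerSeries.X 1 * redPS 2 G) : MvPowerSeries (Fin 3) k) := by
  rw [MvPowerSeries.isUnit_iff_constantCoeff, ← MvPowerSeries.coeff_zero_eq_constantCoeff_apply,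
    coeff_tr, isUnit_iff_ne_zero, ne_eq, map_eq_zero_iff _ (RingEquiv.injective _), MvPowerSeries.X,
    show (2 • 0 + sqfreeExp Finset.univ : Fin 3 →₀ ℕ) =
      Finsupp.single 1 1 + (Finsupp.single (0 : Fin 3) 1 + Finsupp.single (2 : Fin 3) 1) by
        ext i; fin_cases i <;> simp,
    MvPowerSeries.coeff_add_monomial_mul, one_mul, redPS, MvPowerSeries.coeff_map]
  intro h
  apply hG
  have h1 : MvPowerSeries.coeff (Finsupp.single (0 : Fin 3) 1 + Finsupp.single (2 : Fin 3) 1) G ∈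
    RingHom.ker (WittVector.constantCoeff (p := 2) (R := k)) := h
  rw [WittVector.ker_constantCoeff] at h1
  exact_mod_cast Ideal.mem_span_singleton.1 h1

/-- The reductions modulo two of the equation `f` and of `(f ^ 2 - φ(f)) / 2` have the required
shape. -/
theorem exists_xzForm (n N : ℕ) (hN : 1 ≤ N) (G f : MvPowerSeries (Fin 3) (WittVector 2 k))
    (hG : ¬ (2 : WittVector 2 k) ∣
      MvPowerSeries.coeff (Finsupp.single (0 : Fin 3) 1 + Finsupp.single (2 : Fin 3) 1) G)
    (hf :
      f = MvPowerSeries.X 2 ^ 2 + MvPowerSeries.X 0 ^ 2 * MvPowerSeries.X 1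
          + MvPowerSeries.X 0 * MvPowerSeries.X 1 ^ n
          + MvPowerSeries.X 0 * MvPowerSeries.X 1 ^ N * MvPowerSeries.X 2
          + 2 * G ∨
      f = MvPowerSeries.X 2 ^ 2 + MvPowerSeries.X 0 ^ 2 * MvPowerSeries.X 1
          + MvPowerSeries.X 1 ^ n * MvPowerSeries.X 2
          + MvPowerSeries.X 0 * MvPowerSeries.X 1 ^ N * MvPowerSeries.X 2
          + 2 * G) :
    ∃ c, f ^ 2 = (powerSeriesSetting k).φ f + 2 * c ∧
      ∃ X : (powerSeriesCoords k).XZForm ((powerSeriesSetting k).red f)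
        ((powerSeriesSetting k).red c), X.N = N := by
  set D := powerSeriesSetting k with hD
  have hφX : ∀ i, D.φ (MvPowerSeries.X i) = MvPowerSeries.X i ^ 2 := frobLift_X 2
  have hrX : ∀ i, D.red (MvPowerSeries.X i) = MvPowerSeries.X i := MvPowerSeries.map_X _
  have h2 : (2 : MvPowerSeries (Fin 3) k) = 0 := D.two_eq_zero
  have hr2 : D.red 2 = 0 := (map_ofNat D.red 2).trans h2
  -- The half of `f ^ 2 - φ(f)` for a sum of four terms, each carried to its square by `φ`.
  have key : ∀ t : MvPowerSeries (Fin 3) (WittVector 2 k), D.φ t = t ^ 2 →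
      ∀ g : MvPowerSeries (Fin 3) (WittVector 2 k),
      g = MvPowerSeries.X 2 ^ 2 + MvPowerSeries.X 0 ^ 2 * MvPowerSeries.X 1 + t +
        MvPowerSeries.X 0 * MvPowerSeries.X 1 ^ N * MvPowerSeries.X 2 + 2 * G →
      ∃ c, g ^ 2 = D.φ g + 2 * c ∧
        D.red g = MvPowerSeries.X 2 ^ 2 + MvPowerSeries.X 0 ^ 2 * MvPowerSeries.X 1 + D.red t +
          MvPowerSeries.X 0 * MvPowerSeries.X 1 ^ N * MvPowerSeries.X 2 ∧
        D.red c = MvPowerSeries.X 2 ^ 2 * (MvPowerSeries.X 0 ^ 2 * MvPowerSeries.X 1) +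
          MvPowerSeries.X 2 ^ 2 * D.red t +
          MvPowerSeries.X 2 ^ 2 * (MvPowerSeries.X 0 * MvPowerSeries.X 1 ^ N * MvPowerSeries.X 2) +
          MvPowerSeries.X 0 ^ 2 * MvPowerSeries.X 1 * D.red t +
          MvPowerSeries.X 0 ^ 2 * MvPowerSeries.X 1 *
            (MvPowerSeries.X 0 * MvPowerSeries.X 1 ^ N * MvPowerSeries.X 2) +
          D.red t * (MvPowerSeries.X 0 * MvPowerSeries.X 1 ^ N * MvPowerSeries.X 2) +
          D.red G ^ 2 := by
    intro t ht g hg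
    let a : MvPowerSeries (Fin 3) (WittVector 2 k) := MvPowerSeries.X 2 ^ 2
    let b : MvPowerSeries (Fin 3) (WittVector 2 k) := MvPowerSeries.X 0 ^ 2 * MvPowerSeries.X 1
    let q : MvPowerSeries (Fin 3) (WittVector 2 k) :=
      MvPowerSeries.X 0 * MvPowerSeries.X 1 ^ N * MvPowerSeries.X 2
    refine ⟨a * b + a * t + a * q + b * t + b * q + t * q + 2 * (G * (a + b + t + q) + G ^ 2) -
      D.φ G, ?_, ?_, ?_⟩
    · rw [hg]
      simp only [map_add, map_mul D.φ, map_pow, map_ofNat, hφX, ht, a, b, q]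
      ring
    · rw [hg]
      simp only [map_add, map_mul D.red, map_pow, hr2, hrX, zero_mul, add_zero]
    · simp only [map_add, map_sub, map_mul D.red, map_pow, hr2, hrX, zero_mul, add_zero, D.red_φ, a,
        b, q]
      linear_combination (-D.red G ^ 2) * h2
  rcases hf with hf | hf
  · obtain ⟨c, h3, h4, h5⟩ := key (MvPowerSeries.X 0 * MvPowerSeries.X 1 ^ n) (by
      simp only [map_mul D.φ, map_pow, hφX]
      ring) f hf
    simp only [map_mul D.red, map_pow, hrX] at h4 h5
    exact ⟨c, h3, (powerSeriesCoords k).xzFormLeft n N (D.red G) hN (isUnit_tr_X_mul hG) h4 h5, rfl⟩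
  · obtain ⟨c, h3, h4, h5⟩ := key (MvPowerSeries.X 1 ^ n * MvPowerSeries.X 2) (by
      simp only [map_mul D.φ, map_pow, hφX]
      ring) f hf
    simp only [map_mul D.red, map_pow, hrX] at h4 h5
    exact ⟨c, h3, (powerSeriesCoords k).xzFormRight n N (D.red G) hN (isUnit_tr_X_mul hG) h4 h5,
      rfl⟩

end Concrete

end MultiHeight

theorem mainTheorem6 {k : Type u} [Field k] [CharP k 2] [PerfectRing k 2]
    (n : ℕ) (r : ℤ) (hr : r < n)
    (G f : MvPowerSeries (Fin 3) (WittVector 2 k))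
    (hG : ¬ (2 : WittVector 2 k) ∣
      MvPowerSeries.coeff (Finsupp.single (0 : Fin 3) 1 + Finsupp.single (2 : Fin 3) 1) G)
    (hf :
      f = MvPowerSeries.X 2 ^ 2 + MvPowerSeries.X 0 ^ 2 * MvPowerSeries.X 1
          + MvPowerSeries.X 0 * MvPowerSeries.X 1 ^ n
          + MvPowerSeries.X 0 * MvPowerSeries.X 1 ^ ((n : ℤ) - r).toNat * MvPowerSeries.X 2
          + 2 * G ∨
      f = MvPowerSeries.X 2 ^ 2 + MvPowerSeries.X 0 ^ 2 * MvPowerSeries.X 1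
          + MvPowerSeries.X 1 ^ n * MvPowerSeries.X 2
          + MvPowerSeries.X 0 * MvPowerSeries.X 1 ^ ((n : ℤ) - r).toNat * MvPowerSeries.X 2
          + 2 * G) :
    (∃ s t : ℕ, s < t ∧ ∀ i : ℕ,
      MultiHeight.xzAlpha (n - r) (s + i) = MultiHeight.xzAlpha (n - r) (t + i)) ∧
    (∃! h : ℕ → ℕ, MultiHeight.IsMultiHeight 2
      (MvPowerSeries (Fin 3) (WittVector 2 k) ⧸ Ideal.span {f}) h) ∧
    ∀ h : ℕ → ℕ, MultiHeight.IsMultiHeight 2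
        (MvPowerSeries (Fin 3) (WittVector 2 k) ⧸ Ideal.span {f}) h →
      (∀ i : ℕ, h i ≤ MultiHeight.xzE (n - r) i) ∧
      (∀ j : ℕ, h j < MultiHeight.xzE (n - r) j → ∀ i > j, h i = 1) ∧
      ∀ s t : ℕ, s < t →
        (∀ i : ℕ,
          MultiHeight.xzAlpha (n - r) (s + i) = MultiHeight.xzAlpha (n - r) (t + i)) →
        ((∃ j : ℕ, 2 ≤ h (t + j)) → ∀ i : ℕ, MultiHeight.xzE (n - r) i = h i) ∧
        (MultiHeight.possibleHeights (MultiHeight.xzE (n - r)) t).Finite ∧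
        h ∈ MultiHeight.possibleHeights (MultiHeight.xzE (n - r)) t := by
  obtain ⟨N, hN, hNr⟩ : ∃ N : ℕ, 1 ≤ N ∧ (n : ℤ) - r = N :=
    ⟨((n : ℤ) - r).toNat, by omega, by omega⟩
  rw [hNr] at hf ⊢
  rw [Int.toNat_natCast] at hf
  obtain ⟨c, hc, X, hXN⟩ := MultiHeight.exists_xzForm n N hN G f hG hf
  have S := MultiHeight.isXZSeq hN
  rw [← hXN] at S
  have := MultiHeight.charZero_mvPowerSeries_wittVector k (σ := Fin 3)
  have key := (MultiHeight.powerSeriesSetting k).isMultiHeight_iff X.ne_zero hc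
  have hP := MultiHeight.isXZ_maximalIdeal (k := k)
  refine ⟨MultiHeight.exists_xzAlpha_periodic hN, ?_, fun h hh => ?_⟩
  · simp only [key]
    exact MultiHeight.Coords.existsUnique_isLeast X hP S
  rw [key] at hh
  rw [hXN] at S
  subst hXN
  have hle := MultiHeight.Coords.height_le X hP S hh
  refine ⟨hle, fun j hj => MultiHeight.Coords.height_eq_one X hP S hh hj, fun s t hst hα => ?_⟩
  have heq : (∃ j : ℕ, 2 ≤ h (t + j)) → ∀ i : ℕ, MultiHeight.xzE X.N i = h i := fun hex i =>
    (MultiHeight.Coords.height_eq X hP S hh hst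
      (by simpa using congrArg (fun a : ℤ => (1 + a).toNat) (hα 0)) hex i).symm
  refine ⟨heq, MultiHeight.possibleHeights_finite _ _, ?_⟩
  by_cases hex : ∃ j : ℕ, 2 ≤ h (t + j)
  · exact Or.inr (funext fun i => (heq hex i).symm)
  · refine Or.inl ⟨fun i _ => ⟨(hh i).1.1, hle i⟩, fun i hi => ?_⟩
    have h1 := (hh i).1.1
    by_contra h2
    exact hex ⟨i - t, by rw [Nat.add_sub_cancel' hi.le]; omega⟩
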